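/- Let $k$ be an algebraically closed field of characteristic $0$, let $X$ be a smooth projective three-fold over $k$ (integral, of relative dimension $3$), and let $R$ be a discrete valuation ring which is a $k$-algebra, with uniformiser $\pi$. For $m\ge 1$ put $X_m = X\otimes_k R/\pi^m$, and for $1\le m'<m$ let $\iota_{m,m'}\colon X_{m'}\hookrightarrow X_m$ be the closed immersion induced by $R/\pi^m\to R/\pi^{m'}$. Let $D(X_m)$ be the unbounded derived category of the category $\mathrm{Coh}(X_m)$ of coherent sheaves, and $D^-(X_m)\subset D(X_m)$ the full subcategory of bounded above objects. Let $\mathrm{Coh}_{\le 1}(X_m)\subset \mathrm{Coh}(X_m)$ be the full subcategory of sheaves whose support has dimension at most $1$, and $\mathrm{Coh}_{\ge 2}(X_m)$ its right orthogonal, that is, the sheaves $F$ with $\mathrm{Hom}(T,F)=0$ for all $T\in \mathrm{Coh}_{\le 1}(X_m)$. Set $$D^{\le 0}(X_m)=\{E\in D(X_m) : H^0(E)\in \mathrm{Coh}_{\le 1}(X_m),\ H^i(E)=0 \text{ for all } i>0\},$$ $$D^{\ge 0}(X_m)=\{E\in D(X_m) : H^{-1}(E)\in \mathrm{Coh}_{\ge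 2}(X_m),\ H^i(E)=0 \text{ for all } i<-1\}.$$ Then $(D^{\le 0}(X_m),D^{\ge 0}(X_m))$ is a t-structure on $D(X_m)$ for every $m\ge 1$, and the left derived functor $L\iota_{m,m'}^*\colon D^-(X_m)\to D^-(X_{m'})$ of the pullback of coherent sheaves exists for all $1\le m'<m$. Let $\mathcal H^0=\tau^{\le 0}\tau^{\ge 0}$ denote the degree $0$ cohomology functor of this t-structure (on each $D(X_m)$); its values lie in the heart, hence in $D^{\le 0}(X_m)$. Then for all $1\le m''<m'<m$ there is an isomorphism of functors $D^{\le 0}(X_m)\to D^{\le 0}(X_{m''})$ $$\mathcal H^0 L\iota_{m,m''}^* \;\cong\; (\mathcal H^0 L\iota_{m',m''}^*)\circ(\mathcal H^0 L\iota_{m,m'}^*).$$ -/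

import Mathlib

open CategoryTheory CategoryTheory.Limits AlgebraicGeometry Opposite TopologicalSpace

universe u

/-- A right exact additive functor which preserves monomorphisms is left exact. -/
lemma preservesFiniteLimits_of_mono {C D : Type*} [Category C] [Category D] [Abelian C] [Abelian D]
    (F : C ⥤ D) [F.Additive] [PreservesFiniteColimits F] [F.PreservesMonomorphisms] :
    PreservesFiniteLimits F := by
  refine (F.preservesFiniteLimits_tfae.out 0 3).1 ?_
  intro S hS
  refine ⟨?_, ?_⟩
  · have := hS.epi_g
    exact hS.exact.map_of_epi_of_preservesCokernel F inferInstance inferInstance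
  · have := hS.mono_f
    infer_instance

namespace AlgebraicGeometry.Scheme.Modules

variable {X Y : Scheme.{u}}

lemma mono_of_injective {M N : X.Modules} (φ : M ⟶ N)
    (h : ∀ U : X.Opens, Function.Injective (φ.app U)) : Mono φ where
  right_cancellation g g' e := by
    ext U x
    apply h U
    have := congr($(congr(Hom.app $e U)) x)
    simpa using this

lemma injective_of_mono {M N : X.Modules} (φ : M ⟶ N) [Mono φ] (U : X.Opens) :
    Function.Injective (φ.app U) := by
  have : Mono ((toPresheaf X).map φ) := inferInstance
  have : Mono (((toPresheaf X).map φ).app (op U)) := inferInstance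
  exact (AddCommGrpCat.mono_iff_injective _).1 this

instance (f : X ⟶ Y) [IsOpenImmersion f] : (restrictFunctor f).Additive :=
  Functor.additive_of_iso (restrictFunctorIsoPullback f).symm

instance (f : X ⟶ Y) [IsOpenImmersion f] : PreservesFiniteLimits (restrictFunctor f) :=
  have : (restrictFunctor f).PreservesMonomorphisms :=
    ⟨fun φ _ ↦ mono_of_injective _ fun U ↦ injective_of_mono φ (f ''ᵁ U)⟩
  preservesFiniteLimits_of_mono _

end AlgebraicGeometry.Scheme.Modules

namespace AlgebraicGeometry

variable {R S : CommRingCat.{u}}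

instance : (tilde.functor R).PreservesMonomorphisms where
  preserves {M N} g _ := by
    refine Scheme.Modules.mono_of_injective _ fun U ↦ ?_
    have hb (r : R) : Function.Injective
        ((tilde.map g).app (PrimeSpectrum.basicOpen r)) := by
      have hg : Function.Injective g := (ModuleCat.mono_iff_injective _).1 inferInstance
      have key := tilde.toOpen_map_app g (PrimeSpectrum.basicOpen r)
      have h1 := IsLocalizedModule.map_injective (.powers r)
        (tilde.toOpen M (PrimeSpectrum.basicOpen r)).hom
        (tilde.toOpen N (PrimeSpectrum.basicOpen r)).hom g.hom hg
      have h2 : IsLocalizedModule.map (.powers r)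
        (tilde.toOpen M (PrimeSpectrum.basicOpen r)).hom
        (tilde.toOpen N (PrimeSpectrum.basicOpen r)).hom g.hom =
          ((modulesSpecToSheaf.map (tilde.map g)).hom.app (op (PrimeSpectrum.basicOpen r))).hom := by
        apply IsLocalizedModule.ext (.powers r) (tilde.toOpen M (PrimeSpectrum.basicOpen r)).hom
          (IsLocalizedModule.map_units (S := .powers r)
            (tilde.toOpen N (PrimeSpectrum.basicOpen r)).hom)
        rw [IsLocalizedModule.map_comp]
        exact congr(ModuleCat.Hom.hom $key).symm
      rw [h2] at h1
      exact h1
    rw [injective_iff_map_eq_zero]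
    intro x hx
    refine TopCat.Sheaf.eq_of_locally_eq' ⟨_, (tilde M).isSheaf⟩
      (fun i : {r : R // PrimeSpectrum.basicOpen r ≤ U} ↦ PrimeSpectrum.basicOpen i.1) U
      (fun i ↦ homOfLE i.2) ?_ _ _ fun i ↦ ?_
    · intro p hp
      obtain ⟨_, ⟨_, ⟨r, rfl⟩, rfl⟩, hr, hU⟩ :=
        PrimeSpectrum.isBasis_basic_opens.exists_subset_of_mem_open hp U.2
      exact Opens.mem_iSup.2 ⟨⟨r, hU⟩, hr⟩
    · apply hb i.1
      have key := congr($((tilde.map g).mapPresheaf.naturality (homOfLE i.2).op) x)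
      have hx' : ((tilde.map g).app U) x = 0 := hx
      have h0 : (tilde N).presheaf.map (homOfLE i.2).op (((tilde.map g).app U) x) = 0 :=
        (congrArg _ hx').trans (map_zero (AddCommGrpCat.Hom.hom _))
      have h1 : (tilde M).presheaf.map (homOfLE i.2).op 0 = 0 := map_zero (AddCommGrpCat.Hom.hom _)
      have h2 : (tilde.map g).app (PrimeSpectrum.basicOpen i.1)
          ((tilde M).presheaf.map (homOfLE i.2).op 0) = 0 :=
        (congrArg _ h1).trans (map_zero (AddCommGrpCat.Hom.hom _))
      exact (key.trans h0).trans h2.symm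

instance : PreservesFiniteLimits (tilde.functor R) := preservesFiniteLimits_of_mono _

open Scheme.Modules in
/-- The pullback of the sheaf associated with `N` along `Spec S ⟶ Spec R` is the sheaf associated
with `S ⊗[R] N`. -/
noncomputable def pullbackTilde (φ : R ⟶ S) (N : ModuleCat R) :
    (Scheme.Modules.pullback (Spec.map φ)).obj (tilde N) ≅
      tilde ((ModuleCat.extendScalars φ.hom).obj N) := by
  let e : Scheme.Modules.pushforward (Spec.map φ) ⋙ moduleSpecΓFunctor (R := R) ≅
      moduleSpecΓFunctor (R := S) ⋙ ModuleCat.restrictScalars φ.hom :=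
    Functor.isoWhiskerRight (pushforwardCompModulesSpecToSheafIso φ)
      (TopCat.Sheaf.forget _ _ ⋙ (evaluation _ _).obj (op ⊤))
  let adj := (tilde.adjunction (R := R)).comp (pullbackPushforwardAdjunction (Spec.map φ))
  let adj' := (ModuleCat.extendRestrictScalarsAdj φ.hom).comp (tilde.adjunction (R := S))
  exact (Adjunction.leftAdjointUniq (adj.ofNatIsoRight e) adj').app N

namespace Scheme

/-- A sheaf of modules on a locally Noetherian scheme is coherent if every point has an affine open
neighbourhood `U = Spec A` on which the sheaf is isomorphic to the sheaf associated with
a finitely generated `A`-module. -/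
def isCoherent (Y : Scheme.{u}) : ObjectProperty Y.Modules := fun M ↦
  ∀ y : Y, ∃ (U : Y.Opens) (hU : IsAffineOpen U), y ∈ U ∧
    ∃ N : ModuleCat.{u} Γ(Y, U), Module.Finite Γ(Y, U) N ∧
      Nonempty (M.restrict hU.fromSpec ≅ tilde N)

/-- `M` pulls back along `f` to the sheaf associated with a finitely generated module. -/
def FGOn {Y : Scheme.{u}} (M : Y.Modules) {R : CommRingCat.{u}} (f : Spec R ⟶ Y) : Prop :=
  ∃ N : ModuleCat.{u} R, Module.Finite R N ∧ Nonempty ((Modules.pullback f).obj M ≅ tilde N)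

lemma FGOn.comp {Y : Scheme.{u}} {M : Y.Modules} {R S : CommRingCat.{u}} {f : Spec R ⟶ Y}
    (h : FGOn M f) (g : Spec S ⟶ Spec R) : FGOn M (g ≫ f) := by
  obtain ⟨N, hN, ⟨e⟩⟩ := h
  obtain ⟨φ, rfl⟩ := Spec.map_surjective g
  refine ⟨(ModuleCat.extendScalars φ.hom).obj N, ?_, ⟨?_⟩⟩
  · algebraize [φ.hom]
    exact inferInstanceAs (Module.Finite S (TensorProduct R S N))
  · exact (Modules.pullbackComp _ _).symm.app M ≪≫ (Modules.pullback _).mapIso e ≪≫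
      pullbackTilde φ N

lemma FGOn.pullback {X Y : Scheme.{u}} {M : Y.Modules} {R : CommRingCat.{u}} {h : X ⟶ Y}
    {f : Spec R ⟶ X} : FGOn ((Modules.pullback h).obj M) f ↔ FGOn M (f ≫ h) :=
  exists_congr fun _ ↦ and_congr_right fun _ ↦
    ⟨fun ⟨e⟩ ↦ ⟨(Modules.pullbackComp f h).symm.app M ≪≫ e⟩,
      fun ⟨e⟩ ↦ ⟨(Modules.pullbackComp f h).app M ≪≫ e⟩⟩

lemma isCoherent_iff {Y : Scheme.{u}} (M : Y.Modules) :
    isCoherent Y M ↔ ∀ y : Y, ∃ (U : Y.Opens) (hU : IsAffineOpen U), y ∈ U ∧ FGOn M hU.fromSpec :=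
  forall_congr' fun _ ↦ exists_congr fun _ ↦ exists_congr fun _ ↦ and_congr_right fun _ ↦
    exists_congr fun _ ↦ and_congr_right fun _ ↦
    ⟨fun ⟨e⟩ ↦ ⟨(Modules.restrictFunctorIsoPullback _).symm.app M ≪≫ e⟩,
      fun ⟨e⟩ ↦ ⟨(Modules.restrictFunctorIsoPullback _).app M ≪≫ e⟩⟩

lemma FGOn.of_range_subset {Y : Scheme.{u}} {M : Y.Modules} {R S : CommRingCat.{u}}
    {f : Spec R ⟶ Y} [IsOpenImmersion f] (h : FGOn M f) (g : Spec S ⟶ Y)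
    (hg : Set.range g ⊆ Set.range f) : FGOn M g := by
  rw [← IsOpenImmersion.lift_fac f g hg]
  exact h.comp _

lemma isCoherent_pullback {X Y : Scheme.{u}} (f : X ⟶ Y) (M : Y.Modules) (h : isCoherent Y M) :
    isCoherent X ((Modules.pullback f).obj M) := by
  rw [isCoherent_iff] at h ⊢
  intro x
  obtain ⟨U, hU, hx, h⟩ := h (f x)
  obtain ⟨_, ⟨V, hV, rfl⟩, hxV, hVU⟩ :=
    X.isBasis_affineOpens.exists_subset_of_mem_open (show x ∈ f ⁻¹ᵁ U from hx) (f ⁻¹ᵁ U).2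
  refine ⟨V, hV, hxV, FGOn.pullback.2 (h.of_range_subset _ ?_)⟩
  rintro _ ⟨z, rfl⟩
  rw [hU.range_fromSpec]
  apply hVU
  rw [← hV.range_fromSpec]
  exact ⟨z, rfl⟩

/-- Two coherent sheaves are simultaneously described by modules near each point. -/
lemma exists_FGOn_FGOn {Y : Scheme.{u}} {M N : Y.Modules} (hM : isCoherent Y M)
    (hN : isCoherent Y N) (y : Y) :
    ∃ (U : Y.Opens) (hU : IsAffineOpen U), y ∈ U ∧ FGOn M hU.fromSpec ∧ FGOn N hU.fromSpec := by
  rw [isCoherent_iff] at hM hN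
  obtain ⟨U, hU, hy, h⟩ := hM y
  obtain ⟨U', hU', hy', h'⟩ := hN y
  obtain ⟨_, ⟨V, hV, rfl⟩, hyV, hVU⟩ :=
    Y.isBasis_affineOpens.exists_subset_of_mem_open (show y ∈ U ⊓ U' from ⟨hy, hy'⟩) (U ⊓ U').2
  refine ⟨V, hV, hyV, h.of_range_subset _ ?_, h'.of_range_subset _ ?_⟩
  · rw [hV.range_fromSpec, hU.range_fromSpec]
    exact fun z hz ↦ (hVU hz).1
  · rw [hV.range_fromSpec, hU'.range_fromSpec]
    exact fun z hz ↦ (hVU hz).2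

instance (Y : Scheme.{u}) : (isCoherent Y).IsClosedUnderIsomorphisms where
  of_iso e h y := by
    obtain ⟨U, hU, hy, N, hN, ⟨e'⟩⟩ := h y
    exact ⟨U, hU, hy, N, hN, ⟨(Modules.restrictFunctor hU.fromSpec).mapIso e.symm ≪≫ e'⟩⟩

open ZeroObject in
instance (Y : Scheme.{u}) : (isCoherent Y).ContainsZero where
  exists_zero := by
    refine ⟨0, isZero_zero _, fun y ↦ ?_⟩
    obtain ⟨_, ⟨V, hV, rfl⟩, hyV, -⟩ :=
      Y.isBasis_affineOpens.exists_subset_of_mem_open (Set.mem_univ y) isOpen_univ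
    have hV : IsAffineOpen V := hV
    refine ⟨V, hV, hyV, ModuleCat.of _ PUnit.{u + 1},
      inferInstanceAs (Module.Finite _ PUnit.{u + 1}), ⟨?_⟩⟩
    exact ((Modules.restrictFunctor hV.fromSpec).map_isZero (isZero_zero _)).iso
      ((tilde.functor _).map_isZero (ModuleCat.isZero_of_subsingleton _))

/-- Criterion used for the closure properties of coherent sheaves. -/
lemma isCoherent_of_local {Y : Scheme.{u}} {M N P : Y.Modules} (hM : isCoherent Y M)
    (hN : isCoherent Y N)
    (H : ∀ (U : Y.Opens) (hU : IsAffineOpen U) (A B : ModuleCat.{u} Γ(Y, U)),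
      Module.Finite Γ(Y, U) A → Module.Finite Γ(Y, U) B →
      (M.restrict hU.fromSpec ≅ tilde A) → (N.restrict hU.fromSpec ≅ tilde B) →
      ∃ C : ModuleCat.{u} Γ(Y, U), Module.Finite Γ(Y, U) C ∧
        Nonempty (P.restrict hU.fromSpec ≅ tilde C)) :
    isCoherent Y P := by
  intro y
  obtain ⟨U, hU, hy, ⟨A, hA, ⟨e⟩⟩, ⟨B, hB, ⟨e'⟩⟩⟩ := exists_FGOn_FGOn hM hN y
  exact ⟨U, hU, hy, H U hU A B hA hB
    ((Modules.restrictFunctorIsoPullback _).app M ≪≫ e)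
    ((Modules.restrictFunctorIsoPullback _).app N ≪≫ e')⟩

instance (Y : Scheme.{u}) [IsLocallyNoetherian Y] : (isCoherent Y).IsClosedUnderKernels where
  kernels_le := by
    rintro _ ⟨f, k, hk, hM, hN⟩
    refine isCoherent_of_local hM hN fun U hU A B hA hB e e' ↦ ?_
    have : IsNoetherianRing Γ(Y, U) := IsLocallyNoetherian.component_noetherian ⟨U, hU⟩
    let F := Modules.restrictFunctor hU.fromSpec
    let g : A ⟶ B := (tilde.functor _).preimage (e.inv ≫ F.map f ≫ e'.hom)
    have hg : (tilde.functor _).map g = e.inv ≫ F.map f ≫ e'.hom := Functor.map_preimage _ _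
    refine ⟨ModuleCat.of _ (LinearMap.ker g.hom), inferInstance, ⟨?_⟩⟩
    let e₁ : k.pt ≅ kernel f := IsLimit.conePointUniqueUpToIso hk (limit.isLimit _)
    exact F.mapIso e₁ ≪≫ PreservesKernel.iso F f ≪≫
      kernel.mapIso (F.map f) ((tilde.functor _).map g) e e' ((Iso.inv_comp_eq e).1 hg.symm) ≪≫
      (PreservesKernel.iso (tilde.functor _) g).symm ≪≫
      (tilde.functor _).mapIso (ModuleCat.kernelIsoKer g)

instance (Y : Scheme.{u}) : (isCoherent Y).IsClosedUnderCokernels where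
  cokernels_le := by
    rintro _ ⟨f, k, hk, hM, hN⟩
    refine isCoherent_of_local hM hN fun U hU A B hA hB e e' ↦ ?_
    let F := Modules.restrictFunctor hU.fromSpec
    let g : A ⟶ B := (tilde.functor _).preimage (e.inv ≫ F.map f ≫ e'.hom)
    have hg : (tilde.functor _).map g = e.inv ≫ F.map f ≫ e'.hom := Functor.map_preimage _ _
    refine ⟨ModuleCat.of _ (B ⧸ LinearMap.range g.hom), inferInstance, ⟨?_⟩⟩
    let e₁ : k.pt ≅ cokernel f := IsColimit.coconePointUniqueUpToIso hk (colimit.isColimit _)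
    exact F.mapIso e₁ ≪≫ PreservesCokernel.iso F f ≪≫
      cokernel.mapIso (F.map f) ((tilde.functor _).map g) e e' ((Iso.inv_comp_eq e).1 hg.symm) ≪≫
      (PreservesCokernel.iso (tilde.functor _) g).symm ≪≫
      (tilde.functor _).mapIso (ModuleCat.cokernelIsoRangeQuotient g)

instance (Y : Scheme.{u}) : (isCoherent Y).IsClosedUnderFiniteProducts := by
  have : (isCoherent Y).IsClosedUnderBinaryProducts := by
    refine ⟨?_⟩
    rintro P ⟨p⟩
    refine isCoherent_of_local (p.prop_diag_obj ⟨.left⟩) (p.prop_diag_obj ⟨.right⟩)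
      fun U hU A B hA hB e e' ↦ ?_
    let F := Modules.restrictFunctor hU.fromSpec
    refine ⟨ModuleCat.of _ (A × B), inferInstance, ⟨?_⟩⟩
    let h : IsLimit ((Cone.postcompose (diagramIsoPair p.diag).hom).obj ⟨P, p.π⟩) :=
      (IsLimit.postcomposeHomEquiv _ _).symm p.isLimit
    exact F.mapIso (IsLimit.conePointUniqueUpToIso h (limit.isLimit _)) ≪≫
      PreservesLimitPair.iso F _ _ ≪≫ prod.mapIso e e' ≪≫
      (PreservesLimitPair.iso (tilde.functor _) A B).symm ≪≫
      (tilde.functor _).mapIso ((biprod.isoProd A B).symm ≪≫ ModuleCat.biprodIsoProd A B)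
  exact ObjectProperty.IsClosedUnderFiniteProducts.mk'

/-- The category `Coh(Y)` of coherent sheaves on a (locally Noetherian) scheme `Y`. It is abelian
by the closure properties above. -/
abbrev Coh (Y : Scheme.{u}) := (isCoherent Y).FullSubcategory

noncomputable instance (Y : Scheme.{u}) [IsLocallyNoetherian Y] : HasDerivedCategory (Coh Y) :=
  HasDerivedCategory.standard _

/-- The (underived) pullback of coherent sheaves. -/
noncomputable def cohPullback {X Y : Scheme.{u}} (f : X ⟶ Y) : Coh Y ⥤ Coh X :=
  (isCoherent X).lift ((isCoherent Y).ι ⋙ Modules.pullback f)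
    fun M ↦ isCoherent_pullback f M.obj M.property

instance {X Y : Scheme.{u}} (f : X ⟶ Y) : (cohPullback f).Additive where
  map_add := by
    intros
    ext1
    exact (Modules.pullback f).map_add

/-- The support of a sheaf of modules: the set of points where the stalk is nonzero. -/
def supp {Y : Scheme.{u}} (M : Y.Modules) : Set Y := {y | ¬ IsZero (M.presheaf.stalk y)}

/-- `Coh_{≤ d}(Y)`: coherent sheaves whose support has dimension at most `d`. -/
def cohLE (Y : Scheme.{u}) (d : ℕ) : ObjectProperty (Coh Y) :=
  fun M ↦ topologicalKrullDim (supp M.obj) ≤ d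

/-- `Coh_{≥ d + 1}(Y)`: coherent sheaves which receive no nonzero morphism from an object of
`Coh_{≤ d}(Y)`. -/
def cohGESucc (Y : Scheme.{u}) (d : ℕ) : ObjectProperty (Coh Y) :=
  fun M ↦ ∀ (F : Coh Y), cohLE Y d F → ∀ φ : F ⟶ M, φ = 0

section Derived

variable (Y : Scheme.{u}) [IsLocallyNoetherian Y]

/-- The unbounded derived category `D(Y)` of coherent sheaves on `Y`. -/
abbrev DCoh := DerivedCategory (Coh Y)

/-- The bounded above derived category `D⁻(Y)` of coherent sheaves on `Y`. -/
abbrev DCohMinus := (DerivedCategory.TStructure.t (C := Coh Y)).minus.FullSubcategory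

/-- `D^{≤ 0}` for the tilted t-structure with heart `⟨Coh_{≤ 1}(Y), Coh_{≥ 2}(Y)[1]⟩`: the objects
`E` of `D(Y)` with `H^0(E)` in `Coh_{≤ 1}(Y)` and `H^i(E) = 0` for all `i > 0`. -/
def perverseLE : ObjectProperty (DCoh Y) := fun E ↦
  cohLE Y 1 ((DerivedCategory.homologyFunctor (Coh Y) 0).obj E) ∧
    ∀ i : ℤ, 0 < i → IsZero ((DerivedCategory.homologyFunctor (Coh Y) i).obj E)

/-- `D^{≥ 0}` for the tilted t-structure with heart `⟨Coh_{≤ 1}(Y), Coh_{≥ 2}(Y)[1]⟩`: the objects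
`E` of `D(Y)` with `H^{-1}(E)` in `Coh_{≥ 2}(Y)` and `H^i(E) = 0` for all `i < -1`. -/
def perverseGE : ObjectProperty (DCoh Y) := fun E ↦
  cohGESucc Y 1 ((DerivedCategory.homologyFunctor (Coh Y) (-1)).obj E) ∧
    ∀ i : ℤ, i < -1 → IsZero ((DerivedCategory.homologyFunctor (Coh Y) i).obj E)

/-- The t-structure on `D(Y)` with heart `⟨Coh_{≤ 1}(Y), Coh_{≥ 2}(Y)[1]⟩`. A t-structure is
determined by its parts `D^{≤ 0}` and `D^{≥ 0}`, so this type has at most one element. -/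
structure PerverseTStructure where
  /-- the t-structure -/
  t : Triangulated.TStructure (DCoh Y)
  le_zero : t.le 0 = perverseLE Y
  ge_zero : t.ge 0 = perverseGE Y

/-- `D^{≤ 0}` of the tilted t-structure consists of bounded above objects. -/
lemma perverseLE_le_minus :
    perverseLE Y ≤ (DerivedCategory.TStructure.t (C := Coh Y)).minus := fun E hE ↦
  ⟨0, (DerivedCategory.isLE_iff E 0).2 fun i hi ↦ hE.2 i hi⟩

/-- The inclusion of `D^{≤ 0}` of the tilted t-structure in `D⁻(Y)`. -/
noncomputable abbrev perverseLEToMinus : (perverseLE Y).FullSubcategory ⥤ DCohMinus Y :=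
  ObjectProperty.ιOfLE (perverseLE_le_minus Y)

variable {Y}

/-- The cohomology functor `τ^{≤ 0} τ^{≥ 0}` of the tilted t-structure. It takes values in the
heart; here it is considered as a functor to `D^{≤ 0}`. -/
noncomputable def PerverseTStructure.H0 (τ : PerverseTStructure Y) :
    DCoh Y ⥤ (perverseLE Y).FullSubcategory :=
  (perverseLE Y).lift (τ.t.truncGE 0 ⋙ τ.t.truncLE 0) fun E ↦ by
    rw [← τ.le_zero]
    exact τ.t.le_of_isLE ((τ.t.truncLE 0).obj ((τ.t.truncGE 0).obj E)) 0

end Derived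

section LeftDerived

variable (A B : Type*) [Category A] [Category B] [Abelian A] [Abelian B]

/-- Bounded above cochain complexes. -/
def boundedAbove : ObjectProperty (CochainComplex A ℤ) := fun K ↦ ∃ n : ℤ, K.IsStrictlyLE n

/-- The localization functor from bounded above cochain complexes to the bounded above derived
category. -/
noncomputable def minusQ [HasDerivedCategory A] : (boundedAbove A).FullSubcategory ⥤
    (DerivedCategory.TStructure.t (C := A)).minus.FullSubcategory :=
  ObjectProperty.lift _ ((boundedAbove A).ι ⋙ DerivedCategory.Q) fun ⟨K, n, hK⟩ ↦
    ⟨n, ⟨K, Iso.refl _, hK⟩⟩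

variable {A B}

/-- The functor on bounded above cochain complexes obtained by applying `F` degreewise. -/
noncomputable def mapBoundedAbove (F : A ⥤ B) [F.Additive] :
    (boundedAbove A).FullSubcategory ⥤ (boundedAbove B).FullSubcategory :=
  ObjectProperty.lift _ ((boundedAbove A).ι ⋙ F.mapHomologicalComplex (ComplexShape.up ℤ))
    fun ⟨K, n, hK⟩ ↦ ⟨n, by
      rw [CochainComplex.isStrictlyLE_iff]
      exact fun i hi ↦ F.map_isZero (K.isZero_of_isStrictlyLE n i hi)⟩

/-- The left derived functor `Lf^* : D⁻(Y) ⥤ D⁻(X)` of the pullback of coherent sheaves along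
`f : X ⟶ Y`, i.e. a functor with a natural transformation `Lf^* ∘ Q ⟶ Q ∘ f^*` (on bounded above
complexes) which is universal (terminal) among all pairs of this kind. It is unique up to a unique
isomorphism. -/
structure LeftDerivedPullback {X Y : Scheme.{u}} [IsLocallyNoetherian X] [IsLocallyNoetherian Y]
    (f : X ⟶ Y) where
  /-- the functor `Lf^*` -/
  functor : DCohMinus Y ⥤ DCohMinus X
  /-- the natural transformation `Lf^* ∘ Q ⟶ Q ∘ f^*` -/
  counit : minusQ (Coh Y) ⋙ functor ⟶ mapBoundedAbove (cohPullback f) ⋙ minusQ (Coh X)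
  universal : functor.IsRightKanExtension counit

/-- The composition of `Lf^*` and of the cohomology functor of the tilted t-structure, as
a functor from `D^{≤ 0}` of the tilted t-structure on `D(Y)` to that on `D(X)`. -/
noncomputable def LeftDerivedPullback.H0 {X Y : Scheme.{u}} [IsLocallyNoetherian X]
    [IsLocallyNoetherian Y] {f : X ⟶ Y} (L : LeftDerivedPullback f) (τ : PerverseTStructure X) :
    (perverseLE Y).FullSubcategory ⥤ (perverseLE X).FullSubcategory :=
  perverseLEToMinus Y ⋙ L.functor ⋙ ObjectProperty.ι _ ⋙ τ.H0

end LeftDerived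

end Scheme

section Threefold

attribute [local instance] MvPolynomial.gradedAlgebra

/-- `X` is a smooth projective three-fold over the field `k`: it is an integral closed subscheme of
some projective space over `k` and it is smooth of relative dimension `3`. -/
class IsSmoothProjectiveThreefold {k : Type u} [Field k] {X : Scheme.{u}}
    (s : X ⟶ Spec (CommRingCat.of k)) : Prop where
  isIntegral : IsIntegral X
  smooth : SmoothOfRelativeDimension 3 s
  projective : ∃ (n : ℕ)
    (i : X ⟶ Proj (MvPolynomial.homogeneousSubmodule (Fin (n + 1)) k)), IsClosedImmersion i ∧
      i ≫ Proj.toSpecZero _ ≫ Spec.map (CommRingCat.ofHom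
        (algebraMap k (MvPolynomial.homogeneousSubmodule (Fin (n + 1)) k 0))) = s

end Threefold

section Thickening

variable {k : Type u} [Field k] {X : Scheme.{u}} (s : X ⟶ Spec (CommRingCat.of k))
  {R : Type u} [CommRing R] [Algebra k R] (π : R)

/-- The scheme `X_m = X ⊗_k R / π ^ m`. -/
noncomputable def thickening (m : ℕ) : Scheme.{u} :=
  pullback s (Spec.map (CommRingCat.ofHom (algebraMap k (R ⧸ Ideal.span {π ^ m}))))

instance [IsNoetherianRing R] [h : IsSmoothProjectiveThreefold s] (m : ℕ) :
    IsLocallyNoetherian (thickening s π m) := by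
  have := h.smooth
  have : Smooth s := SmoothOfRelativeDimension.smooth 3 s
  unfold thickening
  exact LocallyOfFiniteType.isLocallyNoetherian (pullback.snd s _)

/-- The closed immersion `X_{m'} ⟶ X_m` for `m' ≤ m`. -/
noncomputable def thickeningMap {m' m : ℕ} (h : m' ≤ m) :
    thickening s π m' ⟶ thickening s π m :=
  pullback.map _ _ _ _ (𝟙 X)
    (Spec.map (CommRingCat.ofHom (Ideal.Quotient.factor (S := Ideal.span {π ^ m})
      (T := Ideal.span {π ^ m'}) (Ideal.span_singleton_le_span_singleton.2 (pow_dvd_pow π h)))))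
    (𝟙 _) (by simp) (by
      rw [Category.comp_id, ← Spec.map_comp]
      rfl)

end Thickening

end AlgebraicGeometry

/-! The derived pullback is controlled through a finite flat projection. Write `κ` for the residue
field `R / π`. In characteristic zero `κ` is formally smooth over `k`, so the surjection `R / π ^ m
→ κ`, whose kernel is nilpotent, has a `k`-algebra section (`exists_algHom_quotient_pow_finite`). It
makes `R / π ^ m` a finite and, `κ` being a field, flat `κ`-algebra. Hence there is a finite flat `p
: X_m ⟶ X_κ`, and its composite with `ι : X_{m'} ⟶ X_m` is flat as well.

Consequently sheaves `p^* N` are acyclic for `ι^*`, and `p^* p_* M ⟶ M` is epi because `p_*` is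
faithful. This gives enough acyclic objects without vector bundles or Tor. If `N(M)` is the kernel
of `p^* p_* M ⟶ M`, then `L_1 ι^*(M)` is the kernel of `ι^* N(M) ⟶ ι^* p^* p_* M` and the higher
derived functors of `M` are those of `N(M)` with a shift. Acyclicity is defined by this recursion,
and `Adjunction.isLeftAdapted` shows that the acyclic objects compute derived functors. For a
bounded above complex of such objects, `bijective_derivedUnit_comp` identifies `Hom(ι^* R, Y)` with
`Hom(R, ι_* Y)` in the derived categories. So the exact functor `ι_*` has a left adjoint on `D⁻`,
and this adjoint has the universal property of `Lι^*`.

The t-structure is the tilt at the torsion pair `(Coh_{≤ 1}, Coh_{≥ 2})`. The pair exists since, on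
a noetherian scheme, a coherent sheaf has a largest subsheaf with support of dimension at most `1`.

Since `ι` is a homeomorphism onto its image, `ι^*` preserves `Coh_{≤ 1}`. So `ι_*` preserves `Coh_{≥
2}` and is left t-exact, and its left adjoint `Lι^*` is right t-exact. For `E` in `D^{≤ 0}`, testing
against `W` in `D^{≥ 0}` shows that `Lι^* E ⟶ Lι^* τ^{≥ 0} E` becomes invertible under `τ^{≥ 0}`:
both sides see only `Hom(E, ι_* W)`. Thus `H^0 Lι^*` may be computed after replacing `E` by its
`H^0`. Together with `Lι_{m,m''}^* ≅ Lι_{m',m''}^* Lι_{m,m'}^*`, which is uniqueness of left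
adjoints, this is the claim (`nonempty_H0_iso`). -/

set_option linter.unusedSectionVars false

namespace CategoryTheory

/-- A class of objects which is suitable for computing the left derived functors of a right exact
functor `F`. -/
structure Functor.IsLeftAdapted {A B : Type*} [Category A] [Category B] [Abelian A] [Abelian B]
    (F : A ⥤ B) (P : ObjectProperty A) : Prop where
  mono_map_f : ∀ ⦃S : ShortComplex A⦄, S.ShortExact → P S.X₃ → Mono (F.map S.f)
  prop_X₁ : ∀ ⦃S : ShortComplex A⦄, S.ShortExact → P S.X₂ → P S.X₃ → P S.X₁
  prop_X₂ : ∀ ⦃S : ShortComplex A⦄, S.ShortExact → P S.X₁ → P S.X₃ → P S.X₂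
  exists_epi : ∀ M : A, ∃ (N : A) (π : N ⟶ M), P N ∧ Epi π

/-! ### Diagram chases for rows `K`, `L`, `M` and columns `1`, `2`, `3`. -/

section DiagramChase

variable {C : Type*} [Category C] [Abelian C] {K₁ K₂ K₃ L₁ L₂ L₃ M₁ M₂ M₃ : C}
  {kf : K₁ ⟶ K₂} {kg : K₂ ⟶ K₃} {lf : L₁ ⟶ L₂} {lg : L₂ ⟶ L₃} {mf : M₁ ⟶ M₂} {mg : M₂ ⟶ M₃}
  {i₁ : K₁ ⟶ L₁} {i₂ : K₂ ⟶ L₂} {i₃ : K₃ ⟶ L₃} {e₁ : L₁ ⟶ M₁} {e₂ : L₂ ⟶ M₂} {e₃ : L₃ ⟶ M₃}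

/-- Part of the nine lemma: the kernels of the columns form an exact sequence. -/
lemma exact_of_nine (wk : kf ≫ kg = 0) (wl : lf ≫ lg = 0) (w₁ : i₁ ≫ e₁ = 0)
    (c₁ : kf ≫ i₂ = i₁ ≫ lf) (c₂ : kg ≫ i₃ = i₂ ≫ lg) (d₁ : lf ≫ e₂ = e₁ ≫ mf) (w₂ : i₂ ≫ e₂ = 0)
    (hl : (ShortComplex.mk lf lg wl).Exact) (h₁ : (ShortComplex.mk i₁ e₁ w₁).Exact)
    [Mono i₂] [Mono mf] : (ShortComplex.mk kf kg wk).Exact := by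
  rw [ShortComplex.exact_iff_exact_up_to_refinements]
  intro T (x : T ⟶ K₂) (hx : x ≫ kg = 0)
  obtain ⟨T₁, π₁, _, y, hy⟩ := hl.exact_up_to_refinements (x ≫ i₂)
    (by simp [← c₂, reassoc_of% hx])
  dsimp only at y hy
  obtain ⟨T₂, π₂, _, z, hz⟩ := h₁.exact_up_to_refinements y (by
    rw [← cancel_mono mf]
    simp only [Category.assoc, ← d₁, zero_comp, ← reassoc_of% hy, w₂, comp_zero])
  dsimp only at z hz
  refine ⟨T₂, π₂ ≫ π₁, inferInstance, z, ?_⟩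
  dsimp only
  rw [← cancel_mono i₂]
  simp only [Category.assoc, c₁, hy, reassoc_of% hz]

/-- Part of the nine lemma: the map between the kernels of the columns is an epimorphism. -/
lemma epi_of_nine (wm : mf ≫ mg = 0) (wl : lf ≫ lg = 0) (w₂ : i₂ ≫ e₂ = 0)
    (c₂ : kg ≫ i₃ = i₂ ≫ lg) (d₁ : lf ≫ e₂ = e₁ ≫ mf) (d₂ : lg ≫ e₃ = e₂ ≫ mg) (w₃ : i₃ ≫ e₃ = 0)
    (hm : (ShortComplex.mk mf mg wm).Exact) (h₂ : (ShortComplex.mk i₂ e₂ w₂).Exact)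
    [Epi lg] [Epi e₁] [Mono i₃] : Epi kg := by
  rw [epi_iff_surjective_up_to_refinements]
  intro T x
  obtain ⟨T₁, π₁, _, y, hy⟩ := surjective_up_to_refinements_of_epi lg (x ≫ i₃)
  obtain ⟨T₂, π₂, _, z, hz⟩ := hm.exact_up_to_refinements (y ≫ e₂)
    (by simp [← d₂, ← reassoc_of% hy, w₃])
  dsimp only at z hz
  obtain ⟨T₃, π₃, _, t, ht⟩ := surjective_up_to_refinements_of_epi e₁ z
  obtain ⟨T₄, π₄, _, v, hv⟩ := h₂.exact_up_to_refinements (π₃ ≫ π₂ ≫ y - t ≫ lf)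
    (by simp [Preadditive.sub_comp, d₁, hz, reassoc_of% ht])
  dsimp only at v hv
  refine ⟨T₄, π₄ ≫ π₃ ≫ π₂ ≫ π₁, inferInstance, v, ?_⟩
  rw [← cancel_mono i₃]
  simp only [Category.assoc, c₂, hy, ← reassoc_of% hv, Preadditive.sub_comp,
    wl, comp_zero, sub_zero]

/-- If the kernel of `i₃` vanishes, then so does the kernel of the map between the cokernels of the
first two columns. -/
lemma mono_of_snake (wk : kf ≫ kg = 0) (wl : lf ≫ lg = 0) (w₁ : i₁ ≫ e₁ = 0) (w₂ : i₂ ≫ e₂ = 0)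
    (c₁ : kf ≫ i₂ = i₁ ≫ lf) (c₂ : kg ≫ i₃ = i₂ ≫ lg) (d₁ : lf ≫ e₂ = e₁ ≫ mf)
    (hk : (ShortComplex.mk kf kg wk).Exact) (h₂ : (ShortComplex.mk i₂ e₂ w₂).Exact)
    [Mono i₃] [Epi e₁] [Mono lf] : Mono mf := by
  rw [Preadditive.mono_iff_cancel_zero]
  intro T x hx
  obtain ⟨T₁, π₁, _, y, hy⟩ := surjective_up_to_refinements_of_epi e₁ x
  obtain ⟨T₂, π₂, _, z, hz⟩ := h₂.exact_up_to_refinements (y ≫ lf)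
    (by simp [d₁, ← reassoc_of% hy, hx])
  dsimp only at z hz
  obtain ⟨T₃, π₃, _, t, ht⟩ := hk.exact_up_to_refinements z (by
    rw [← cancel_mono i₃]
    simp only [Category.assoc, c₂, ← reassoc_of% hz, wl, comp_zero, zero_comp])
  dsimp only at t ht
  have h : π₃ ≫ π₂ ≫ y = t ≫ i₁ := by
    rw [← cancel_mono lf]
    simp only [Category.assoc, hz, ← c₁, reassoc_of% ht]
  rw [← cancel_epi π₁, ← cancel_epi π₂, ← cancel_epi π₃, hy, reassoc_of% h, w₁]
  simp

/-- A four lemma: an element killed by `i₂` dies in `K₃`, so it comes from `K₁`, where injectivity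
of `i₁` and `lf` kills it. -/
lemma mono_of_mono_of_mono (wk : kf ≫ kg = 0) (c₁ : kf ≫ i₂ = i₁ ≫ lf) (c₂ : kg ≫ i₃ = i₂ ≫ lg)
    (hk : (ShortComplex.mk kf kg wk).Exact) [Mono i₁] [Mono i₃] [Mono lf] : Mono i₂ := by
  rw [Preadditive.mono_iff_cancel_zero]
  intro T x hx
  obtain ⟨T₃, π₃, _, t, ht⟩ := hk.exact_up_to_refinements x (by
    rw [← cancel_mono i₃]
    simp only [Category.assoc, c₂, reassoc_of% hx, zero_comp])
  dsimp only at t ht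
  have h : t = 0 := by
    rw [← cancel_mono i₁, ← cancel_mono lf]
    simp only [Category.assoc, ← c₁, ← reassoc_of% ht, hx, comp_zero, zero_comp]
  rw [← cancel_epi π₃, ht, h, zero_comp, comp_zero]

end DiagramChase

/-! ### Acyclic objects for the comonad of an adjunction. -/

namespace Adjunction

variable {A A₁ B : Type*} [Category A] [Category A₁] [Category B]
  [Abelian A] [Abelian A₁] [Abelian B] {pb : A₁ ⥤ A} {pf : A ⥤ A₁} (adj : pb ⊣ pf)

/-- The kernel of the counit of an adjunction, as a functor. -/
noncomputable def kernelCounit : A ⥤ A where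
  obj M := kernel (adj.counit.app M)
  map φ := kernel.map _ _ (pb.map (pf.map φ)) φ (by simp)

/-- The inclusion of the kernel of the counit. -/
noncomputable def kernelCounitι : adj.kernelCounit ⟶ pf ⋙ pb where
  app M := kernel.ι (adj.counit.app M)
  naturality _ _ φ := by simp [kernelCounit]

instance (M : A) : Mono (adj.kernelCounitι.app M) :=
  inferInstanceAs (Mono (kernel.ι _))

@[simp]
lemma kernelCounitι_counit (M : A) : adj.kernelCounitι.app M ≫ adj.counit.app M = 0 :=
  kernel.condition _

lemma kernelCounitι_counit_assoc (M : A) {N : A} (φ : M ⟶ N) :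
    adj.kernelCounitι.app M ≫ adj.counit.app M ≫ φ = 0 := by
  rw [← Category.assoc, kernelCounitι_counit, zero_comp]

/-- The tautological short complex given by the kernel of the counit. -/
noncomputable abbrev kernelCounitShortComplex (M : A) : ShortComplex A :=
  ShortComplex.mk (adj.kernelCounitι.app M) (adj.counit.app M) (by simp)

lemma kernelCounitShortComplex_shortExact [pf.Faithful] (M : A) :
    (adj.kernelCounitShortComplex M).ShortExact where
  exact := ShortComplex.exact_of_f_is_kernel _ (kernelIsKernel _)
  mono_f := by dsimp; infer_instance
  epi_g := by dsimp; infer_instance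

instance [pb.Additive] [pf.Additive] : adj.kernelCounit.PreservesZeroMorphisms where
  map_zero M N := by
    rw [← cancel_mono (adj.kernelCounitι.app N), adj.kernelCounitι.naturality]
    simp

/-- Nine lemma for the columns kernel, comonad, identity: the last two rows are short exact because
`pf ⋙ pb` is exact, and the columns because faithfulness of `pf` makes the counit epi. -/
lemma kernelCounit_shortExact [pb.Additive] [pf.Additive] [pf.Faithful]
    [PreservesFiniteLimits pb] [PreservesFiniteColimits pb]
    [PreservesFiniteLimits pf] [PreservesFiniteColimits pf] {S : ShortComplex A}
    (hS : S.ShortExact) : (S.map adj.kernelCounit).ShortExact := by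
  have hΛ : (S.map (pf ⋙ pb)).ShortExact := hS.map_of_exact (pf ⋙ pb)
  have := hS.mono_f
  have := hS.epi_g
  have := hΛ.mono_f
  have := hΛ.epi_g
  have nf := adj.kernelCounitι.naturality S.f
  have ng := adj.kernelCounitι.naturality S.g
  have mf : Mono (adj.kernelCounit.map S.f) := by
    have : Mono (adj.kernelCounit.map S.f ≫ adj.kernelCounitι.app S.X₂) := by
      rw [nf]; exact mono_comp' inferInstance hΛ.mono_f
    exact mono_of_mono _ (adj.kernelCounitι.app S.X₂)
  exact
    { exact := exact_of_nine (mf := S.f) (i₁ := adj.kernelCounitι.app S.X₁)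
        (i₂ := adj.kernelCounitι.app S.X₂) (e₁ := adj.counit.app S.X₁) (e₂ := adj.counit.app S.X₂)
        _ (S.map (pf ⋙ pb)).zero (by simp) nf ng (adj.counit.naturality S.f) (by simp) hΛ.exact
        (adj.kernelCounitShortComplex_shortExact S.X₁).exact
      mono_f := mf
      epi_g := by
        have : Epi ((pf ⋙ pb).map S.g) := hΛ.epi_g
        change Epi (adj.kernelCounit.map S.g)
        exact epi_of_nine (lg := (pf ⋙ pb).map S.g) (i₂ := adj.kernelCounitι.app S.X₂) (i₃ := adj.kernelCounitι.app S.X₃)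
          (e₁ := adj.counit.app S.X₁) (e₂ := adj.counit.app S.X₂) (e₃ := adj.counit.app S.X₃)
          S.zero (S.map (pf ⋙ pb)).zero (adj.kernelCounitι_counit S.X₂) ng
          (adj.counit.naturality S.f) (adj.counit.naturality S.g) (adj.kernelCounitι_counit S.X₃) hS.exact
          (adj.kernelCounitShortComplex_shortExact S.X₂).exact }

variable (F : A ⥤ B)

/-- The condition that the first `n` left derived functors of `F`, computed by means of the
comonad attached to an adjunction, vanish on an object. -/
def IsAcyclicUpTo : ℕ → ObjectProperty A
  | 0 => fun _ ↦ True
  | n + 1 => fun M ↦ Mono (F.map (adj.kernelCounitι.app M)) ∧ IsAcyclicUpTo n (adj.kernelCounit.obj M)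

/-- The kernel of the counit at an object `pb.obj N` is only a summand of an object of that form, so
the induction in `isAcyclicUpTo_obj` needs stability under retracts. -/
lemma IsAcyclicUpTo.of_retract {n : ℕ} {M N : A} (h : IsAcyclicUpTo adj F n N) (r : Retract M N) :
    IsAcyclicUpTo adj F n M := by
  induction n generalizing M N with
  | zero => trivial
  | succ n hn =>
    have hr : adj.kernelCounit.map r.i ≫ adj.kernelCounit.map r.r = 𝟙 _ := by
      rw [← cancel_mono (adj.kernelCounitι.app M), Category.assoc, adj.kernelCounitι.naturality,
        adj.kernelCounitι.naturality_assoc, ← Functor.map_comp, r.retract]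
      simp
    refine ⟨?_, hn h.2 ⟨_, _, hr⟩⟩
    have := h.1
    have : IsSplitMono (adj.kernelCounit.map r.i) := ⟨⟨⟨_, hr⟩⟩⟩
    have : Mono (F.map (adj.kernelCounitι.app M) ≫ F.map ((pf ⋙ pb).map r.i)) := by
      rw [← F.map_comp, ← adj.kernelCounitι.naturality, F.map_comp]
      infer_instance
    exact mono_of_mono _ (F.map ((pf ⋙ pb).map r.i))

/-- The triangle identity splits the counit at `pb.obj N`. Its kernel is therefore a summand of
`pb.obj (pf.obj (pb.obj N))`, to which the induction hypothesis applies; `ρ` is the complementary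
projection. -/
lemma isAcyclicUpTo_obj (n : ℕ) (N : A₁) : IsAcyclicUpTo adj F n (pb.obj N) := by
  induction n generalizing N with
  | zero => trivial
  | succ n hn =>
    let ρ : (pf ⋙ pb).obj (pb.obj N) ⟶ adj.kernelCounit.obj (pb.obj N) :=
      kernel.lift _ (𝟙 _ - adj.counit.app (pb.obj N) ≫ pb.map (adj.unit.app N))
        (by simp [Preadditive.sub_comp])
    have hρ : adj.kernelCounitι.app (pb.obj N) ≫ ρ = 𝟙 _ := by
      rw [← cancel_mono (adj.kernelCounitι.app (pb.obj N)), Category.assoc]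
      have : ρ ≫ adj.kernelCounitι.app (pb.obj N) = _ := kernel.lift_ι _ _ _
      rw [this]
      simp [Preadditive.comp_sub, kernelCounitι_counit_assoc]
    have : IsSplitMono (adj.kernelCounitι.app (pb.obj N)) := ⟨⟨⟨_, hρ⟩⟩⟩
    exact ⟨inferInstance, (hn (pf.obj (pb.obj N))).of_retract adj F ⟨_, _, hρ⟩⟩

variable [pb.Additive] [pf.Additive] [pf.Faithful]
    [PreservesFiniteLimits pb] [PreservesFiniteColimits pb]
    [PreservesFiniteLimits pf] [PreservesFiniteColimits pf]
    [F.Additive] [PreservesFiniteColimits F] [(pb ⋙ F).PreservesMonomorphisms]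

lemma mono_map_counit_comonad {S : ShortComplex A} (hS : S.ShortExact) :
    Mono (F.map ((pf ⋙ pb).map S.f)) := by
  have := hS.mono_f
  exact inferInstanceAs (Mono ((pb ⋙ F).map (pf.map S.f)))

lemma map_kernelCounit_exact {S : ShortComplex A} (hS : S.ShortExact) :
    (ShortComplex.mk (F.map (adj.kernelCounit.map S.f)) (F.map (adj.kernelCounit.map S.g))
      (by simp [← Functor.map_comp])).Exact := by
  have hK := adj.kernelCounit_shortExact hS
  have := hK.epi_g
  exact hK.exact.map_of_epi_of_preservesCokernel F inferInstance inferInstance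

/-- The hypothesis plays the role of the vanishing of `L_1 F` on `S.X₃`. The conclusion is the snake
lemma for the image under `F` of the columns kernel, comonad, identity. -/
lemma mono_map_f_of_mono {S : ShortComplex A} (hS : S.ShortExact)
    (h : Mono (F.map (adj.kernelCounitι.app S.X₃))) : Mono (F.map S.f) := by
  have := mono_map_counit_comonad (pb := pb) (pf := pf) F hS
  have ex₂ := adj.kernelCounitShortComplex_shortExact S.X₂
  have := ex₂.epi_g
  exact mono_of_snake (i₁ := F.map (adj.kernelCounitι.app S.X₁))
    (i₂ := F.map (adj.kernelCounitι.app S.X₂)) (i₃ := F.map (adj.kernelCounitι.app S.X₃))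
    (e₁ := F.map (adj.counit.app S.X₁)) (e₂ := F.map (adj.counit.app S.X₂))
    (lf := F.map ((pf ⋙ pb).map S.f)) (lg := F.map ((pf ⋙ pb).map S.g)) _
    (by rw [← F.map_comp, ← Functor.map_comp, S.zero, Functor.map_zero, F.map_zero])
    (by simp [← Functor.map_comp]) (by simp [← Functor.map_comp])
    (by simp only [← Functor.map_comp, NatTrans.naturality])
    (by simp only [← Functor.map_comp, NatTrans.naturality])
    (by simp only [← Functor.map_comp, NatTrans.naturality, Functor.id_map])
    (adj.map_kernelCounit_exact F hS)
    (ex₂.exact.map_of_epi_of_preservesCokernel F inferInstance inferInstance)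

/-- In the long exact sequence `L_i F` of the first term sits between `L_{i+1} F` of the third and
`L_i F` of the second; hence the `n + 1` for `S.X₃`. -/
lemma IsAcyclicUpTo.prop_X₁ {n : ℕ} {S : ShortComplex A} (hS : S.ShortExact)
    (h₂ : IsAcyclicUpTo adj F n S.X₂) (h₃ : IsAcyclicUpTo adj F (n + 1) S.X₃) :
    IsAcyclicUpTo adj F n S.X₁ := by
  induction n generalizing S with
  | zero => trivial
  | succ n hn =>
    have hK := adj.kernelCounit_shortExact hS
    refine ⟨?_, hn hK h₂.2 h₃.2⟩
    have := adj.mono_map_f_of_mono F hK h₃.2.1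
    have : Mono (F.map (adj.kernelCounitι.app S.X₁) ≫ F.map ((pf ⋙ pb).map S.f)) := by
      rw [← F.map_comp, ← adj.kernelCounitι.naturality, F.map_comp]
      exact mono_comp' this h₂.1
    exact mono_of_mono _ (F.map ((pf ⋙ pb).map S.f))

lemma IsAcyclicUpTo.prop_X₂ {n : ℕ} {S : ShortComplex A} (hS : S.ShortExact)
    (h₁ : IsAcyclicUpTo adj F n S.X₁) (h₃ : IsAcyclicUpTo adj F n S.X₃) :
    IsAcyclicUpTo adj F n S.X₂ := by
  induction n generalizing S with
  | zero => trivial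
  | succ n hn =>
    refine ⟨?_, hn (adj.kernelCounit_shortExact hS) h₁.2 h₃.2⟩
    have := mono_map_counit_comonad (pb := pb) (pf := pf) F hS
    have := h₁.1
    have := h₃.1
    exact mono_of_mono_of_mono (i₁ := F.map (adj.kernelCounitι.app S.X₁))
      (i₃ := F.map (adj.kernelCounitι.app S.X₃)) (lf := F.map ((pf ⋙ pb).map S.f))
      (lg := F.map ((pf ⋙ pb).map S.g)) _
      (by simp only [← Functor.map_comp, NatTrans.naturality])
      (by simp only [← Functor.map_comp, NatTrans.naturality])
      (adj.map_kernelCounit_exact F hS)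

/-- Let `pb ⊣ pf` be an adjunction between exact functors, with `pf` faithful. If `F` is a right
exact functor such that `pb ⋙ F` is exact, then the objects on which the left derived functors
of `F` vanish are adapted to `F`. -/
lemma isLeftAdapted : F.IsLeftAdapted (fun M ↦ ∀ n, IsAcyclicUpTo adj F n M) where
  mono_map_f _ hS h₃ := adj.mono_map_f_of_mono F hS (h₃ 1).1
  prop_X₁ _ hS h₂ h₃ n := IsAcyclicUpTo.prop_X₁ adj F hS (h₂ n) (h₃ (n + 1))
  prop_X₂ _ hS h₁ h₃ n := IsAcyclicUpTo.prop_X₂ adj F hS (h₁ n) (h₃ n)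
  exists_epi M := ⟨_, adj.counit.app M, fun n ↦ adj.isAcyclicUpTo_obj F n _, inferInstance⟩

end Adjunction

end CategoryTheory

/-! ### Resolutions by adapted objects. -/

namespace CategoryTheory

open ZeroObject

variable {A B : Type*} [Category A] [Category B] [Abelian A] [Abelian B]

namespace Functor.IsLeftAdapted

variable {F : A ⥤ B} {P : ObjectProperty A} (h : F.IsLeftAdapted P)

include h

/-- A zero object is the kernel of the identity of any object satisfying `P`. -/
lemma prop_of_isZero {Z : A} (hZ : IsZero Z) : P Z := by
  obtain ⟨N, _, hN, -⟩ := h.exists_epi Z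
  let S : ShortComplex A := ShortComplex.mk (0 : Z ⟶ N) (𝟙 N) (by simp)
  have hS : S.ShortExact :=
    { exact := (S.exact_iff_mono (hZ.eq_of_src _ _)).2 (inferInstanceAs (Mono (𝟙 N)))
      mono_f := ⟨fun _ _ _ ↦ hZ.eq_of_tgt _ _⟩
      epi_g := inferInstanceAs (Epi (𝟙 N)) }
  exact h.prop_X₁ hS hN hN

lemma prop_of_iso {M N : A} (e : M ≅ N) (hN : P N) : P M := by
  let S : ShortComplex A := ShortComplex.mk e.hom (0 : N ⟶ 0) (by simp)
  have hS : S.ShortExact :=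
    { exact := (S.exact_iff_epi rfl).2 (inferInstanceAs (Epi e.hom))
      mono_f := inferInstanceAs (Mono e.hom)
      epi_g := ⟨fun _ _ _ ↦ (isZero_zero A).eq_of_src _ _⟩ }
  exact h.prop_X₁ hS hN (h.prop_of_isZero (isZero_zero A))

lemma prop_biprod {M N : A} (hM : P M) (hN : P N) : P (M ⊞ N) := by
  let S : ShortComplex A := ShortComplex.mk (biprod.inl : M ⟶ M ⊞ N) biprod.snd (by simp)
  have s : S.Splitting := { r := biprod.fst, s := biprod.inr }
  exact h.prop_X₂ s.shortExact hM hN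

end Functor.IsLeftAdapted

section Resolution

variable (P : ObjectProperty A)

/-- A step in the inductive construction of a resolution. -/
structure ResolutionStep {X₁ X₀ L₂ L₁ : A} (d : X₁ ⟶ X₀) (l : L₂ ⟶ L₁) (f : X₁ ⟶ L₁) where
  /-- the next object -/
  X₂ : A
  /-- the next differential -/
  d' : X₂ ⟶ X₁
  /-- the next component of the resolution -/
  f' : X₂ ⟶ L₂
  prop : P X₂
  zero : d' ≫ d = 0
  comm : d' ≫ f = f' ≫ l
  surj : ∀ ⦃T : A⦄ (x : T ⟶ X₁) (y : T ⟶ L₂), x ≫ d = 0 → x ≫ f = y ≫ l →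
    ∃ (T' : A) (π : T' ⟶ T) (_ : Epi π) (z : T' ⟶ X₂), π ≫ x = z ≫ d' ∧ π ≫ y = z ≫ f'

variable {P} (hP : ∀ M : A, ∃ (N : A) (π : N ⟶ M), P N ∧ Epi π)

include hP in
lemma ResolutionStep.nonempty {X₁ X₀ L₂ L₁ : A} (d : X₁ ⟶ X₀) (l : L₂ ⟶ L₁) (f : X₁ ⟶ L₁) :
    Nonempty (ResolutionStep P d l f) := by
  -- The new term covers the fibre product of `kernel d` and `L₂` over `L₁`. This one epimorphism
  -- gives both injectivity and surjectivity on homology.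
  obtain ⟨N, π, hN, _⟩ := hP (pullback (kernel.ι d ≫ f) l)
  exact ⟨{
    X₂ := N
    d' := π ≫ pullback.fst _ _ ≫ kernel.ι d
    f' := π ≫ pullback.snd _ _
    prop := hN
    zero := by simp
    comm := by simp [pullback.condition]
    surj := fun T x y hx hy ↦ by
      obtain ⟨T', p, _, z, hz⟩ := surjective_up_to_refinements_of_epi π
        (pullback.lift (kernel.lift d x hx) y (by rw [kernel.lift_ι_assoc, hy]))
      refine ⟨T', p, inferInstance, z, ?_, ?_⟩
      · rw [← reassoc_of% hz, pullback.lift_fst_assoc, kernel.lift_ι]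
      · rw [← reassoc_of% hz, pullback.lift_snd] }⟩

/-- A stage in the inductive construction of a resolution. -/
structure ResolutionStage (L : ChainComplex A ℕ) (n : ℕ) where
  /-- the source of the differential -/
  X₁ : A
  /-- the target of the differential -/
  X₀ : A
  /-- the differential -/
  d : X₁ ⟶ X₀
  /-- the resolution in degree `n + 1` -/
  f₁ : X₁ ⟶ L.X (n + 1)
  /-- the resolution in degree `n` -/
  f₀ : X₀ ⟶ L.X n

namespace ResolutionStage

variable (L : ChainComplex A ℕ)

/-- The zeroth step. -/
noncomputable def step₀ : ResolutionStep P (0 : (0 : A) ⟶ 0) (0 : L.X 0 ⟶ 0) 0 :=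
  (ResolutionStep.nonempty hP _ _ _).some

/-- The first step. -/
noncomputable def step₁ :
    ResolutionStep P (0 : (step₀ hP L).X₂ ⟶ 0) (L.d 1 0) (step₀ hP L).f' :=
  (ResolutionStep.nonempty hP _ _ _).some

/-- The next step. -/
noncomputable def step {n : ℕ} (s : ResolutionStage L n) :
    ResolutionStep P s.d (L.d (n + 2) (n + 1)) s.f₁ :=
  (ResolutionStep.nonempty hP _ _ _).some

/-- The stages of the resolution. -/
noncomputable def stages : ∀ n : ℕ, ResolutionStage L n
  | 0 => ⟨_, _, (step₁ hP L).d', (step₁ hP L).f', (step₀ hP L).f'⟩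
  | n + 1 => ⟨_, _, (step hP L (stages n)).d', (step hP L (stages n)).f', (stages n).f₁⟩

/-- The resolution of a chain complex. -/
noncomputable def complex : ChainComplex A ℕ :=
  ChainComplex.of (fun n ↦ (stages hP L n).X₀) (fun n ↦ (stages hP L n).d)
    fun n ↦ (step hP L (stages hP L n)).zero

lemma complex_d (n : ℕ) : (complex hP L).d (n + 1) n = (stages hP L n).d :=
  ChainComplex.of_d (fun n ↦ (stages hP L n).X₀) (fun n ↦ (stages hP L n).d) n

lemma stages_comm (n : ℕ) :
    (stages hP L n).d ≫ (stages hP L n).f₀ = (stages hP L n).f₁ ≫ L.d (n + 1) n := by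
  cases n with
  | zero => exact (step₁ hP L).comm
  | succ n => exact (step hP L (stages hP L n)).comm

/-- The map from the resolution. -/
noncomputable def map : complex hP L ⟶ L where
  f n := (stages hP L n).f₀
  comm' := by
    rintro _ i rfl
    rw [complex_d]
    exact (stages_comm hP L i).symm

lemma prop_complex_X (n : ℕ) : P ((complex hP L).X n) := by
  match n with
  | 0 => exact (step₀ hP L).prop
  | 1 => exact (step₁ hP L).prop
  | n + 2 => exact (step hP L (stages hP L n)).prop

lemma surj₀ ⦃T : A⦄ (y : T ⟶ L.X 0) :
    ∃ (T' : A) (π : T' ⟶ T) (_ : Epi π) (z : T' ⟶ (complex hP L).X 0),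
      π ≫ y = z ≫ (map hP L).f 0 := by
  obtain ⟨T', π, h, z, -, h'⟩ := (step₀ hP L).surj (0 : T ⟶ 0) y (by simp) (by simp)
  exact ⟨T', π, h, z, h'⟩

lemma surj₁ ⦃T : A⦄ (x : T ⟶ (complex hP L).X 0) (y : T ⟶ L.X 1)
    (hxy : x ≫ (map hP L).f 0 = y ≫ L.d 1 0) :
    ∃ (T' : A) (π : T' ⟶ T) (_ : Epi π) (z : T' ⟶ (complex hP L).X 1),
      π ≫ x = z ≫ (complex hP L).d 1 0 ∧ π ≫ y = z ≫ (map hP L).f 1 := by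
  rw [complex_d]
  exact (step₁ hP L).surj x y comp_zero hxy

lemma surj (n : ℕ) ⦃T : A⦄ (x : T ⟶ (complex hP L).X (n + 1)) (y : T ⟶ L.X (n + 2))
    (hx : x ≫ (complex hP L).d (n + 1) n = 0)
    (hxy : x ≫ (map hP L).f (n + 1) = y ≫ L.d (n + 2) (n + 1)) :
    ∃ (T' : A) (π : T' ⟶ T) (_ : Epi π) (z : T' ⟶ (complex hP L).X (n + 2)),
      π ≫ x = z ≫ (complex hP L).d (n + 2) (n + 1) ∧ π ≫ y = z ≫ (map hP L).f (n + 2) := by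
  rw [complex_d] at hx ⊢
  exact (step hP L (stages hP L n)).surj x y hx hxy

/-- Both halves come from the same lifting property. Applied to a cycle whose image is a boundary it
gives injectivity; applied with first component zero to a cycle of `L` it gives surjectivity. In
degree `0`, surjectivity comes from `surj₀`. -/
instance : QuasiIso (map hP L) where
  quasiIsoAt j := by
    rw [quasiIsoAt_iff_isIso_homologyMap]
    have h₁ : Mono (HomologicalComplex.homologyMap (map hP L) j) := by
      cases j with
      | zero =>
        rw [HomologicalComplex.mono_homologyMap_iff_up_to_refinements _ 1 0 0 (by simp) (by simp)]
        intro T x hx y hy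
        obtain ⟨T', π, h, z, hz, -⟩ := surj₁ hP L x y hy
        exact ⟨T', π, h, z, hz⟩
      | succ j =>
        rw [HomologicalComplex.mono_homologyMap_iff_up_to_refinements _ (j + 2) (j + 1) j
          (by simp) (by simp)]
        intro T x hx y hy
        obtain ⟨T', π, h, z, hz, -⟩ := surj hP L j x y hx hy
        exact ⟨T', π, h, z, hz⟩
    have h₂ : Epi (HomologicalComplex.homologyMap (map hP L) j) := by
      match j with
      | 0 =>
        rw [HomologicalComplex.epi_homologyMap_iff_up_to_refinements _ 1 0 0 (by simp) (by simp)]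
        intro T y hy
        obtain ⟨T', π, h, z, hz⟩ := surj₀ hP L y
        exact ⟨T', π, h, z, by simp, 0, by simpa using hz⟩
      | 1 =>
        rw [HomologicalComplex.epi_homologyMap_iff_up_to_refinements _ 2 1 0 (by simp) (by simp)]
        intro T y hy
        obtain ⟨T', π, h, z, hz, hz'⟩ := surj₁ hP L 0 y (by simpa using hy.symm)
        exact ⟨T', π, h, z, by simpa using hz.symm, 0, by simpa using hz'⟩
      | j + 2 =>
        rw [HomologicalComplex.epi_homologyMap_iff_up_to_refinements _ (j + 3) (j + 2) (j + 1)
          (by simp) (by simp)]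
        intro T y hy
        obtain ⟨T', π, h, z, hz, hz'⟩ := surj hP L j 0 y (by simp) (by simpa using hy.symm)
        exact ⟨T', π, h, z, by simpa using hz.symm, 0, by simpa using hz'⟩
    exact isIso_of_mono_of_epi _

end ResolutionStage

/-- Only the cohomology of `K` is bounded, so `K` is first replaced by its truncation, a chain
complex indexed by `ℕ`. Its resolution is then extended by zero, which is harmless since `P`
contains zero objects. -/
lemma Functor.IsLeftAdapted.exists_resolution {F : A ⥤ B} (h : F.IsLeftAdapted P)
    (K : CochainComplex A ℤ) (n : ℤ) [K.IsLE n] :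
    ∃ (R : CochainComplex A ℤ) (φ : R ⟶ K), R.IsStrictlyLE n ∧ (∀ i, P (R.X i)) ∧ QuasiIso φ := by
  let e := ComplexShape.embeddingUpIntLE n
  let L : ChainComplex A ℕ := K.truncLE' e
  let R := ResolutionStage.complex h.exists_epi L
  let φ : R ⟶ L := ResolutionStage.map h.exists_epi L
  have : QuasiIso φ := inferInstance
  have : QuasiIso (HomologicalComplex.ιTruncLE K e) :=
    inferInstanceAs (QuasiIso (CochainComplex.ιTruncLE K n))
  refine ⟨R.extend e, HomologicalComplex.extendMap φ e ≫ (K.truncLEIso e).inv ≫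
    HomologicalComplex.ιTruncLE K e,
    inferInstanceAs ((R.extend e).IsStrictlySupported e), fun i ↦ ?_, inferInstance⟩
  by_cases hi : ∃ j, e.f j = i
  · obtain ⟨j, hj⟩ := hi
    exact h.prop_of_iso (R.extendXIso e hj) (ResolutionStage.prop_complex_X h.exists_epi L j)
  · exact h.prop_of_isZero (R.isZero_extend_X e i (by simpa using hi))

end Resolution

/-! ### Right exact functors on complexes of adapted objects. -/

section Exactness

namespace Functor.IsLeftAdapted

variable {F : A ⥤ B} {P : ObjectProperty A} (h : F.IsLeftAdapted P)

/-- The short complex `Z^i ⟶ X^i ⟶ Z^{i+1}`. -/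
noncomputable abbrev cyclesShortComplex (K : CochainComplex A ℤ) (i j : ℤ) : ShortComplex A :=
  ShortComplex.mk (K.iCycles i) (K.toCycles i j) (by
    rw [← cancel_mono (K.iCycles j)]; simp)

lemma cyclesShortComplex_shortExact (K : CochainComplex A ℤ) (i j : ℤ) (hij : i + 1 = j)
    (hK : K.ExactAt j) : (cyclesShortComplex K i j).ShortExact where
  exact := by
    rw [ShortComplex.exact_iff_exact_up_to_refinements]
    intro T (x : T ⟶ K.X i) (hx : x ≫ K.toCycles i j = 0)
    have hx' : x ≫ K.d i j = 0 := by
      rw [← K.toCycles_i, reassoc_of% hx, zero_comp]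
    exact ⟨T, 𝟙 _, inferInstance, K.liftCycles x j (by simp [← hij]) hx', by
      rw [Category.id_comp, K.liftCycles_i]⟩
  mono_f := by dsimp; infer_instance
  epi_g := by
    change Epi (K.toCycles i j)
    rw [epi_iff_surjective_up_to_refinements]
    intro T x
    rw [K.exactAt_iff_exact_up_to_refinements i j (j + 1) (by simp [← hij]) (by simp)] at hK
    obtain ⟨T', π, hπ, y, hy⟩ := hK (x ≫ K.iCycles j) (by simp)
    exact ⟨T', π, hπ, y, by rw [← cancel_mono (K.iCycles j)]; simpa using hy⟩

include h

/-- Descending induction from degree `n + 1`, where the cycles vanish: `Z^i` is the kernel of the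
epimorphism `K^i ⟶ Z^{i+1}`. -/
lemma prop_cycles (K : CochainComplex A ℤ) (n : ℤ) [K.IsStrictlyLE n] (hP : ∀ i, P (K.X i))
    (hK : K.Acyclic) (i : ℤ) : P (K.cycles i) := by
  have key (m : ℕ) : ∀ i : ℤ, n + 1 ≤ i + m → P (K.cycles i) := by
    induction m with
    | zero =>
      intro i hi
      refine h.prop_of_isZero (IsZero.of_mono (K.iCycles i)
        (K.isZero_of_isStrictlyLE n i (by simp at hi; lia)))
    | succ m hm =>
      intro i hi
      exact h.prop_X₁ (cyclesShortComplex_shortExact K i (i + 1) rfl (hK _)) (hP i)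
        (hm (i + 1) (by push_cast at hi; lia))
  exact key (n + 1 - i).toNat i (by lia)

/-- An acyclic complex is spliced from the sequences `Z^j ⟶ K^j ⟶ Z^{j+1}`. All cycles satisfy `P`,
so `F` keeps these sequences short exact, and they can be spliced again. -/
lemma acyclic_map [F.Additive] [PreservesFiniteColimits F] (K : CochainComplex A ℤ) (n : ℤ)
    [K.IsStrictlyLE n] (hP : ∀ i, P (K.X i)) (hK : K.Acyclic) :
    HomologicalComplex.Acyclic ((F.mapHomologicalComplex (ComplexShape.up ℤ)).obj K) := by
  intro j
  rw [HomologicalComplex.exactAt_iff_exact_up_to_refinements _ (j - 1) j (j + 1)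
    (by simp) (by simp)]
  intro T (x : T ⟶ F.obj (K.X j)) (hx : x ≫ F.map (K.d j (j + 1)) = 0)
  have hS := cyclesShortComplex_shortExact K j (j + 1) rfl (hK _)
  have hS' := cyclesShortComplex_shortExact K (j - 1) j (by simp) (hK _)
  have := hS.epi_g
  have := hS'.epi_g
  -- The quotient of `K^{j+1}` by its cycles is `Z^{j+2}`, which satisfies `P`.
  have hm : Mono (F.map (K.iCycles (j + 1))) :=
    h.mono_map_f (cyclesShortComplex_shortExact K (j + 1) (j + 2) (by ring) (hK _))
      (h.prop_cycles K n hP hK _)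
  have ex := hS.exact.map_of_epi_of_preservesCokernel F inferInstance inferInstance
  obtain ⟨T₁, π₁, _, y, hy⟩ := ex.exact_up_to_refinements x (by
    change x ≫ F.map (K.toCycles j (j + 1)) = 0
    rw [← cancel_mono (F.map (K.iCycles (j + 1))), Category.assoc, ← F.map_comp, K.toCycles_i, hx,
      zero_comp])
  have : Epi (F.map (K.toCycles (j - 1) j)) := F.map_epi _
  obtain ⟨T₂, π₂, _, z, hz⟩ :=
    surjective_up_to_refinements_of_epi (F.map (K.toCycles (j - 1) j)) y
  have hy' : π₁ ≫ x = y ≫ F.map (K.iCycles j) := hy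
  have : (π₂ ≫ π₁) ≫ x = z ≫ F.map (K.d (j - 1) j) := by
    rw [Category.assoc, hy', ← K.toCycles_i, F.map_comp, ← reassoc_of% hz]
    exact (Category.assoc _ _ _).symm
  exact ⟨T₂, π₂ ≫ π₁, inferInstance, z, this⟩

omit h in
lemma quasiIso_iff_acyclic_mappingCone {K L : CochainComplex A ℤ} (φ : K ⟶ L) :
    QuasiIso φ ↔ (CochainComplex.mappingCone φ).Acyclic := by
  rw [← HomotopyCategory.quotient_obj_mem_subcategoryAcyclic_iff_acyclic,
    ← HomologicalComplex.mem_quasiIso_iff, ← HomotopyCategory.quotient_map_mem_quasiIso_iff,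
    HomotopyCategory.quasiIso_eq_trW_subcategoryAcyclic]
  exact ObjectProperty.trW_iff_of_distinguished _ _
    (HomotopyCategory.mappingCone_triangleh_distinguished φ)

/-- The mapping cone of `φ` is acyclic with terms `K^{i+1} ⊞ L^i` satisfying `P`, and `F` commutes
with mapping cones. -/
lemma quasiIso_map [F.Additive] [PreservesFiniteColimits F] {K L : CochainComplex A ℤ} (φ : K ⟶ L)
    (n : ℤ) [K.IsStrictlyLE n] [L.IsStrictlyLE n] (hK : ∀ i, P (K.X i)) (hL : ∀ i, P (L.X i))
    [hφ : QuasiIso φ] : QuasiIso ((F.mapHomologicalComplex (ComplexShape.up ℤ)).map φ) := by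
  rw [quasiIso_iff_acyclic_mappingCone] at hφ ⊢
  have : (CochainComplex.mappingCone φ).IsStrictlyLE n := by
    rw [CochainComplex.isStrictlyLE_iff]
    intro i hi
    refine IsZero.of_iso ?_ (HomologicalComplex.homotopyCofiber.XIsoBiprod φ i (i + 1) rfl)
    rw [biprod_isZero_iff]
    exact ⟨K.isZero_of_isStrictlyLE n (i + 1) (by lia), L.isZero_of_isStrictlyLE n i hi⟩
  exact fun j ↦ (h.acyclic_map (CochainComplex.mappingCone φ) n (fun i ↦ h.prop_of_iso
    (HomologicalComplex.homotopyCofiber.XIsoBiprod φ i (i + 1) rfl)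
    (h.prop_biprod (hK _) (hL _))) hφ j).of_iso
      (CochainComplex.mappingCone.mapHomologicalComplexIso φ F)

end Functor.IsLeftAdapted

end Exactness

end CategoryTheory

/-! ### The derived adjunction on adapted complexes. -/

namespace CategoryTheory

variable {A B : Type*} [Category A] [Category B] [Abelian A] [Abelian B]

namespace Adjunction

variable {F : A ⥤ B} {G : B ⥤ A} [F.Additive] [G.Additive] (adj : F ⊣ G)

/-- The adjunction on homological complexes induced by an adjunction between additive functors. -/
@[simps]
def mapHomologicalComplex {ι : Type*} (c : ComplexShape ι) :
    F.mapHomologicalComplex c ⊣ G.mapHomologicalComplex c where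
  unit := { app := fun K ↦ { f := fun i ↦ adj.unit.app (K.X i)
                             comm' := fun i j _ ↦ (adj.unit.naturality _).symm }
            naturality := fun K L φ ↦ by
              ext i
              exact adj.unit.naturality _ }
  counit := { app := fun K ↦ { f := fun i ↦ adj.counit.app (K.X i)
                               comm' := fun i j _ ↦ (adj.counit.naturality _).symm }
              naturality := fun K L φ ↦ by
                ext i
                exact adj.counit.naturality _ }
  left_triangle_components K := by
    ext i
    exact adj.left_triangle_components _
  right_triangle_components K := by
    ext i
    exact adj.right_triangle_components _

variable [HasDerivedCategory A] [HasDerivedCategory B]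
  [PreservesFiniteLimits G] [PreservesFiniteColimits G]

open _root_.DerivedCategory

/-- The unit of the derived adjunction. -/
noncomputable def derivedUnit :
    Q ⟶ F.mapHomologicalComplex (ComplexShape.up ℤ) ⋙ Q ⋙ G.mapDerivedCategory where
  app K := Q.map ((adj.mapHomologicalComplex (ComplexShape.up ℤ)).unit.app K) ≫
    G.mapDerivedCategoryFactors.inv.app _
  naturality K L φ := by
    have h₁ := (adj.mapHomologicalComplex (ComplexShape.up ℤ)).unit.naturality φ
    have h₂ := G.mapDerivedCategoryFactors.inv.naturality
      ((F.mapHomologicalComplex (ComplexShape.up ℤ)).map φ)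
    dsimp only [Functor.id_map, Functor.comp_map] at h₁ h₂ ⊢
    rw [Category.assoc, ← h₂, ← Q.map_comp_assoc, ← Q.map_comp_assoc, ← h₁]

/-- Translates the derived unit on morphisms coming from complexes into the ordinary adjunction of
complexes. -/
lemma derivedUnit_comp {K : CochainComplex A ℤ} {Y : CochainComplex B ℤ}
    (g : (F.mapHomologicalComplex (ComplexShape.up ℤ)).obj K ⟶ Y) :
    adj.derivedUnit.app K ≫ G.mapDerivedCategory.map (Q.map g) =
      Q.map ((adj.mapHomologicalComplex (ComplexShape.up ℤ)).homEquiv _ _ g) ≫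
        G.mapDerivedCategoryFactors.inv.app Y := by
  have h₂ := G.mapDerivedCategoryFactors.inv.naturality g
  dsimp only [Functor.comp_map] at h₂
  dsimp only [derivedUnit]
  rw [Category.assoc, ← h₂, ← Q.map_comp_assoc, homEquiv_unit]

end Adjunction

namespace Functor.IsLeftAdapted

open _root_.DerivedCategory

variable {F : A ⥤ B} {P : ObjectProperty A} (h : F.IsLeftAdapted P)

/-- A bounded above complex whose terms satisfy `P`. -/
structure IsAdaptedComplex (P : ObjectProperty A) (K : CochainComplex A ℤ) : Prop where
  exists_isStrictlyLE : ∃ n : ℤ, K.IsStrictlyLE n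
  prop (i : ℤ) : P (K.X i)

variable [HasDerivedCategory A] [HasDerivedCategory B]

include h

lemma isIso_Q_map [F.Additive] [PreservesFiniteColimits F] {K L : CochainComplex A ℤ} (φ : K ⟶ L)
    (hK : IsAdaptedComplex P K) (hL : IsAdaptedComplex P L) [hφ : IsIso (Q.map φ)] :
    IsIso (Q.map ((F.mapHomologicalComplex (ComplexShape.up ℤ)).map φ)) := by
  rw [isIso_Q_map_iff_quasiIso] at hφ ⊢
  obtain ⟨n, hn⟩ := hK.exists_isStrictlyLE
  obtain ⟨m, hm⟩ := hL.exists_isStrictlyLE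
  have := CochainComplex.isStrictlyLE_of_le K n (max n m) (by simp)
  have := CochainComplex.isStrictlyLE_of_le L m (max n m) (by simp)
  exact h.quasiIso_map φ (max n m) hK.prop hL.prop

lemma exists_adaptedComplex (K : CochainComplex A ℤ) (n : ℤ) [K.IsLE n] :
    ∃ (R : CochainComplex A ℤ) (φ : R ⟶ K), IsAdaptedComplex P R ∧ IsIso (Q.map φ) := by
  obtain ⟨R, φ, hR, hR', _⟩ := h.exists_resolution K n
  exact ⟨R, φ, ⟨⟨n, hR⟩, hR'⟩, inferInstance⟩

/-- The apex of a right fraction may be chosen bounded above, and precomposing with an adapted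
resolution of the apex makes it adapted. -/
lemma right_fac {R K : CochainComplex A ℤ} (hR : IsAdaptedComplex P R) (f : Q.obj R ⟶ Q.obj K) :
    ∃ (R' : CochainComplex A ℤ) (_ : IsAdaptedComplex P R') (s : R' ⟶ R) (_ : IsIso (Q.map s))
      (g : R' ⟶ K), Q.map s ≫ f = Q.map g := by
  obtain ⟨n, hn⟩ := hR.exists_isStrictlyLE
  obtain ⟨X, hX, s, hs, g, rfl⟩ := right_fac_of_isStrictlyLE f n
  obtain ⟨R', t, hR', ht⟩ := h.exists_adaptedComplex X n
  exact ⟨R', hR', t ≫ s, by rw [Q.map_comp]; infer_instance, t ≫ g, by simp⟩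

lemma exists_homotopy {R K : CochainComplex A ℤ} (hR : IsAdaptedComplex P R) (f : R ⟶ K)
    (hf : Q.map f = 0) :
    ∃ (R' : CochainComplex A ℤ) (_ : IsAdaptedComplex P R') (s : R' ⟶ R) (_ : IsIso (Q.map s)),
      Nonempty (Homotopy (s ≫ f) 0) := by
  have hf' : Qh.map ((HomotopyCategory.quotient A (ComplexShape.up ℤ)).map f) =
      Qh.map ((HomotopyCategory.quotient A (ComplexShape.up ℤ)).map 0) := by
    change Q.map f = Q.map 0
    rw [hf, Q.map_zero]
  obtain ⟨X, s, hs, hs'⟩ := (MorphismProperty.map_eq_iff_precomp Qh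
    (HomotopyCategory.quasiIso A (ComplexShape.up ℤ)) _ _).1 hf'
  obtain ⟨X, rfl⟩ := HomotopyCategory.quotient_obj_surjective X
  obtain ⟨s, rfl⟩ := (HomotopyCategory.quotient _ _).map_surjective s
  rw [HomotopyCategory.quotient_map_mem_quasiIso_iff, HomologicalComplex.mem_quasiIso_iff] at hs
  rw [← Functor.map_comp, ← Functor.map_comp, comp_zero] at hs'
  obtain ⟨n, hn⟩ := hR.exists_isStrictlyLE
  have : IsIso (Q.map s) := (isIso_Q_map_iff_quasiIso _ s).2 hs
  -- `X` is isomorphic to `R` in the derived category, hence cohomologically bounded above, and so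
  -- has an adapted resolution.
  have : CochainComplex.IsLE X n :=
    (isLE_Q_obj_iff X n).1 (TStructure.t.isLE_of_iso (asIso (Q.map s)).symm n)
  obtain ⟨R', t, hR', ht⟩ := h.exists_adaptedComplex X n
  refine ⟨R', hR', t ≫ s, by rw [Q.map_comp]; infer_instance, ⟨?_⟩⟩
  exact (Homotopy.ofEq (Category.assoc _ _ _)).trans
    (((HomotopyCategory.homotopyOfEq _ _ hs').compLeft t).trans (Homotopy.ofEq comp_zero))

variable {G : B ⥤ A} [F.Additive] [G.Additive] (adj : F ⊣ G)
  [PreservesFiniteLimits G] [PreservesFiniteColimits G] [PreservesFiniteColimits F]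

/-- On adapted complexes `F` preserves quasi-isomorphisms, so the adjunction of complexes passes to
fractions: left fractions give injectivity, and right fractions with adapted apex give surjectivity.
-/
lemma bijective_derivedUnit_comp {R : CochainComplex A ℤ} (hR : IsAdaptedComplex P R)
    (Y : DerivedCategory B) : Function.Bijective
      (fun φ : Q.obj ((F.mapHomologicalComplex (ComplexShape.up ℤ)).obj R) ⟶ Y ↦
        adj.derivedUnit.app R ≫ G.mapDerivedCategory.map φ) := by
  let Fc := F.mapHomologicalComplex (ComplexShape.up ℤ)
  let cadj := adj.mapHomologicalComplex (ComplexShape.up ℤ)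
  obtain ⟨Y, ⟨e⟩⟩ : ∃ Y', Nonempty (Q.obj Y' ≅ Y) := ⟨_, ⟨Q.objObjPreimageIso Y⟩⟩
  suffices Function.Bijective (fun φ : Q.obj (Fc.obj R) ⟶ Q.obj Y ↦
      adj.derivedUnit.app R ≫ G.mapDerivedCategory.map φ) by
    have h' := ((G.mapDerivedCategory.mapIso e).homToEquiv (Z := Q.obj R)).bijective.comp
      (this.comp (e.symm.homToEquiv (Z := Q.obj (Fc.obj R))).bijective)
    convert h' using 1
    ext φ
    simp [← Functor.map_comp]
  constructor
  · have key (φ : Q.obj (Fc.obj R) ⟶ Q.obj Y)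
        (hφ : adj.derivedUnit.app R ≫ G.mapDerivedCategory.map φ = 0) : φ = 0 := by
      obtain ⟨Y', g, s, hs, rfl⟩ := left_fac φ
      have hg : Q.map (cadj.homEquiv _ _ g) = 0 := by
        rw [← cancel_mono (G.mapDerivedCategoryFactors.inv.app Y'), zero_comp,
          ← adj.derivedUnit_comp, ← cancel_mono (G.mapDerivedCategory.map (CategoryTheory.inv (Q.map s))),
          Category.assoc, ← Functor.map_comp, hφ, zero_comp]
      -- The adjunct of the numerator vanishes in the derived category of `A`, so it becomes
      -- null-homotopic on a further adapted complex. Applying `F` and the counit makes the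
      -- numerator itself null-homotopic there.
      obtain ⟨R', hR', t, ht, ⟨H⟩⟩ := h.exists_homotopy hR _ hg
      have := h.isIso_Q_map t hR' hR
      have hg' : Q.map (Fc.map t ≫ g) = 0 := by
        have H' : Homotopy (Fc.map t ≫ g) 0 := by
          have H₁ := (F.mapHomotopy H).compRight (cadj.counit.app Y')
          refine (Homotopy.ofEq ?_).trans (H₁.trans (Homotopy.ofEq ?_))
          · rw [Functor.map_comp, Category.assoc]
            congr 1
            exact ((cadj.homEquiv_counit _ _ _).symm.trans (Equiv.symm_apply_apply _ _)).symm
          · simp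
        simpa using Q_map_eq_of_homotopy _ H'
      rw [Q.map_comp] at hg'
      have : Q.map g = 0 := by rw [← cancel_epi (Q.map (Fc.map t)), hg', comp_zero]
      rw [this, zero_comp]
    intro φ ψ hφ
    rw [← sub_eq_zero]
    apply key
    rw [Functor.map_sub, Preadditive.comp_sub]
    exact sub_eq_zero.2 hφ
  · intro f
    obtain ⟨R', hR', s, hs, g, hg⟩ :=
      h.right_fac hR (f ≫ G.mapDerivedCategoryFactors.hom.app Y)
    have := h.isIso_Q_map s hR' hR
    refine ⟨CategoryTheory.inv (Q.map (Fc.map s)) ≫ Q.map ((cadj.homEquiv _ _).symm g), ?_⟩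
    have h₁ := adj.derivedUnit.naturality s
    have h₂ := adj.derivedUnit_comp ((cadj.homEquiv _ _).symm g)
    dsimp only [Functor.comp_map] at h₁
    change adj.derivedUnit.app R ≫ G.mapDerivedCategory.map _ = _
    rw [← cancel_epi (Q.map s), reassoc_of% h₁, ← Functor.map_comp, IsIso.hom_inv_id_assoc, h₂,
      Equiv.apply_symm_apply, ← hg]
    simp

end Functor.IsLeftAdapted

end CategoryTheory

/-! ### Left derived functors as right Kan extensions. -/

namespace CategoryTheory

section KanExtension

variable {C D H : Type*} [Category C] [Category D] [Category H] {Q : C ⥤ D} {F : C ⥤ H}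
  {L : D ⥤ H} (α : Q ⋙ L ⟶ F) (W : ObjectProperty C)

/-- A criterion for a functor to be a left derived functor: it suffices that it is computed by
means of a class of objects which allow a calculus of fractions. -/
lemma isRightKanExtension_of_resolutions (hα : ∀ R, W R → IsIso (α.app R))
    (hW : ∀ E : D, ∃ R, W R ∧ Nonempty (Q.obj R ≅ E))
    (hfac : ∀ (R K : C) (_ : W R) (φ : Q.obj R ⟶ Q.obj K), ∃ (R' : C) (_ : W R') (s : R' ⟶ R)
      (_ : IsIso (Q.map s)) (g : R' ⟶ K), Q.map s ≫ φ = Q.map g) :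
    L.IsRightKanExtension α := by
  choose r hr e using hW
  replace e E := (e E).some
  have main (L' : D ⥤ H) (α' : Q ⋙ L' ⟶ F) :
      ∃ β : L' ⟶ L, Functor.whiskerLeft Q β ≫ α = α' := by
    -- Naturality along all morphisms `Q.obj R ⟶ Q.obj R'`, not only those coming from `C`. A
    -- fraction reduces it to the naturality of `α` and `α'`. It makes `β`, defined through chosen
    -- resolutions, natural.
    have key (R R' : C) (hR : W R) (hR' : W R') (φ : Q.obj R ⟶ Q.obj R') :
        have := hα R hR
        have := hα R' hR'
        L'.map φ ≫ α'.app R' ≫ inv (α.app R') = α'.app R ≫ inv (α.app R) ≫ L.map φ := by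
      intro _ _
      obtain ⟨R'', hR'', s, hs, g, hg⟩ := hfac R R' hR φ
      have := hα _ hR''
      have nat {K : C} (g : R'' ⟶ K) (hK : W K) : have := hα K hK
          L'.map (Q.map g) ≫ α'.app K ≫ inv (α.app K) =
            α'.app R'' ≫ inv (α.app R'') ≫ L.map (Q.map g) := by
        intro _
        have h₁ := α.naturality g
        have h₂ := α'.naturality g
        dsimp only [Functor.comp_map] at h₁ h₂
        rw [← cancel_mono (α.app K)]
        simp only [Category.assoc, IsIso.inv_hom_id, Category.comp_id, h₁, h₂,
          IsIso.inv_hom_id_assoc]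
      rw [← cancel_epi (L'.map (Q.map s)), ← L'.map_comp_assoc, hg, nat g hR',
        reassoc_of% (nat s hR), ← L.map_comp, hg]
    let β : L' ⟶ L :=
      { app := fun E ↦
          have := hα _ (hr E)
          L'.map (e E).inv ≫ α'.app (r E) ≫ inv (α.app (r E)) ≫ L.map (e E).hom
        naturality := fun E E' f ↦ by
          have := hα _ (hr E)
          have := hα _ (hr E')
          have h := key _ _ (hr E) (hr E') ((e E).hom ≫ f ≫ (e E').inv)
          dsimp only at h ⊢
          rw [← cancel_epi (L'.map (e E).hom), ← cancel_mono (L.map (e E').inv)]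
          simp only [Category.assoc, ← L.map_comp, Iso.hom_inv_id, L.map_id]
          rw [← L'.map_comp_assoc, ← L'.map_comp_assoc, ← L'.map_comp_assoc, Iso.hom_inv_id,
            L'.map_id, Category.id_comp, Category.assoc]
          exact (congrArg (_ ≫ ·) (congrArg (_ ≫ ·) (Category.comp_id _))).trans h }
    refine ⟨β, ?_⟩
    ext K
    obtain ⟨R, hR, s, hs, g, hg⟩ := hfac _ K (hr (Q.obj K)) (e (Q.obj K)).hom
    have := hα _ hR
    have := hα _ (hr (Q.obj K))
    have hg' : IsIso (Q.map g) := by rw [← hg]; infer_instance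
    have h₁ := α.naturality g
    have h₂ := α'.naturality g
    have h := key _ _ hR (hr (Q.obj K)) (Q.map s)
    dsimp only [Functor.comp_map] at h₁ h₂ h
    have hs' : Q.map g ≫ (e (Q.obj K)).inv = Q.map s := by rw [← hg]; simp
    rw [← cancel_epi (L'.map (Q.map g))]
    dsimp [β]
    rw [h₂, Category.assoc, Category.assoc, Category.assoc, ← L'.map_comp_assoc, hs', reassoc_of% h, ← L.map_comp_assoc, hg, h₁,
      IsIso.inv_hom_id_assoc]
  have uniq (L' : D ⥤ H) (β γ : L' ⟶ L)
      (h : Functor.whiskerLeft Q β ≫ α = Functor.whiskerLeft Q γ ≫ α) : β = γ := by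
    ext E
    have := hα _ (hr E)
    have h' := NatTrans.congr_app h (r E)
    dsimp at h'
    rw [← cancel_epi (L'.map (e E).hom), β.naturality, γ.naturality,
      (cancel_mono (α.app (r E))).1 h']
  exact ⟨⟨IsTerminal.ofUniqueHom
    (fun X ↦ CostructuredArrow.homMk (main X.left X.hom).choose (main X.left X.hom).choose_spec)
    fun X m ↦ by
      ext1
      exact uniq _ _ _ ((CostructuredArrow.w m).trans (main X.left X.hom).choose_spec.symm)⟩⟩

end KanExtension

variable {A B : Type*} [Category A] [Category B] [Abelian A] [Abelian B]
  [HasDerivedCategory A] [HasDerivedCategory B]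

open _root_.DerivedCategory Scheme

namespace Functor

/-- An exact functor induces a functor between bounded above derived categories. -/
noncomputable def mapMinus (G : B ⥤ A) [G.Additive] [PreservesFiniteLimits G]
    [PreservesFiniteColimits G] : Minus B ⥤ Minus A :=
  ObjectProperty.lift _ (Minus.ι ⋙ G.mapDerivedCategory) fun ⟨E, n, ⟨K, e, _⟩⟩ ↦
    ⟨n, ⟨(G.mapHomologicalComplex _).obj K,
      G.mapDerivedCategory.mapIso e ≪≫ G.mapDerivedCategoryFactors.app K, by
      rw [CochainComplex.isStrictlyLE_iff]
      exact fun i hi ↦ G.map_isZero (K.isZero_of_isStrictlyLE n i hi)⟩⟩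

variable {F : A ⥤ B} {G : B ⥤ A} [F.Additive] [G.Additive] (adj : F ⊣ G)
  [PreservesFiniteLimits G] [PreservesFiniteColimits G] [PreservesFiniteColimits F]

namespace IsLeftAdapted

variable {P : ObjectProperty A} (h : F.IsLeftAdapted P)

include h in
lemma exists_adaptedComplex_iso (E : Minus A) :
    ∃ R : (boundedAbove A).FullSubcategory, IsAdaptedComplex P R.obj ∧
      Nonempty ((minusQ A).obj R ≅ E) := by
  obtain ⟨E, n, ⟨K, e, _⟩⟩ := E
  obtain ⟨R, φ, hR, hφ⟩ := h.exists_adaptedComplex K n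
  let e' : Q.obj R ≅ Q.obj K := asIso (Q.map φ)
  exact ⟨⟨R, hR.1⟩, hR, ⟨ObjectProperty.isoMk _ (e' ≪≫ e.symm)⟩⟩

include h in
lemma bijective_minus {R : (boundedAbove A).FullSubcategory} (hR : IsAdaptedComplex P R.obj)
    (Y : Minus B) : Function.Bijective
      (fun φ : (mapBoundedAbove F ⋙ minusQ B).obj R ⟶ Y ↦
        (ObjectProperty.homMk (adj.derivedUnit.app R.obj) :
          (minusQ A).obj R ⟶ G.mapMinus.obj ((mapBoundedAbove F ⋙ minusQ B).obj R)) ≫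
            G.mapMinus.map φ) := by
  obtain ⟨h₁, h₂⟩ := h.bijective_derivedUnit_comp adj hR Y.obj
  refine ⟨fun φ ψ e ↦ ?_, fun f ↦ ?_⟩
  · ext1
    exact h₁ congr(($e).hom)
  · obtain ⟨φ, hφ⟩ := h₂ f.hom
    exact ⟨ObjectProperty.homMk φ, by ext1; exact hφ⟩

include h adj in
/-- The functor induced on bounded above derived categories by an exact right adjoint has a left
adjoint if there are enough objects adapted to the left adjoint. -/
lemma isRightAdjoint_mapMinus : (G.mapMinus (A := A)).IsRightAdjoint := by
  choose R hR e using h.exists_adaptedComplex_iso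
  replace e E := (e E).some
  exact (Adjunction.adjunctionOfEquivLeft (G := G.mapMinus (A := A))
    (fun E Y ↦ (Equiv.ofBijective _ (h.bijective_minus adj (hR E) Y)).trans
      (e E).homFromEquiv) (fun E Y Y' g f ↦ by simp)).isRightAdjoint

variable {L : Minus A ⥤ Minus B} (adj' : L ⊣ G.mapMinus)

/-- The natural transformation from the derived functor. -/
noncomputable def derivedCounit : minusQ A ⋙ L ⟶ mapBoundedAbove F ⋙ minusQ B where
  app K := (adj'.homEquiv _ _).symm (ObjectProperty.homMk (adj.derivedUnit.app K.obj))
  naturality K K' φ := by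
    dsimp only [Functor.comp_map]
    rw [← Adjunction.homEquiv_naturality_left_symm, ← Adjunction.homEquiv_naturality_right_symm]
    congr 1
    ext1
    exact adj.derivedUnit.naturality φ.hom

-- By Yoneda: precomposition with the counit at `R` is the bijection `bijective_minus` followed by
-- the adjunction bijection.
include h in
lemma isIso_derivedCounit {R : (boundedAbove A).FullSubcategory}
    (hR : IsAdaptedComplex P R.obj) : IsIso ((derivedCounit adj adj').app R) := by
  refine isIso_of_coyoneda_map_bijective _ fun Y ↦ ?_
  have e : (fun (φ : (mapBoundedAbove F ⋙ minusQ B).obj R ⟶ Y) ↦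
      (derivedCounit adj adj').app R ≫ φ) = (adj'.homEquiv _ _).symm ∘ _ :=
    funext fun φ ↦ (Adjunction.homEquiv_naturality_right_symm _ _ _).symm
  rw [e]
  exact (adj'.homEquiv _ _).symm.bijective.comp (h.bijective_minus adj hR Y)

include h in
lemma isRightKanExtension : L.IsRightKanExtension (derivedCounit adj adj') := by
  refine isRightKanExtension_of_resolutions _ (fun R ↦ IsAdaptedComplex P R.obj)
    (fun R hR ↦ h.isIso_derivedCounit adj adj' hR) h.exists_adaptedComplex_iso
    fun R K hR φ ↦ ?_
  obtain ⟨R', hR', s, hs, g, hg⟩ := h.right_fac hR φ.hom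
  let e' : Q.obj R' ≅ Q.obj R.obj := asIso (Q.map s)
  refine ⟨⟨R', hR'.1⟩, hR', ObjectProperty.homMk s, ?_, ObjectProperty.homMk g, ?_⟩
  · exact (ObjectProperty.isoMk _ e' :
      (minusQ A).obj ⟨R', hR'.1⟩ ≅ (minusQ A).obj R).isIso_hom
  · ext1
    exact hg

end IsLeftAdapted

end Functor

end CategoryTheory

/-! ### Tilting the standard t-structure at a torsion pair. -/

namespace DerivedCategory

open CategoryTheory.Pretriangulated CategoryTheory.Triangulated

variable {C : Type*} [Category C] [Abelian C] [HasDerivedCategory C]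

lemma isIso_homologyMap_mor₁ (T : Triangle (DerivedCategory C)) (hT : T ∈ distTriang _) (n₀ n₁ : ℤ)
    (h : n₀ + 1 = n₁) (h₀ : IsZero ((homologyFunctor C n₀).obj T.obj₃))
    (h₁ : IsZero ((homologyFunctor C n₁).obj T.obj₃)) :
    IsIso ((homologyFunctor C n₁).map T.mor₁) := by
  have := (HomologySequence.mono_homologyMap_mor₁_iff T hT n₀ n₁ h).2 (h₀.eq_of_src _ _)
  have := (HomologySequence.epi_homologyMap_mor₁_iff T hT n₁).2 (h₁.eq_of_tgt _ _)
  exact isIso_of_mono_of_epi _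

lemma isIso_homologyMap_mor₂ (T : Triangle (DerivedCategory C)) (hT : T ∈ distTriang _) (n₀ n₁ : ℤ)
    (h : n₀ + 1 = n₁) (h₀ : IsZero ((homologyFunctor C n₀).obj T.obj₁))
    (h₁ : IsZero ((homologyFunctor C n₁).obj T.obj₁)) :
    IsIso ((homologyFunctor C n₀).map T.mor₂) := by
  have := (HomologySequence.mono_homologyMap_mor₂_iff T hT n₀).2 (h₀.eq_of_src _ _)
  have := (HomologySequence.epi_homologyMap_mor₂_iff T hT n₀ n₁ h).2 (h₁.eq_of_tgt _ _)
  exact isIso_of_mono_of_epi _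

lemma isIso_homologyMap_truncGEπ (X : DerivedCategory C) (n i : ℤ) (h : n ≤ i) :
    IsIso ((homologyFunctor C i).map ((TStructure.t.truncGEπ n).app X)) :=
  isIso_homologyMap_mor₂ _ (TStructure.t.triangleLTGE_distinguished n X) i (i + 1) rfl
    (isZero_of_isLE _ (n - 1) _ (by lia)) (isZero_of_isLE _ (n - 1) _ (by lia))

lemma isIso_homologyMap_truncLEι (X : DerivedCategory C) (n i : ℤ) (h : i ≤ n) :
    IsIso ((homologyFunctor C i).map ((TStructure.t.truncLEι n).app X)) :=
  isIso_homologyMap_mor₁ _ (TStructure.t.triangleLEGT_distinguished n X) (i - 1) i (by lia)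
    (isZero_of_isGE ((TStructure.t.truncGT n).obj X) (n + 1) _ (by lia))
    (isZero_of_isGE ((TStructure.t.truncGT n).obj X) (n + 1) _ (by lia))

/-- An object in `D^{≤ 0}` maps to its cohomology in degree `0`. -/
lemma exists_hom_single_of_isLE (X : DerivedCategory C) [X.IsLE 0] :
    ∃ (M : C) (q : X ⟶ (singleFunctor C 0).obj M), IsIso ((homologyFunctor C 0).map q) ∧
      ∀ (Y : DerivedCategory C) [Y.IsGE 0] (f : X ⟶ Y), ∃ f', q ≫ f' = f := by
  have : ((TStructure.t.truncGE 0).obj X).IsLE 0 := by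
    rw [isLE_iff]
    intro i hi
    have := isIso_homologyMap_truncGEπ X 0 i hi.le
    exact (isZero_of_isLE X 0 i hi).of_iso
      (asIso ((homologyFunctor C i).map ((TStructure.t.truncGEπ 0).app X))).symm
  obtain ⟨M, ⟨e⟩⟩ := exists_iso_singleFunctor_obj_of_isGE_of_isLE
    ((TStructure.t.truncGE 0).obj X) 0
  refine ⟨M, (TStructure.t.truncGEπ 0).app X ≫ e.hom, ?_, fun Y _ f ↦ ?_⟩
  · have := isIso_homologyMap_truncGEπ X 0 0 le_rfl
    rw [Functor.map_comp]
    infer_instance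
  · obtain ⟨f', hf'⟩ := Triangle.yoneda_exact₂ _ (TStructure.t.triangleLTGE_distinguished 0 X) f
      (TStructure.t.zero_of_isLE_of_isGE _ (-1) 0 (by lia)
        (inferInstanceAs (TStructure.t.IsLE ((TStructure.t.truncLT 0).obj X) (0 - 1)))
        inferInstance)
    replace hf' : (TStructure.t.truncGEπ 0).app X ≫ f' = f := hf'.symm
    refine ⟨e.inv ≫ (show (TStructure.t.truncGE 0).obj X ⟶ Y from f'), ?_⟩
    rwa [Category.assoc, Iso.hom_inv_id_assoc]

/-- An object in `D^{≥ 0}` receives a morphism from its cohomology in degree `0`. -/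
lemma exists_hom_single_of_isGE (Y : DerivedCategory C) [Y.IsGE 0] :
    ∃ (N : C) (r : (singleFunctor C 0).obj N ⟶ Y), IsIso ((homologyFunctor C 0).map r) ∧
      ∀ (X : DerivedCategory C) [X.IsLE 0] (f : X ⟶ Y), ∃ f', f' ≫ r = f := by
  have : ((TStructure.t.truncLE 0).obj Y).IsGE 0 := by
    rw [isGE_iff]
    intro i hi
    have := isIso_homologyMap_truncLEι Y 0 i hi.le
    exact (isZero_of_isGE Y 0 i hi).of_iso
      (asIso ((homologyFunctor C i).map ((TStructure.t.truncLEι 0).app Y)))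
  obtain ⟨N, ⟨e⟩⟩ := exists_iso_singleFunctor_obj_of_isGE_of_isLE
    ((TStructure.t.truncLE 0).obj Y) 0
  refine ⟨N, e.inv ≫ (TStructure.t.truncLEι 0).app Y, ?_, fun X _ f ↦ ?_⟩
  · have := isIso_homologyMap_truncLEι Y 0 0 le_rfl
    rw [Functor.map_comp]
    infer_instance
  · exact ⟨TStructure.t.liftTruncLE f 0 ≫ e.hom, by simp⟩

/-- A torsion pair in an abelian category. -/
structure IsTorsionPair {A : Type*} [Category A] [Abelian A] (T F : ObjectProperty A) : Prop where
  torsion_iso : T.IsClosedUnderIsomorphisms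
  free_iso : F.IsClosedUnderIsomorphisms
  zero ⦃X Y : A⦄ (f : X ⟶ Y) : T X → F Y → f = 0
  exists_shortExact (M : A) : ∃ S : ShortComplex A, S.ShortExact ∧ S.X₂ = M ∧ T S.X₁ ∧ F S.X₃

namespace IsTorsionPair

variable {T F : ObjectProperty C} (h : IsTorsionPair T F)

/-- The aisle of the tilted t-structure. -/
def tiltLE (T : ObjectProperty C) (n : ℤ) : ObjectProperty (DerivedCategory C) := fun E ↦
  T ((homologyFunctor C n).obj E) ∧ ∀ i : ℤ, n < i → IsZero ((homologyFunctor C i).obj E)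

/-- The coaisle of the tilted t-structure. -/
def tiltGE (F : ObjectProperty C) (n : ℤ) : ObjectProperty (DerivedCategory C) := fun E ↦
  F ((homologyFunctor C (n - 1)).obj E) ∧
    ∀ i : ℤ, i < n - 1 → IsZero ((homologyFunctor C i).obj E)

/-- The homology of a shift. -/
noncomputable def homologyShiftIso (E : DerivedCategory C) (a i j : ℤ) (h : a + i = j) :
    (homologyFunctor C i).obj (E⟦a⟧) ≅ (homologyFunctor C j).obj E :=
  ((homologyFunctor C 0).shiftIso a i j h).app E

include h

lemma torsion_of_isZero {Z : C} (hZ : IsZero Z) : T Z := by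
  obtain ⟨S, hS, e, h₁, -⟩ := h.exists_shortExact Z
  have := hS.mono_f
  have := h.torsion_iso
  exact T.prop_of_iso ((IsZero.of_mono S.f (e ▸ hZ)).iso hZ) h₁

lemma free_of_isZero {Z : C} (hZ : IsZero Z) : F Z := by
  obtain ⟨S, hS, e, -, h₁⟩ := h.exists_shortExact Z
  have := hS.epi_g
  have := h.free_iso
  exact F.prop_of_iso ((IsZero.of_epi S.g (e ▸ hZ)).iso hZ) h₁

/-- For the standard t-structure `X` is `≤ 0` and `Y` is `≥ 0`, so `f` factors through a morphism
from `H^0(X)`, which is torsion, to `H^0(Y)`, which is torsion-free; note that `tiltGE F 1` puts `F`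
on `H^0`. -/
lemma hom_eq_zero {X Y : DerivedCategory C} (f : X ⟶ Y) (hX : tiltLE T 0 X)
    (hY : tiltGE F 1 Y) : f = 0 := by
  have := h.torsion_iso
  have := h.free_iso
  have : X.IsLE 0 := (isLE_iff _ _).2 hX.2
  have : Y.IsGE 0 := (isGE_iff _ _).2 hY.2
  obtain ⟨M, q, hq, hM⟩ := exists_hom_single_of_isLE X
  obtain ⟨N, r, hr, hN⟩ := exists_hom_single_of_isGE Y
  obtain ⟨f', rfl⟩ := hM Y f
  obtain ⟨f'', rfl⟩ := hN _ f'
  obtain ⟨g, rfl⟩ := (singleFunctor C 0).map_surjective f''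
  have : g = 0 := h.zero g
    (T.prop_of_iso (asIso ((homologyFunctor C 0).map q) ≪≫
      (singleFunctorCompHomologyFunctorIso C 0).app M) hX.1)
    (F.prop_of_iso ((asIso ((homologyFunctor C 0).map r)).symm ≪≫
      (singleFunctorCompHomologyFunctorIso C 0).app N) hY.1)
  rw [this, Functor.map_zero, zero_comp, comp_zero]

/-- `X` is the fibre of the morphism `p` from `A` to the torsion-free quotient of `H^0(A)`, placed
in degree `0`. -/
lemma exists_torsion_hom (A : DerivedCategory C) [A.IsLE 0] :
    ∃ (X : DerivedCategory C) (f : X ⟶ A), tiltLE T 0 X ∧ Mono ((homologyFunctor C 0).map f) ∧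
      F (cokernel ((homologyFunctor C 0).map f)) ∧
      ∀ i < 0, IsIso ((homologyFunctor C i).map f) := by
  have := h.torsion_iso
  have := h.free_iso
  obtain ⟨N, q, hq, -⟩ := exists_hom_single_of_isLE A
  obtain ⟨S, hS, rfl, hT, hF⟩ := h.exists_shortExact N
  let p : A ⟶ (singleFunctor C 0).obj S.X₃ := q ≫ (singleFunctor C 0).map S.g
  obtain ⟨X, f, δ, hf⟩ := distinguished_cocone_triangle₁ p
  have w : f ≫ p = 0 := comp_distTriang_mor_zero₁₂ _ hf
  let e := singleFunctorCompHomologyFunctorIso C 0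
  let θ : (homologyFunctor C 0).obj A ≅ S.X₂ := asIso ((homologyFunctor C 0).map q) ≪≫ e.app S.X₂
  have hθ : (homologyFunctor C 0).map p ≫ e.hom.app S.X₃ = θ.hom ≫ S.g := by
    dsimp [p, θ]
    rw [Functor.map_comp, Category.assoc, Category.assoc]
    exact congrArg (_ ≫ ·) (e.hom.naturality S.g)
  have := hS.mono_f
  have := hS.epi_g
  have hp : Epi ((homologyFunctor C 0).map p) := by
    have : Epi ((homologyFunctor C 0).map p ≫ e.hom.app S.X₃) := by rw [hθ]; infer_instance
    have h' : (homologyFunctor C 0).map p =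
      ((homologyFunctor C 0).map p ≫ e.hom.app S.X₃) ≫ e.inv.app S.X₃ := by simp
    rw [h']
    infer_instance
  have z (i : ℤ) (hi : i ≠ 0) :
      IsZero ((homologyFunctor C i).obj ((singleFunctor C 0).obj S.X₃)) := by
    obtain hi | hi := lt_or_gt_of_ne hi
    · exact isZero_of_isGE _ 0 i hi
    · exact isZero_of_isLE _ 0 i hi
  have hm : Mono ((homologyFunctor C 0).map f) :=
    (HomologySequence.mono_homologyMap_mor₁_iff _ hf (-1) 0).2
      ((z (-1) (by lia)).eq_of_src _ _)
  have ex : (ShortComplex.mk ((homologyFunctor C 0).map f) ((homologyFunctor C 0).map p)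
      (by rw [← Functor.map_comp, w, Functor.map_zero])).Exact :=
    HomologySequence.exact₂ _ hf 0
  let i₀ : ShortComplex.mk ((homologyFunctor C 0).map f ≫ θ.hom) S.g (by
      rw [Category.assoc, ← hθ, ← Functor.map_comp_assoc, w,
        Functor.map_zero, zero_comp]) ≅
      ShortComplex.mk ((homologyFunctor C 0).map f) ((homologyFunctor C 0).map p)
      (by rw [← Functor.map_comp, w, Functor.map_zero]) :=
    ShortComplex.isoMk (Iso.refl _) θ.symm (e.symm.app S.X₃) (by simp) (by
      dsimp
      rw [Iso.inv_comp_eq, ← reassoc_of% hθ]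
      simp)
  refine ⟨X, f, ⟨?_, fun i hi ↦ ?_⟩, hm, ?_, fun i hi ↦ ?_⟩
  · have ex' := ShortComplex.exact_of_iso i₀.symm ex
    have : Mono ((homologyFunctor C 0).map f ≫ θ.hom) := mono_comp _ _
    exact T.prop_of_iso (IsLimit.conePointUniqueUpToIso hS.exact.fIsKernel
      (ex'.fIsKernel)) hT
  · have : Mono ((homologyFunctor C i).map f) := by
      refine (HomologySequence.mono_homologyMap_mor₁_iff _ hf (i - 1) i (by lia)).2 ?_
      -- Degree `1` is the only positive degree where the connecting map needs an argument: it
      -- vanishes since `p` is epi on `H^0`.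
      obtain rfl | hi' := eq_or_ne i 1
      · exact (HomologySequence.epi_homologyMap_mor₂_iff _ hf 0 1 (by lia)).1 hp
      · exact (z (i - 1) (by lia)).eq_of_src _ _
    exact IsZero.of_mono ((homologyFunctor C i).map f) (isZero_of_isLE A 0 i hi)
  · exact F.prop_of_iso ((e.app S.X₃).symm ≪≫
      IsColimit.coconePointUniqueUpToIso ex.gIsCokernel (colimit.isColimit _)) hF
  · exact isIso_homologyMap_mor₁ _ hf (i - 1) i (by lia) (z _ (by lia)) (z _ (by lia))

/-- Let `Y` be the cone of the composite of `exists_torsion_hom` with `τ^{≤ 0} A ⟶ A`. Since `H^1(X)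
= 0`, `H^0(Y)` is the torsion-free cokernel. Negative cohomology of `Y` vanishes because `f` is iso
in negative degrees and mono in degree `0`. -/
lemma exists_triangle (A : DerivedCategory C) :
    ∃ (X Y : DerivedCategory C) (_ : tiltLE T 0 X) (_ : tiltGE F 1 Y)
      (f : X ⟶ A) (g : A ⟶ Y) (δ : Y ⟶ X⟦(1 : ℤ)⟧), Triangle.mk f g δ ∈ distTriang _ := by
  have := h.free_iso
  obtain ⟨X, f', hX, hf₀, hF, hf⟩ := h.exists_torsion_hom ((TStructure.t.truncLE 0).obj A)
  have hι (i : ℤ) (hi : i ≤ 0) := isIso_homologyMap_truncLEι A 0 i hi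
  let f : X ⟶ A := f' ≫ (TStructure.t.truncLEι 0).app A
  have hf' (i : ℤ) (hi : i < 0) : IsIso ((homologyFunctor C i).map f) := by
    have := hι i hi.le
    have := hf i hi
    dsimp only [f]
    rw [Functor.map_comp]
    infer_instance
  have hm : Mono ((homologyFunctor C 0).map f) := by
    have := hι 0 le_rfl
    dsimp only [f]
    rw [Functor.map_comp]
    infer_instance
  obtain ⟨Y, g, δ, hg⟩ := distinguished_cocone_triangle f
  refine ⟨X, Y, hX, ⟨?_, fun i hi ↦ ?_⟩, f, g, δ, hg⟩
  · have w : f ≫ g = 0 := comp_distTriang_mor_zero₁₂ _ hg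
    have ex : (ShortComplex.mk ((homologyFunctor C 0).map f) ((homologyFunctor C 0).map g)
      (by rw [← Functor.map_comp, w, Functor.map_zero])).Exact := HomologySequence.exact₂ _ hg 0
    have : Epi ((homologyFunctor C 0).map g) :=
      (HomologySequence.epi_homologyMap_mor₂_iff _ hg 0 1 (by lia)).2
        ((hX.2 1 (by lia)).eq_of_tgt _ _)
    have := hι 0 le_rfl
    exact F.prop_of_iso (cokernel.mapIso _ _ (Iso.refl _)
      (asIso ((homologyFunctor C 0).map ((TStructure.t.truncLEι 0).app A))) (by simp [f]) ≪≫
        IsColimit.coconePointUniqueUpToIso (colimit.isColimit _) ex.gIsCokernel) hF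
  · have h₁ : Mono ((homologyFunctor C (i + 1)).map f) := by
      obtain hi' | hi' : i + 1 < 0 ∨ i + 1 = 0 := by lia
      · have := hf' _ hi'
        infer_instance
      · rwa [hi']
    have := hf' i (by lia)
    have h₂ : (homologyFunctor C i).map g = 0 :=
      (HomologySequence.epi_homologyMap_mor₁_iff _ hg i).1
        (inferInstanceAs (Epi ((homologyFunctor C i).map f)))
    have h₃ := (HomologySequence.mono_homologyMap_mor₁_iff _ hg i (i + 1) rfl).1 h₁
    have h₄ : Epi ((homologyFunctor C i).map g) :=
      (HomologySequence.epi_homologyMap_mor₂_iff _ hg i (i + 1) rfl).2 h₃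
    exact IsZero.of_epi_eq_zero _ h₂

/-- The tilted t-structure attached to a torsion pair. -/
noncomputable def tilt : TStructure (DerivedCategory C) where
  le := tiltLE T
  ge := tiltGE F
  le_isClosedUnderIsomorphisms n := by
    have := h.torsion_iso
    exact ⟨fun e hX ↦ ⟨T.prop_of_iso ((homologyFunctor C _).mapIso e) hX.1,
      fun i hi ↦ (hX.2 i hi).of_iso ((homologyFunctor C _).mapIso e).symm⟩⟩
  ge_isClosedUnderIsomorphisms n := by
    have := h.free_iso
    exact ⟨fun e hX ↦ ⟨F.prop_of_iso ((homologyFunctor C _).mapIso e) hX.1,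
      fun i hi ↦ (hX.2 i hi).of_iso ((homologyFunctor C _).mapIso e).symm⟩⟩
  le_shift n a n' hn X hX := by
    have := h.torsion_iso
    exact ⟨T.prop_of_iso (homologyShiftIso X a n' n hn).symm hX.1,
      fun i hi ↦ (hX.2 (a + i) (by lia)).of_iso (homologyShiftIso X a i _ rfl)⟩
  ge_shift n a n' hn X hX := by
    have := h.free_iso
    exact ⟨F.prop_of_iso (homologyShiftIso X a (n' - 1) (n - 1) (by lia)).symm hX.1,
      fun i hi ↦ (hX.2 (a + i) (by lia)).of_iso (homologyShiftIso X a i _ rfl)⟩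
  zero' _ _ f hX hY := h.hom_eq_zero f hX hY
  le_zero_le X hX := ⟨h.torsion_of_isZero (hX.2 1 (by lia)), fun i hi ↦ hX.2 i (by lia)⟩
  ge_one_le X hX := ⟨h.free_of_isZero (hX.2 (0 - 1) (by lia)), fun i hi ↦ hX.2 i (by lia)⟩
  exists_triangle_zero_one := h.exists_triangle

end IsTorsionPair

end DerivedCategory

/-! ### t-exactness and adjunctions. -/

namespace CategoryTheory

open Pretriangulated Triangulated

section TStructure

variable {D D' : Type*} [Category D] [Category D'] [Preadditive D] [Preadditive D'] [HasZeroObject D]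
  [HasZeroObject D'] [HasShift D ℤ] [HasShift D' ℤ] [∀ n : ℤ, (shiftFunctor D n).Additive]
  [∀ n : ℤ, (shiftFunctor D' n).Additive] [Pretriangulated D] [Pretriangulated D']
  [CategoryTheory.IsTriangulated D] [CategoryTheory.IsTriangulated D']

lemma Triangulated.TStructure.exists_comp_eq_of_isIso_truncGE_map (t : TStructure D) {n : ℤ}
    {X X' W : D} (g : X ⟶ X') [IsIso ((t.truncGE n).map g)] [t.IsGE W n] (f : X ⟶ W) :
    ∃ f' : X' ⟶ W, g ≫ f' = f :=
  ⟨(t.truncGEπ n).app X' ≫ inv ((t.truncGE n).map g) ≫ t.descTruncGE f n, by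
    rw [← Category.assoc, ← t.truncGEπ_naturality, Category.assoc, IsIso.hom_inv_id_assoc,
      t.π_descTruncGE]⟩

lemma Triangulated.TStructure.comp_cancel_of_isIso_truncGE_map (t : TStructure D) {n : ℤ}
    {X X' W : D} (g : X ⟶ X') [IsIso ((t.truncGE n).map g)] [t.IsGE W n] {a b : X' ⟶ W}
    (h : g ≫ a = g ≫ b) : a = b := by
  rw [← t.π_descTruncGE a n, ← t.π_descTruncGE b n] at h ⊢
  congr 1
  rw [← cancel_epi ((t.truncGE n).map g)]
  apply t.from_truncGE_obj_ext
  simpa only [← t.truncGEπ_naturality_assoc] using h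

namespace Adjunction

variable {M : ObjectProperty D} {M' : ObjectProperty D'} {L : M.FullSubcategory ⥤ M'.FullSubcategory}
  {G : M'.FullSubcategory ⥤ M.FullSubcategory} (adj : L ⊣ G)
  (t : TStructure D) (t' : TStructure D')

include adj in
/-- The left adjoint of a left t-exact functor is right t-exact. -/
lemma isLE_obj [M'.IsTriangulated] [M'.IsClosedUnderIsomorphisms] (hM' : t'.le 0 ≤ M')
    (hG : ∀ Y : M'.FullSubcategory, t'.IsGE Y.obj 1 → t.IsGE (G.obj Y).obj 1)
    (X : M.FullSubcategory) [t.IsLE X.obj 0] : t'.IsLE (L.obj X).obj 0 := by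
  rw [t'.isLE_iff_isZero_truncGE_obj 0 1 rfl]
  let Z := (L.obj X).obj
  -- The adjunction lives on `M'`, so the truncation must be placed there: it is the third vertex of
  -- a triangle whose other vertices lie in `M'`.
  have hW : M' ((t'.truncGE 1).obj Z) :=
    M'.ext_of_isTriangulatedClosed₃ _ (t'.triangleLTGE_distinguished 1 Z) (by
      have : t'.IsLE ((t'.truncLT 1).obj Z) 0 := t'.isLE_truncLT_obj _ _ _
      exact hM' _ (t'.le_of_isLE ((t'.truncLT 1).obj Z) 0)) (L.obj X).property
  let W : M'.FullSubcategory := ⟨(t'.truncGE 1).obj Z, hW⟩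
  let p : L.obj X ⟶ W := ObjectProperty.homMk ((t'.truncGEπ 1).app Z)
  have : t.IsGE (G.obj W).obj 1 := hG W (inferInstanceAs (t'.IsGE ((t'.truncGE 1).obj Z) 1))
  have h0 : ((adj.homEquiv _ _) p).hom = 0 := t.zero_of_isLE_of_isGE _ 0 1 (by simp) ‹_› ‹_›
  have hp : p = (adj.homEquiv _ _).symm (ObjectProperty.homMk 0) := by
    rw [Equiv.eq_symm_apply]
    ext1
    exact h0
  -- No additivity of the adjunction is needed: the adjuncts of `p` and of `0` both vanish by
  -- orthogonality, so `p = 0`.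
  let q : L.obj X ⟶ W := ObjectProperty.homMk 0
  have hG0 : ((adj.homEquiv _ _) q).hom = 0 := t.zero_of_isLE_of_isGE _ 0 1 (by simp) ‹_› ‹_›
  have hpq : p = q := (adj.homEquiv _ _).injective (by
    ext1
    exact h0.trans hG0.symm)
  rw [IsZero.iff_id_eq_zero]
  apply t'.from_truncGE_obj_ext
  have : (t'.truncGEπ 1).app Z = 0 := congr(($hpq).hom)
  rw [this, zero_comp, zero_comp]

-- For `W` in `D^{≥ 0}`, `Hom(L X, W) = Hom(X, G W)` with `G W` in `D^{≥ 0}`, so it depends only on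
-- `τ^{≥ 0} X`. The inverse is built explicitly: `s` extends the truncation map of `L X` along
-- `L.map g`, and `d` is the morphism induced by `s`.
include adj in
lemma isIso_truncGE_map [M'.IsTriangulated] (hM' : t'.le 0 ≤ M')
    (hG : ∀ Y : M'.FullSubcategory, t'.IsGE Y.obj 0 → t.IsGE (G.obj Y).obj 0)
    {X X' : M.FullSubcategory} (g : X ⟶ X') [IsIso ((t.truncGE 0).map g.hom)]
    [t'.IsLE (L.obj X).obj 0] [t'.IsLE (L.obj X').obj 0] :
    IsIso ((t'.truncGE 0).map (L.map g).hom) := by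
  -- Here right t-exactness enters: the truncation of `L X` stays `≤ 0`, hence lies in `M'`.
  have hW (X : M.FullSubcategory) [t'.IsLE (L.obj X).obj 0] :
    M' ((t'.truncGE 0).obj (L.obj X).obj) := hM' _ (t'.le_of_isLE _ 0)
  let W (X : M.FullSubcategory) [t'.IsLE (L.obj X).obj 0] : M'.FullSubcategory := ⟨_, hW X⟩
  have hGE (X : M.FullSubcategory) [t'.IsLE (L.obj X).obj 0] : t'.IsGE (W X).obj 0 :=
    inferInstanceAs (t'.IsGE ((t'.truncGE 0).obj _) 0)
  have hGW (X : M.FullSubcategory) [t'.IsLE (L.obj X).obj 0] : t.IsGE (G.obj (W X)).obj 0 :=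
    hG _ (hGE X)
  let p (X : M.FullSubcategory) [t'.IsLE (L.obj X).obj 0] : L.obj X ⟶ W X :=
    ObjectProperty.homMk ((t'.truncGEπ 0).app _)
  let h : W X ⟶ W X' := ObjectProperty.homMk ((t'.truncGE 0).map (L.map g).hom)
  have hp : p X ≫ h = L.map g ≫ p X' := by
    ext1
    exact t'.truncGEπ_naturality 0 (L.map g).hom
  obtain ⟨s, hs⟩ : ∃ s : L.obj X' ⟶ W X, L.map g ≫ s = p X := by
    obtain ⟨f, hf⟩ := t.exists_comp_eq_of_isIso_truncGE_map (n := 0) g.hom ((adj.homEquiv _ _) (p X)).hom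
    refine ⟨(adj.homEquiv _ _).symm (ObjectProperty.homMk f), ?_⟩
    rw [← adj.homEquiv_naturality_left_symm, Equiv.symm_apply_eq]
    ext1
    exact hf
  have hsh : s ≫ h = p X' := by
    apply (adj.homEquiv _ _).injective
    ext1
    apply t.comp_cancel_of_isIso_truncGE_map (n := 0) g.hom
    have : L.map g ≫ s ≫ h = L.map g ≫ p X' := by rw [← Category.assoc, hs, hp]
    have := congr(((adj.homEquiv _ _) $this).hom)
    rwa [adj.homEquiv_naturality_left, adj.homEquiv_naturality_left] at this
  let d : (t'.truncGE 0).obj (L.obj X').obj ⟶ (t'.truncGE 0).obj (L.obj X).obj :=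
    t'.descTruncGE s.hom 0
  have hd : (t'.truncGEπ 0).app _ ≫ d = s.hom := t'.π_descTruncGE _ _
  refine ⟨d, ?_, ?_⟩
  · apply t'.from_truncGE_obj_ext
    refine (t'.truncGEπ_naturality_assoc 0 (L.map g).hom d).trans ?_
    refine (congrArg ((L.map g).hom ≫ ·) hd).trans ?_
    exact congr(($hs).hom).trans (Category.comp_id _).symm
  · apply t'.from_truncGE_obj_ext
    rw [reassoc_of% hd]
    exact congr(($hsh).hom).trans (Category.comp_id _).symm

include adj in
/-- If `G` is left t-exact, then its left adjoint composed with the zeroth cohomology functor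
depends only on the zeroth cohomology on objects which are `≤ 0`. -/
lemma nonempty_iso_comp_truncGE_truncLE [M'.IsTriangulated] [M'.IsClosedUnderIsomorphisms]
    (hM' : t'.le 0 ≤ M')
    (hG : ∀ (n : ℤ) (Y : M'.FullSubcategory), t'.IsGE Y.obj n → t.IsGE (G.obj Y).obj n)
    {E : Type*} [Category E] (N K : E ⥤ M.FullSubcategory) (hN : ∀ e, t.IsLE (N.obj e).obj 0)
    (i : K ⋙ M.ι ≅ N ⋙ M.ι ⋙ t.truncGE 0 ⋙ t.truncLE 0) :
    Nonempty (N ⋙ L ⋙ M'.ι ⋙ t'.truncGE 0 ⋙ t'.truncLE 0 ≅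
      K ⋙ L ⋙ M'.ι ⋙ t'.truncGE 0 ⋙ t'.truncLE 0) := by
  -- The comparison `γ` from `N` to `K` inverts `β` in the zigzag `N ⟶ τ^{≥ 0} N ⟵ τ^{≤ 0} τ^{≥ 0} N
  -- ≅ K`; `β` is invertible since `N` takes values in `D^{≤ 0}`.
  let α : N ⋙ M.ι ⟶ N ⋙ M.ι ⋙ t.truncGE 0 := Functor.whiskerLeft (N ⋙ M.ι) (t.truncGEπ 0)
  let β : K ⋙ M.ι ⟶ N ⋙ M.ι ⋙ t.truncGE 0 :=
    i.hom ≫ Functor.whiskerLeft (N ⋙ M.ι ⋙ t.truncGE 0) (t.truncLEι 0)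
  have hβ (e : E) : IsIso (β.app e) := by
    have := hN e
    have : IsIso ((t.truncLEι 0).app ((t.truncGE 0).obj (N.obj e).obj)) := inferInstance
    have : IsIso (i.hom.app e) := inferInstance
    exact IsIso.comp_isIso' ‹_› ‹_›
  have : IsIso β := NatIso.isIso_of_isIso_app _
  let γ₀ : N ⋙ M.ι ⟶ K ⋙ M.ι := α ≫ inv β
  let γ : N ⟶ K := ((Functor.FullyFaithful.whiskeringRight M.fullyFaithfulι _).preimage γ₀)
  have hγ (e : E) : (γ.app e).hom ≫ β.app e = (t.truncGEπ 0).app (N.obj e).obj := by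
    have : (γ.app e).hom = γ₀.app e := rfl
    rw [this]
    have : γ₀ ≫ β = α := by simp [γ₀]
    exact congr_app this e
  have hK (e : E) : t.IsLE (K.obj e).obj 0 := by
    have : t.IsLE ((t.truncLE 0).obj ((t.truncGE 0).obj (N.obj e).obj)) 0 := inferInstance
    have : t.IsLE ((N ⋙ M.ι ⋙ t.truncGE 0 ⋙ t.truncLE 0).obj e) 0 := this
    exact t.isLE_of_iso (i.symm.app e) 0
  have hγ' (e : E) : IsIso ((t.truncGE 0).map (γ.app e).hom) := by
    have h₁ : IsIso ((t.truncGE 0).map ((t.truncGEπ 0).app (N.obj e).obj)) := inferInstance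
    have h₂ : IsIso ((t.truncGE 0).map (β.app e)) := inferInstance
    rw [← hγ e, Functor.map_comp] at h₁
    exact IsIso.of_isIso_comp_right _ ((t.truncGE 0).map (β.app e))
  let δ : N ⋙ L ⋙ M'.ι ⋙ t'.truncGE 0 ⋙ t'.truncLE 0 ⟶
      K ⋙ L ⋙ M'.ι ⋙ t'.truncGE 0 ⋙ t'.truncLE 0 :=
    Functor.whiskerRight γ (L ⋙ M'.ι ⋙ t'.truncGE 0 ⋙ t'.truncLE 0)
  have (e : E) : IsIso (δ.app e) := by
    have := hN e
    have := hK e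
    have := hγ' e
    have := adj.isLE_obj t t' hM' (hG 1) (N.obj e)
    have := adj.isLE_obj t t' hM' (hG 1) (K.obj e)
    have := adj.isIso_truncGE_map t t' hM' (hG 0) (γ.app e)
    exact inferInstanceAs (IsIso ((t'.truncLE 0).map ((t'.truncGE 0).map (L.map (γ.app e)).hom)))
  have : IsIso δ := NatIso.isIso_of_isIso_app _
  exact ⟨asIso δ⟩

end Adjunction

end TStructure

end CategoryTheory

/-! ### Exact functors between derived categories. -/

namespace CategoryTheory.Functor

open _root_.DerivedCategory

section

variable {A B C : Type*} [Category A] [Category B] [Category C] [Abelian A] [Abelian B] [Abelian C]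
  [HasDerivedCategory A] [HasDerivedCategory B] [HasDerivedCategory C]

/-- Exact functors commute with the cohomology of objects of the derived category. -/
lemma nonempty_homologyFunctor_mapDerivedCategory_iso (G : B ⥤ A) [G.Additive]
    [PreservesFiniteLimits G] [PreservesFiniteColimits G] (E : DerivedCategory B) (i : ℤ) :
    Nonempty ((homologyFunctor A i).obj (G.mapDerivedCategory.obj E) ≅
      G.obj ((homologyFunctor B i).obj E)) := by
  let K := Q.objPreimage E
  let e : Q.obj K ≅ E := Q.objObjPreimageIso E
  let K' : CochainComplex A ℤ := (G.mapHomologicalComplex (ComplexShape.up ℤ)).obj K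
  let e₁ : (homologyFunctor A i).obj (G.mapDerivedCategory.obj E) ≅ K'.homology i :=
    (homologyFunctor A i).mapIso (G.mapDerivedCategory.mapIso e.symm ≪≫
      G.mapDerivedCategoryFactors.app K) ≪≫ (homologyFunctorFactors A i).app K'
  let e₂ : (homologyFunctor B i).obj E ≅ K.homology i :=
    (homologyFunctor B i).mapIso e.symm ≪≫ (homologyFunctorFactors B i).app K
  let e₃ : K'.homology i ≅ G.obj (K.homology i) := (K.sc i).mapHomologyIso G
  exact ⟨e₁ ≪≫ e₃ ≪≫ G.mapIso e₂.symm⟩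

variable (G₁ : C ⥤ B) (G₂ : B ⥤ A) (G : C ⥤ A) [G₁.Additive] [G₂.Additive] [G.Additive]
  [PreservesFiniteLimits G₁] [PreservesFiniteColimits G₁]
  [PreservesFiniteLimits G₂] [PreservesFiniteColimits G₂]
  [PreservesFiniteLimits G] [PreservesFiniteColimits G]

/-- The functors induced on derived categories by exact functors are compatible with
compositions. -/
noncomputable def mapDerivedCategoryCompIso (e : G₁ ⋙ G₂ ≅ G) :
    G₁.mapDerivedCategory ⋙ G₂.mapDerivedCategory ≅ G.mapDerivedCategory :=
  let M₁ := G₁.mapHomologicalComplex (ComplexShape.up ℤ)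
  let M₂ := G₂.mapHomologicalComplex (ComplexShape.up ℤ)
  let M := G.mapHomologicalComplex (ComplexShape.up ℤ)
  let i : M₁ ⋙ M₂ ≅ M := NatIso.mapHomologicalComplex e (ComplexShape.up ℤ)
  let j : Q ⋙ G₁.mapDerivedCategory ⋙ G₂.mapDerivedCategory ≅ Q ⋙ G.mapDerivedCategory :=
    (associator _ _ _).symm ≪≫ isoWhiskerRight G₁.mapDerivedCategoryFactors _ ≪≫
      associator _ _ _ ≪≫ isoWhiskerLeft M₁ G₂.mapDerivedCategoryFactors ≪≫
      (associator _ _ _).symm ≪≫ isoWhiskerRight i Q ≪≫ G.mapDerivedCategoryFactors.symm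
  have : Localization.Lifting Q (HomologicalComplex.quasiIso C (ComplexShape.up ℤ))
    (Q ⋙ G.mapDerivedCategory) (G₁.mapDerivedCategory ⋙ G₂.mapDerivedCategory) := ⟨j⟩
  have : Localization.Lifting Q (HomologicalComplex.quasiIso C (ComplexShape.up ℤ))
    (Q ⋙ G.mapDerivedCategory) G.mapDerivedCategory := ⟨Iso.refl _⟩
  Localization.liftNatIso Q (HomologicalComplex.quasiIso C (ComplexShape.up ℤ))
    (Q ⋙ G.mapDerivedCategory) (Q ⋙ G.mapDerivedCategory) _ _ (Iso.refl _)

/-- The functors induced on bounded above derived categories by exact functors are compatible with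
compositions. -/
noncomputable def mapMinusCompIso (e : G₁ ⋙ G₂ ≅ G) :
    G₁.mapMinus (A := B) ⋙ G₂.mapMinus (A := A) ≅ G.mapMinus :=
  fullyFaithfulCancelRight Minus.ι
    (isoWhiskerLeft Minus.ι (mapDerivedCategoryCompIso G₁ G₂ G e) :
      (G₁.mapMinus ⋙ G₂.mapMinus) ⋙ Minus.ι ≅ G.mapMinus ⋙ Minus.ι)

end

end CategoryTheory.Functor

/-! ### Derived pullbacks and their `H^0`. -/

namespace AlgebraicGeometry.Scheme

open DerivedCategory Triangulated

variable {X Y Z : Scheme.{u}} [IsLocallyNoetherian X] [IsLocallyNoetherian Y]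
  [IsLocallyNoetherian Z]

/-- The pullback of coherent sheaves along `f` has an exact right adjoint and there are enough
coherent sheaves adapted to it. -/
structure IsPullbackDerivable (f : X ⟶ Y) : Prop where
  exists_adjunction : ∃ G : Coh X ⥤ Coh Y, Nonempty (cohPullback f ⊣ G) ∧
    PreservesFiniteColimits G
  exists_isLeftAdapted : ∃ P, (cohPullback f).IsLeftAdapted P

/-- The pullback of coherent sheaves is compatible with compositions. -/
noncomputable def cohPullbackComp (f : X ⟶ Y) (g : Y ⟶ Z) :
    cohPullback g ⋙ cohPullback f ≅ cohPullback (f ≫ g) :=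
  NatIso.ofComponents (fun M ↦ ObjectProperty.isoMk _ ((Modules.pullbackComp f g).app M.obj))
    fun φ ↦ by
      ext1
      exact (Modules.pullbackComp f g).hom.naturality φ.hom

section

variable (f : X ⟶ Y) {G : Coh X ⥤ Coh Y} [G.Additive] [PreservesFiniteLimits G]
  [PreservesFiniteColimits G] (adj : cohPullback f ⊣ G)

lemma cohGESucc.of_iso {d : ℕ} {M N : Coh Y} (e : M ≅ N) (h : cohGESucc Y d M) :
    cohGESucc Y d N := fun F hF φ ↦ by
  rw [← cancel_mono e.inv, h F hF (φ ≫ e.inv), zero_comp]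

-- A morphism from `F` in `Coh_{≤ d}` to `G.obj M` is adjoint to one from the pullback of `F`, again
-- in `Coh_{≤ d}`, to `M`.
include adj in
lemma cohGESucc.map_rightAdjoint {d : ℕ} (hf : ∀ M, cohLE Y d M → cohLE X d ((cohPullback f).obj M))
    {M : Coh X} (hM : cohGESucc X d M) : cohGESucc Y d (G.obj M) := fun F hF φ ↦ by
  have := adj.left_adjoint_additive
  apply (adj.homEquiv _ _).symm.injective
  rw [hM _ (hf F hF) ((adj.homEquiv F M).symm φ), hM _ (hf F hF) ((adj.homEquiv F M).symm 0)]

include adj in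
lemma perverseGE.mapDerivedCategory (hf : ∀ M, cohLE Y 1 M → cohLE X 1 ((cohPullback f).obj M))
    {E : DCoh X} (hE : perverseGE X E) : perverseGE Y (G.mapDerivedCategory.obj E) := by
  refine ⟨(hE.1.map_rightAdjoint f adj hf).of_iso
    (G.nonempty_homologyFunctor_mapDerivedCategory_iso E (-1)).some.symm, fun i hi ↦ ?_⟩
  exact (G.map_isZero (hE.2 i hi)).of_iso
    (G.nonempty_homologyFunctor_mapDerivedCategory_iso E i).some

include adj in
lemma PerverseTStructure.isGE_mapDerivedCategory (τ : PerverseTStructure X)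
    (τ' : PerverseTStructure Y) (hf : ∀ M, cohLE Y 1 M → cohLE X 1 ((cohPullback f).obj M))
    (n : ℤ) {E : DCoh X} [τ.t.IsGE E n] : τ'.t.IsGE (G.mapDerivedCategory.obj E) n := by
  have h : τ.t.ge 0 (E⟦n⟧) := (τ.t.isGE_shift E n n 0).ge
  rw [τ.ge_zero] at h
  have h' := h.mapDerivedCategory f adj hf
  rw [← τ'.ge_zero, τ'.t.ge_iff_isGE] at h'
  have : τ'.t.IsGE ((shiftFunctor _ n ⋙ G.mapDerivedCategory).obj E) 0 := h'
  have : τ'.t.IsGE ((G.mapDerivedCategory.obj E)⟦n⟧) 0 :=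
    τ'.t.isGE_of_iso ((G.mapDerivedCategory.commShiftIso n).app E) 0
  exact τ'.t.isGE_of_shift _ n n 0

variable {f}

-- `L` is given only by its universal property. The left adjoint of `G.mapMinus` has the same
-- property, so the adjunction is transported along the uniqueness isomorphism.
include adj in
lemma LeftDerivedPullback.nonempty_adjunction (hf : IsPullbackDerivable f)
    (L : LeftDerivedPullback f) : Nonempty (L.functor ⊣ G.mapMinus) := by
  obtain ⟨P, hP⟩ := hf.exists_isLeftAdapted
  have := adj.isLeftAdjoint
  have := hP.isRightAdjoint_mapMinus adj
  let adj' := Adjunction.ofIsRightAdjoint (G.mapMinus (A := Coh Y))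
  have := L.universal
  have := hP.isRightKanExtension adj adj'
  exact ⟨adj'.ofNatIsoLeft (Functor.rightKanExtensionUnique _
    (Functor.IsLeftAdapted.derivedCounit adj adj') _ L.counit)⟩

end

lemma IsPullbackDerivable.nonempty_leftDerivedPullback {f : X ⟶ Y} (hf : IsPullbackDerivable f) :
    Nonempty (LeftDerivedPullback f) := by
  obtain ⟨G, ⟨adj⟩, _⟩ := hf.exists_adjunction
  obtain ⟨P, hP⟩ := hf.exists_isLeftAdapted
  have := adj.right_adjoint_additive
  have := adj.rightAdjoint_preservesLimits
  have := adj.isLeftAdjoint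
  have := hP.isRightAdjoint_mapMinus adj
  let adj' := Adjunction.ofIsRightAdjoint (G.mapMinus (A := Coh Y))
  exact ⟨⟨_, _, hP.isRightKanExtension adj adj'⟩⟩

lemma nonempty_H0_iso {f₁ : X ⟶ Y} {f₂ : Y ⟶ Z} {f : X ⟶ Z} (hf : f₁ ≫ f₂ = f)
    (h₁ : IsPullbackDerivable f₁) (h₂ : IsPullbackDerivable f₂) (h : IsPullbackDerivable f)
    (hd₁ : ∀ M, cohLE Y 1 M → cohLE X 1 ((cohPullback f₁).obj M))
    (hd₂ : ∀ M, cohLE Z 1 M → cohLE Y 1 ((cohPullback f₂).obj M))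
    (τX : PerverseTStructure X) (τY : PerverseTStructure Y) (τZ : PerverseTStructure Z)
    (L : LeftDerivedPullback f) (L₁ : LeftDerivedPullback f₁) (L₂ : LeftDerivedPullback f₂) :
    Nonempty (L.H0 τX ≅ L₂.H0 τY ⋙ L₁.H0 τX) := by
  obtain ⟨G, ⟨adj⟩, _⟩ := h.exists_adjunction
  obtain ⟨G₁, ⟨adj₁⟩, _⟩ := h₁.exists_adjunction
  obtain ⟨G₂, ⟨adj₂⟩, _⟩ := h₂.exists_adjunction
  have := adj.right_adjoint_additive
  have := adj.rightAdjoint_preservesLimits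
  have := adj₁.right_adjoint_additive
  have := adj₁.rightAdjoint_preservesLimits
  have := adj₂.right_adjoint_additive
  have := adj₂.rightAdjoint_preservesLimits
  subst hf
  let e : G₁ ⋙ G₂ ≅ G :=
    (adj₂.comp adj₁).rightAdjointUniq (adj.ofNatIsoLeft (cohPullbackComp f₁ f₂).symm)
  obtain ⟨a⟩ := L.nonempty_adjunction adj h
  obtain ⟨a₁⟩ := L₁.nonempty_adjunction adj₁ h₁
  obtain ⟨a₂⟩ := L₂.nonempty_adjunction adj₂ h₂
  -- Both sides are left adjoint to the composite of the exact pushforwards.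
  let i : L.functor ≅ L₂.functor ⋙ L₁.functor := a.leftAdjointUniq
    ((a₂.comp a₁).ofNatIsoRight (Functor.mapMinusCompIso G₁ G₂ G e))
  have hτ (τ : PerverseTStructure X) : τ.t.le 0 ≤ (TStructure.t (C := Coh X)).minus := by
    rw [τ.le_zero]
    exact perverseLE_le_minus X
  have hτY : τY.t.le 0 ≤ (TStructure.t (C := Coh Y)).minus := by
    rw [τY.le_zero]
    exact perverseLE_le_minus Y
  -- Applied to `L₂` restricted to `D^{≤ 0}`, and to its `H^0`, which is the truncation by
  -- definition. The t-structure on `Z` serves only to show that `L₂` lands in `D^{≤ 0}`.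
  obtain ⟨j⟩ := a₁.nonempty_iso_comp_truncGE_truncLE τY.t τX.t (hτ τX)
    (fun n E (_ : τX.t.IsGE E.obj n) ↦
      PerverseTStructure.isGE_mapDerivedCategory (E := E.obj) f₁ adj₁ τX τY hd₁ n)
    (perverseLEToMinus Z ⋙ L₂.functor) (L₂.H0 τY ⋙ perverseLEToMinus Y)
    (fun E ↦ by
      have : τZ.t.IsLE E.obj 0 := ⟨by rw [τZ.le_zero]; exact E.property⟩
      have : τZ.t.IsLE ((perverseLEToMinus Z).obj E).obj 0 := this
      exact a₂.isLE_obj τZ.t τY.t hτY (fun E (_ : τY.t.IsGE E.obj 1) ↦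
        PerverseTStructure.isGE_mapDerivedCategory (E := E.obj) f₂ adj₂ τY τZ hd₂ 1) _)
    (Iso.refl _)
  exact ⟨(perverseLE X).fullyFaithfulι.whiskeringRight _ |>.preimageIso
    (Functor.isoWhiskerLeft (perverseLEToMinus Z) (Functor.isoWhiskerRight i
      (ObjectProperty.ι _ ⋙ τX.t.truncGE 0 ⋙ τX.t.truncLE 0)) ≪≫ j)⟩

end AlgebraicGeometry.Scheme

/-! ### Coherent sheaves on affine schemes. -/

lemma ModuleCat.finite_extendScalars_iff {R S : Type u} [CommRing R] [CommRing S]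
    [inst : Algebra R S] (N : ModuleCat.{u} R) :
    Module.Finite S ((ModuleCat.extendScalars (algebraMap R S)).obj N) ↔
      Module.Finite S (TensorProduct R S N) := by
  obtain ⟨φ, rfl⟩ : ∃ φ : R →+* S, inst = φ.toAlgebra :=
    ⟨algebraMap R S, toAlgebra_algebraMap.symm⟩
  exact Iff.rfl

namespace AlgebraicGeometry.Scheme

namespace Modules

/-- A presentation of the restriction of a sheaf of modules to an open subscheme induces a
presentation over this open subset. -/
noncomputable def presentationOver {Y : Scheme.{u}} (M : Y.Modules) (U : Y.Opens)
    (p : (M.restrict U.ι).Presentation) :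
    (SheafOfModules.over (R := Y.ringCatSheaf) M U).Presentation :=
  let e : SheafOfModules (Y.ringCatSheaf.over U) ≌ SheafOfModules U.toScheme.ringCatSheaf :=
    overEquiv U
  let η : e.inverse.obj (SheafOfModules.unit _) ≅ SheafOfModules.unit (Y.ringCatSheaf.over U) :=
    (e.unitIso.app (SheafOfModules.unit (Y.ringCatSheaf.over U))).symm
  have : PreservesColimitsOfSize.{u, u} e.inverse :=
    e.symm.toAdjunction.leftAdjoint_preservesColimits
  let q := SheafOfModules.Presentation.map p e.inverse η.symm
  let i : e.inverse.obj (M.restrict U.ι) ≅ SheafOfModules.over (R := Y.ringCatSheaf) M U :=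
    e.inverse.mapIso ((overFunctorEquiv U).symm.app M) ≪≫ (e.unitIso.app _).symm
  SheafOfModules.Presentation.ofIsIso.{u, u, u} i.hom q

end Modules

lemma isCoherent.isQuasicoherent {Y : Scheme.{u}} {M : Y.Modules} (hM : isCoherent Y M) :
    M.IsQuasicoherent := by
  choose U hU hy N _ e using hM
  let p (y : Y) : (M.restrict (U y).ι).Presentation :=
    let i : tilde (N y) ≅ M.restrict (hU y).fromSpec := (e y).some.symm
    let q : (M.restrict (hU y).fromSpec).Presentation :=
      @SheafOfModules.Presentation.ofIsIso.{u, u, u} _ _ _ _ _ _ _ _ i.hom i.isIso_hom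
        (presentationTilde (N y) Set.univ (by simp) _ (Submodule.span_eq _))
    let j : (M.restrict (hU y).fromSpec).restrict (hU y).isoSpec.hom ≅ M.restrict (U y).ι :=
      ((Modules.restrictFunctorComp _ _).symm ≪≫
        Modules.restrictFunctorCongr (by simp)).app M
    @SheafOfModules.Presentation.ofIsIso.{u, u, u} _ _ _ _ _ _ _ _ j.hom j.isIso_hom
      (Modules.presentationRestrict (hU y).isoSpec.hom q)
  exact (show SheafOfModules.QuasicoherentData (R := Y.ringCatSheaf) M from
    { I := Y
      X := U
      coversTop := by
        rw [Opens.coversTop_iff]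
        exact eq_top_iff.2 fun y _ ↦ Opens.mem_iSup.2 ⟨y, hy y⟩
      presentation y := Modules.presentationOver M (U y) (p y) }).isQuasicoherent

/-- A coherent sheaf on the spectrum of a ring is associated with a finitely generated module. -/
lemma isCoherent.exists_iso_tilde {R : CommRingCat.{u}} {M : (Spec R).Modules}
    (hM : isCoherent (Spec R) M) :
    ∃ N : ModuleCat.{u} R, Module.Finite R N ∧ Nonempty (M ≅ tilde N) := by
  have := hM.isQuasicoherent
  obtain ⟨N, ⟨e⟩⟩ := isIso_fromTildeΓ_iff.1 (inferInstance : IsIso M.fromTildeΓ)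
  let e : M ≅ tilde N := e.symm
  refine ⟨N, ?_, ⟨e⟩⟩
  -- Finiteness of a module can be checked after inverting elements that generate the unit ideal.
  let s : Set R := {r | Module.Finite (Localization.Away r)
    (TensorProduct R (Localization.Away r) N)}
  have hs : Ideal.span s = ⊤ := by
    rw [← PrimeSpectrum.iSup_basicOpen_eq_top_iff', eq_top_iff]
    rintro y -
    rw [isCoherent_iff] at hM
    obtain ⟨U, hU, hy, h⟩ := hM y
    obtain ⟨_, ⟨_, ⟨r, rfl⟩, rfl⟩, hr, hrU⟩ :=
      PrimeSpectrum.isBasis_basic_opens.exists_subset_of_mem_open hy U.2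
    simp only [Opens.mem_iSup]
    refine ⟨r, ?_, hr⟩
    let φ : R ⟶ CommRingCat.of (Localization.Away r) := CommRingCat.ofHom (algebraMap _ _)
    obtain ⟨N', hN', ⟨e'⟩⟩ := h.of_range_subset (Spec.map φ) (by
      rw [hU.range_fromSpec]
      refine subset_trans ?_ hrU
      exact (PrimeSpectrum.localization_away_comap_range (Localization.Away r) r).subset)
    -- Two descriptions of the pullback of `M` to a basic open; full faithfulness of `tilde` turns
    -- the isomorphism into one of modules.
    let i : tilde ((ModuleCat.extendScalars φ.hom).obj N) ≅ tilde N' :=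
      (pullbackTilde φ N).symm ≪≫ (Modules.pullback _).mapIso e.symm ≪≫ e'
    let j := (tilde.fullyFaithfulFunctor.preimageIso i).symm.toLinearEquiv
    have := Module.Finite.equiv j
    exact (ModuleCat.finite_extendScalars_iff N).1 this
  refine Module.Finite.of_localizationSpan' s hs
    (fun r ↦ TensorProduct.mk R (Localization.Away r.1) N 1) fun r ↦ r.2

lemma isCoherent.FGOn {Y : Scheme.{u}} {M : Y.Modules} (hM : isCoherent Y M) {R : CommRingCat.{u}}
    (f : Spec R ⟶ Y) : FGOn M f :=
  (isCoherent_pullback f M hM).exists_iso_tilde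

end AlgebraicGeometry.Scheme

/-! ### Sections of coherent sheaves over affine opens. -/

/-- A left exact additive functor which preserves epimorphisms is right exact. -/
lemma preservesFiniteColimits_of_epi {C D : Type*} [Category C] [Category D] [Abelian C]
    [Abelian D] (F : C ⥤ D) [F.Additive] [PreservesFiniteLimits F] [F.PreservesEpimorphisms] :
    PreservesFiniteColimits F := by
  refine (F.preservesFiniteColimits_tfae.out 0 3).1 ?_
  intro S hS
  have := hS.mono_f
  have := hS.epi_g
  exact ⟨hS.exact.map_of_mono_of_preservesKernel F inferInstance inferInstance, inferInstance⟩

namespace CategoryTheory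

variable {C D : Type*} [Category C] [Category D] {F G : C ⥤ D} (e : F ≅ G) {X Y : C} (f : X ⟶ Y)

include e

lemma NatIso.mono_map_iff : Mono (F.map f) ↔ Mono (G.map f) :=
  (MorphismProperty.monomorphisms D).arrow_mk_iso_iff
    (Arrow.isoMk (e.app X) (e.app Y) (e.hom.naturality f).symm)

lemma NatIso.epi_map_iff : Epi (F.map f) ↔ Epi (G.map f) :=
  (MorphismProperty.epimorphisms D).arrow_mk_iso_iff
    (Arrow.isoMk (e.app X) (e.app Y) (e.hom.naturality f).symm)

lemma NatIso.map_eq_zero_iff [HasZeroMorphisms D] : F.map f = 0 ↔ G.map f = 0 := by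
  rw [← cancel_mono (e.hom.app Y), e.hom.naturality, zero_comp, ← cancel_epi (e.hom.app X),
    comp_zero]

end CategoryTheory

namespace AlgebraicGeometry.Scheme

namespace Modules

lemma hom_ext_of_isBasis {Y : Scheme.{u}} {M N : Y.Modules} {φ ψ : M ⟶ N}
    (h : ∀ y : Y, ∃ V : Y.Opens, y ∈ V ∧ ∀ W ≤ V, φ.app W = ψ.app W) : φ = ψ := by
  refine hom_ext _ _ fun U ↦ ?_
  ext s
  choose V hV h using h
  refine TopCat.Sheaf.eq_of_locally_eq' ⟨_, N.isSheaf⟩ (fun y : U ↦ U ⊓ V y.1) U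
    (fun y ↦ homOfLE inf_le_left) (fun y hy ↦ Opens.mem_iSup.2 ⟨⟨y, hy⟩, hy, hV y⟩) _ _ fun y ↦ ?_
  have h₁ := congr($(φ.mapPresheaf.naturality (homOfLE (inf_le_left : U ⊓ V y.1 ≤ U)).op) s)
  have h₂ := congr($(ψ.mapPresheaf.naturality (homOfLE (inf_le_left : U ⊓ V y.1 ≤ U)).op) s)
  have h₃ : φ.app (U ⊓ V y.1) = ψ.app (U ⊓ V y.1) := h _ _ inf_le_right
  refine h₁.symm.trans (Eq.trans ?_ h₂)
  exact congr(($h₃) (M.presheaf.map (homOfLE (inf_le_left : U ⊓ V y.1 ≤ U)).op s))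

lemma eq_zero_of_restrict {Y : Scheme.{u}} {M N : Y.Modules} {φ : M ⟶ N}
    (h : ∀ y : Y, ∃ (U : Scheme.{u}) (j : U ⟶ Y) (_ : IsOpenImmersion j), y ∈ Set.range j ∧
      (restrictFunctor j).map φ = 0) : φ = 0 := by
  refine hom_ext_of_isBasis fun y ↦ ?_
  obtain ⟨U, j, _, hy, h⟩ := h y
  refine ⟨j.opensRange, hy, fun W hW ↦ ?_⟩
  have h' : φ.app (j ''ᵁ (j ⁻¹ᵁ W)) = 0 := congr(Hom.app $h (j ⁻¹ᵁ W))
  rw [j.image_preimage_eq_opensRange_inf, inf_eq_right.2 hW] at h'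
  exact h'

end Modules

section

variable (R : CommRingCat.{u})

/-- The functor of global sections of sheaves of modules on the spectrum of a ring. -/
noncomputable def specΓ : (Spec R).Modules ⥤ ModuleCat.{u} R := moduleSpecΓFunctor (R := R)

/-- The adjunction between `tilde.functor` and the global sections. -/
noncomputable def tildeSpecΓAdjunction : tilde.functor R ⊣ specΓ R := tilde.adjunction (R := R)

instance : (specΓ R).Additive := (tildeSpecΓAdjunction R).right_adjoint_additive

instance : PreservesFiniteLimits (specΓ R) :=
  have := (tildeSpecΓAdjunction R).rightAdjoint_preservesLimits
  PreservesLimits.preservesFiniteLimits _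

variable {R}

lemma isIso_tildeSpecΓAdjunction_counit_app {M : (Spec R).Modules} {N : ModuleCat.{u} R}
    (e : M ≅ tilde N) : IsIso ((tildeSpecΓAdjunction R).counit.app M) :=
  isIso_fromTildeΓ_iff.2 ⟨N, ⟨e.symm⟩⟩

end

section Restrict

variable {Y : Scheme.{u}} [IsLocallyNoetherian Y]

instance : PreservesFiniteLimits (isCoherent Y).ι :=
  have := (isCoherent Y).preservesMonomorphisms_ι_of_isNormalEpiCategory
  have := (isCoherent Y).preservesEpimorphisms_ι_of_isNormalMonoCategory
  (((isCoherent Y).ι.preservesFiniteLimits_tfae).out 2 3).1 (isCoherent Y).preservesKernels_ι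

instance : PreservesFiniteColimits (isCoherent Y).ι :=
  (((isCoherent Y).ι.preservesFiniteColimits_tfae).out 2 3).1 (isCoherent Y).preservesCokernels_ι

variable {R : CommRingCat.{u}} (j : Spec R ⟶ Y) [IsOpenImmersion j]

/-- The restriction of coherent sheaves to an affine open subscheme. -/
noncomputable def cohRestrict : Coh Y ⥤ (Spec R).Modules :=
  (isCoherent Y).ι ⋙ Modules.restrictFunctor j

instance : (cohRestrict j).Additive := by
  unfold cohRestrict
  infer_instance

instance : PreservesFiniteLimits (cohRestrict j) := by
  unfold cohRestrict
  infer_instance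

instance : PreservesFiniteColimits (cohRestrict j) := by
  unfold cohRestrict
  infer_instance

/-- The sections of coherent sheaves on an affine open subscheme. -/
noncomputable def cohSections : Coh Y ⥤ ModuleCat.{u} R :=
  cohRestrict j ⋙ specΓ R

lemma exists_cohRestrict_iso (M : Coh Y) : ∃ N : ModuleCat.{u} R, Module.Finite R N ∧
    Nonempty ((cohRestrict j).obj M ≅ tilde N) := by
  obtain ⟨N, hN, ⟨e⟩⟩ := M.property.FGOn j
  exact ⟨N, hN, ⟨(Modules.restrictFunctorIsoPullback j).app M.obj ≪≫ e⟩⟩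

instance (M : Coh Y) : Module.Finite R ((cohSections j).obj M) := by
  obtain ⟨N, hN, ⟨e⟩⟩ := exists_cohRestrict_iso j M
  exact Module.Finite.equiv (show N ≅ (cohSections j).obj M from tilde.toTildeΓNatIso.app N ≪≫
    (specΓ R).mapIso e.symm).toLinearEquiv

instance : IsIso (Functor.whiskerLeft (cohRestrict j) (tildeSpecΓAdjunction R).counit) := by
  have (M : Coh Y) : IsIso ((Functor.whiskerLeft (cohRestrict j)
      (tildeSpecΓAdjunction R).counit).app M) := by
    obtain ⟨N, hN, ⟨e⟩⟩ := exists_cohRestrict_iso j M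
    exact isIso_tildeSpecΓAdjunction_counit_app e
  exact NatIso.isIso_of_isIso_app _

/-- The restriction of a coherent sheaf to an affine open subscheme is associated with its
module of sections. -/
noncomputable def cohSectionsTilde : cohSections j ⋙ tilde.functor R ≅ cohRestrict j :=
  let e := asIso (Functor.whiskerLeft (cohRestrict j) (tildeSpecΓAdjunction R).counit)
  e

instance : (cohSections j).Additive := by
  unfold cohSections
  infer_instance

instance : PreservesFiniteLimits (cohSections j) :=
  comp_preservesFiniteLimits _ _

/-- Exactness of sections on affines, without cohomology: restriction is sections followed by
`tilde`, and the faithful functor `tilde` reflects epimorphisms. -/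
instance : PreservesFiniteColimits (cohSections j) := by
  have : (cohSections j).PreservesEpimorphisms := ⟨fun φ _ ↦ by
    have : Epi ((cohSections j ⋙ tilde.functor R).map φ) :=
      (NatIso.epi_map_iff (cohSectionsTilde j) φ).2 inferInstance
    exact (tilde.functor R).epi_of_epi_map this⟩
  exact preservesFiniteColimits_of_epi _

lemma cohRestrict_map_eq_zero_iff {M N : Coh Y} (φ : M ⟶ N) :
    (cohRestrict j).map φ = 0 ↔ (cohSections j).map φ = 0 := by
  rw [← NatIso.map_eq_zero_iff (cohSectionsTilde j)]
  exact (tilde.functor R).map_eq_zero_iff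

lemma coh_eq_zero_of_local {M N : Coh Y} {φ : M ⟶ N}
    (h : ∀ y : Y, ∃ (R : CommRingCat.{u}) (j : Spec R ⟶ Y) (_ : IsOpenImmersion j),
      y ∈ Set.range j ∧ (cohSections j).map φ = 0) : φ = 0 := by
  ext1
  refine Modules.eq_zero_of_restrict fun y ↦ ?_
  obtain ⟨R, j, _, hy, h⟩ := h y
  exact ⟨_, j, ‹_›, hy, (cohRestrict_map_eq_zero_iff j φ).2 h⟩

lemma coh_mono_of_local {M N : Coh Y} {φ : M ⟶ N}
    (h : ∀ y : Y, ∃ (R : CommRingCat.{u}) (j : Spec R ⟶ Y) (_ : IsOpenImmersion j),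
      y ∈ Set.range j ∧ Mono ((cohSections j).map φ)) : Mono φ := by
  refine Preadditive.mono_of_kernel_zero (coh_eq_zero_of_local fun y ↦ ?_)
  obtain ⟨R, j, _, hy, h⟩ := h y
  refine ⟨R, j, ‹_›, hy, ?_⟩
  rw [← cancel_mono ((cohSections j).map φ), ← Functor.map_comp, kernel.condition, zero_comp,
    Functor.map_zero]

lemma coh_epi_of_local {M N : Coh Y} {φ : M ⟶ N}
    (h : ∀ y : Y, ∃ (R : CommRingCat.{u}) (j : Spec R ⟶ Y) (_ : IsOpenImmersion j),
      y ∈ Set.range j ∧ Epi ((cohSections j).map φ)) : Epi φ := by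
  refine Preadditive.epi_of_cokernel_zero (coh_eq_zero_of_local fun y ↦ ?_)
  obtain ⟨R, j, _, hy, h⟩ := h y
  refine ⟨R, j, ‹_›, hy, ?_⟩
  rw [← cancel_epi ((cohSections j).map φ), ← Functor.map_comp, cokernel.condition, comp_zero,
    Functor.map_zero]

end Restrict

end AlgebraicGeometry.Scheme

/-! ### Pushforward of coherent sheaves along finite morphisms. -/

lemma TopCat.Presheaf.map_comp_map_comp_map {C : Type*} [Category C] {X : TopCat}
    (F : TopCat.Presheaf C X) {U V W Z : (Opens X)ᵒᵖ} (a : U ⟶ V) (b : V ⟶ W) (c : W ⟶ Z)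
    (d : U ⟶ Z) : (F.map a ≫ F.map b) ≫ F.map c = F.map d := by
  rw [← F.map_comp, ← F.map_comp]
  rfl

namespace AlgebraicGeometry.Scheme

namespace Modules

variable {X Y U W : Scheme.{u}} {f : X ⟶ Y} {j : U ⟶ Y} {j' : W ⟶ X} {g : W ⟶ U}
  [IsOpenImmersion j] [IsOpenImmersion j'] (w : j' ≫ f = g ≫ j)

/-- The base change morphism for the pushforward of sheaves of modules, with respect to open
immersions. -/
noncomputable def pushforwardRestrict :
    pushforward f ⋙ restrictFunctor j ⟶ restrictFunctor j' ⋙ pushforward g where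
  app M := (restrictFunctor j).map ((pushforward f).map ((restrictAdjunction j').unit.app M) ≫
    (pushforwardComp j' f).hom.app _ ≫ (pushforwardCongr w).hom.app _ ≫
      (pushforwardComp g j).inv.app _) ≫ (restrictAdjunction j).counit.app _
  naturality M N φ := by
    have h₁ := (restrictAdjunction j').unit.naturality φ
    have h₂ := (pushforwardComp j' f).hom.naturality ((restrictFunctor j').map φ)
    have h₃ := (pushforwardCongr w).hom.naturality ((restrictFunctor j').map φ)
    have h₄ := (pushforwardComp g j).inv.naturality ((restrictFunctor j').map φ)
    have h₅ := (restrictAdjunction j).counit.naturality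
      ((pushforward g).map ((restrictFunctor j').map φ))
    simp only [Functor.comp_map, Functor.id_map] at h₁ h₂ h₃ h₄ h₅
    have key : (pushforward f).map φ ≫ (pushforward f).map ((restrictAdjunction j').unit.app N) ≫
        (pushforwardComp j' f).hom.app _ ≫ (pushforwardCongr w).hom.app _ ≫
          (pushforwardComp g j).inv.app _ =
        ((pushforward f).map ((restrictAdjunction j').unit.app M) ≫
          (pushforwardComp j' f).hom.app _ ≫ (pushforwardCongr w).hom.app _ ≫
            (pushforwardComp g j).inv.app _) ≫
            (pushforward j).map ((pushforward g).map ((restrictFunctor j').map φ)) := by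
      rw [← Functor.map_comp_assoc, h₁, Functor.map_comp]
      simp only [Category.assoc]
      rw [reassoc_of% h₂, reassoc_of% h₃, h₄]
    refine ((restrictFunctor j).map_comp_assoc _ _ _).symm.trans ?_
    refine (congrArg (fun t ↦ (restrictFunctor j).map t ≫ (restrictAdjunction j).counit.app _)
      key).trans ?_
    refine ((restrictFunctor j).map_comp_assoc _ _ _).trans ?_
    exact (congrArg (_ ≫ ·) h₅).trans (Category.assoc _ _ _).symm

include w in
lemma image_preimage_eq_preimage_image (hw : ∀ x, f x ∈ Set.range j → x ∈ Set.range j')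
    (V : U.Opens) : j' ''ᵁ g ⁻¹ᵁ V = f ⁻¹ᵁ j ''ᵁ V := by
  have key (z : W) : f (j' z) = j (g z) := by
    rw [← Scheme.Hom.comp_apply, w, Scheme.Hom.comp_apply]
  ext x
  constructor
  · rintro ⟨z, hz, rfl⟩
    exact ⟨g z, hz, (key z).symm⟩
  · rintro ⟨v, hv, hx⟩
    obtain ⟨z, rfl⟩ := hw x ⟨v, hx⟩
    rw [key] at hx
    obtain rfl := j.isOpenEmbedding.injective hx
    exact ⟨z, hv, rfl⟩

/-- When the source chart contains the whole preimage of the target chart, both sides have the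
sections of `M` over the same open set, and the base change morphism is the identification. -/
lemma isIso_pushforwardRestrict (hw : ∀ x, f x ∈ Set.range j → x ∈ Set.range j') :
    IsIso (pushforwardRestrict w) := by
  have (M : X.Modules) : IsIso ((pushforwardRestrict w).app M) := by
    rw [Hom.isIso_iff_isIso_app]
    intro V
    have e : j' ''ᵁ g ⁻¹ᵁ V = f ⁻¹ᵁ j ''ᵁ V := image_preimage_eq_preimage_image w hw V
    have h : ((pushforwardRestrict w).app M).app V = M.presheaf.map (eqToHom e).op := by
      have e' : (j' ≫ f) ⁻¹ᵁ j ''ᵁ V = (g ≫ j) ⁻¹ᵁ j ''ᵁ V := by rw [w]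
      have e'' : j ⁻¹ᵁ j ''ᵁ V = V := j.preimage_image_eq V
      -- The unit, the comparison isomorphisms and the counit are all restriction maps of `M` or
      -- identities, so the composite is the unique restriction map.
      change (M.presheaf.map (homOfLE (j'.image_preimage_le (f ⁻¹ᵁ j ''ᵁ V))).op ≫ 𝟙 _ ≫
        M.presheaf.map (j'.opensFunctor.map (eqToHom e'.symm)).op ≫ 𝟙 _) ≫
          M.presheaf.map (j'.opensFunctor.map ((Opens.map g.base).map (eqToHom e''.symm))).op = _
      simp only [Category.id_comp, Category.comp_id]
      exact TopCat.Presheaf.map_comp_map_comp_map _ _ _ _ _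
    rw [h]
    have : IsIso (M.presheaf.map (eqToHom e).op) := inferInstance
    exact this
  exact NatIso.isIso_of_isIso_app _

end Modules

end AlgebraicGeometry.Scheme

namespace AlgebraicGeometry

section

variable {R S : CommRingCat.{u}} (φ : R ⟶ S)

/-- Global sections commute with pushforward along a morphism of affine schemes. -/
noncomputable def pushforwardSpecΓ : Scheme.Modules.pushforward (Spec.map φ) ⋙ Scheme.specΓ R ≅
    Scheme.specΓ S ⋙ ModuleCat.restrictScalars φ.hom :=
  Functor.isoWhiskerRight (pushforwardCompModulesSpecToSheafIso φ)
    (TopCat.Sheaf.forget _ _ ⋙ (evaluation _ _).obj (op ⊤))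

instance : IsIso (Functor.whiskerLeft (tilde.functor S ⋙ Scheme.Modules.pushforward (Spec.map φ))
    (Scheme.tildeSpecΓAdjunction R).counit) := by
  have (N : ModuleCat.{u} S) : IsIso ((Functor.whiskerLeft
      (tilde.functor S ⋙ Scheme.Modules.pushforward (Spec.map φ))
        (Scheme.tildeSpecΓAdjunction R).counit).app N) := by
    have : IsIso (tilde N).fromTildeΓ := isIso_fromTildeΓ_iff.2 ⟨N, ⟨Iso.refl _⟩⟩
    exact isIso_fromTildeΓ_pushforward φ (tilde N)
  exact NatIso.isIso_of_isIso_app _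

/-- The pushforward of the sheaf associated with `N` along `Spec S ⟶ Spec R` is the sheaf associated
with `N` considered as an `R`-module. -/
noncomputable def tildePushforward :
    tilde.functor S ⋙ Scheme.Modules.pushforward (Spec.map φ) ≅
      ModuleCat.restrictScalars φ.hom ⋙ tilde.functor R :=
  let e := asIso (Functor.whiskerLeft (tilde.functor S ⋙ Scheme.Modules.pushforward (Spec.map φ))
    (Scheme.tildeSpecΓAdjunction R).counit)
  let e₁ : tilde.functor S ⋙ Scheme.specΓ S ≅ 𝟭 _ := tilde.toTildeΓNatIso.symm
  e.symm ≪≫ Functor.isoWhiskerRight (Functor.isoWhiskerLeft (tilde.functor S)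
    (pushforwardSpecΓ φ)) (tilde.functor R) ≪≫
    Functor.isoWhiskerRight e₁ (ModuleCat.restrictScalars φ.hom ⋙ tilde.functor R)

end

namespace Scheme

section

variable {X Y : Scheme.{u}} [IsLocallyNoetherian X] {f : X ⟶ Y} {R S : CommRingCat.{u}}
  {j : Spec R ⟶ Y} {j' : Spec S ⟶ X} {φ : R ⟶ S} [IsOpenImmersion j] [IsOpenImmersion j']

/-- Pushforward of coherent sheaves in terms of modules. -/
noncomputable def pushforwardRestrictIso (w : j' ≫ f = Spec.map φ ≫ j)
    (hw : ∀ x, f x ∈ Set.range j → x ∈ Set.range j') :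
    ((isCoherent X).ι ⋙ Modules.pushforward f) ⋙ Modules.restrictFunctor j ≅
      (cohSections j' ⋙ ModuleCat.restrictScalars φ.hom) ⋙ tilde.functor R :=
  have := Modules.isIso_pushforwardRestrict w hw
  Functor.isoWhiskerLeft (isCoherent X).ι (asIso (Modules.pushforwardRestrict w)) ≪≫
    Functor.isoWhiskerRight (cohSectionsTilde j').symm (Modules.pushforward (Spec.map φ)) ≪≫
    Functor.isoWhiskerLeft (cohSections j') (tildePushforward φ)

end

section

variable {X Y : Scheme.{u}} [IsLocallyNoetherian X] (f : X ⟶ Y)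

/-- The sections of the pushforward along an affine morphism on an affine open subset. -/
noncomputable def affinePushforwardRestrictIso [IsAffineHom f] {V : Y.Opens}
    (hV : IsAffineOpen V) :
    ((isCoherent X).ι ⋙ Modules.pushforward f) ⋙ Modules.restrictFunctor hV.fromSpec ≅
      (cohSections (hV.preimage f).fromSpec ⋙ ModuleCat.restrictScalars (f.app V).hom) ⋙
        tilde.functor Γ(Y, V) :=
  pushforwardRestrictIso (by
    rw [← IsAffineOpen.SpecMap_appLE_fromSpec f hV (hV.preimage f) le_rfl,
      Scheme.Hom.app_eq_appLE]) (by
    rw [hV.range_fromSpec, (hV.preimage f).range_fromSpec]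
    exact fun x hx ↦ hx)

lemma exists_affineOpen (y : Y) : ∃ V : Y.Opens, IsAffineOpen V ∧ y ∈ V := by
  obtain ⟨_, ⟨V, hV, rfl⟩, hyV, -⟩ :=
    Y.isBasis_affineOpens.exists_subset_of_mem_open (Set.mem_univ y) isOpen_univ
  exact ⟨V, hV, hyV⟩

lemma isCoherent_pushforward [IsFinite f] (M : Coh X) :
    isCoherent Y ((Modules.pushforward f).obj M.obj) := by
  intro y
  obtain ⟨V, hV, hy⟩ := exists_affineOpen y
  refine ⟨V, hV, hy, _, ?_, ⟨(affinePushforwardRestrictIso f hV).app M⟩⟩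
  have hf : (f.app V).hom.Finite := IsFinite.finite_app f V hV
  let N := (cohSections (hV.preimage f).fromSpec).obj M
  have hN : Module.Finite Γ(X, f ⁻¹ᵁ V) N := inferInstance
  -- The sections are finite over `Γ(X, f ⁻¹ᵁ V)`, which is finite over `Γ(Y, V)`; finiteness is
  -- transitive.
  algebraize [(f.app V).hom]
  let : Module Γ(Y, V) N := Module.compHom N (f.app V).hom
  have : IsScalarTower Γ(Y, V) Γ(X, f ⁻¹ᵁ V) N := ⟨fun a b c ↦ mul_smul _ _ _⟩
  have h : Module.Finite Γ(Y, V) N := Module.Finite.trans Γ(X, f ⁻¹ᵁ V) N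
  exact h

/-- The pushforward of coherent sheaves along a finite morphism. -/
noncomputable def cohPushforward [IsFinite f] : Coh X ⥤ Coh Y :=
  (isCoherent Y).lift ((isCoherent X).ι ⋙ Modules.pushforward f) (isCoherent_pushforward f)

/-- The adjunction between the pullback and the pushforward of coherent sheaves along a finite
morphism. -/
noncomputable def cohPullbackPushforwardAdjunction [IsFinite f] :
    cohPullback f ⊣ cohPushforward f :=
  (Modules.pullbackPushforwardAdjunction f).restrictFullyFaithful (isCoherent Y).fullyFaithfulι
    (isCoherent X).fullyFaithfulι (Iso.refl _) (Iso.refl _)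

variable [IsFinite f] [IsLocallyNoetherian Y]

/-- Sections of the pushforward of a coherent sheaf on affine open subsets. -/
noncomputable def cohPushforwardSectionsIso {V : Y.Opens} (hV : IsAffineOpen V) :
    cohPushforward f ⋙ cohSections hV.fromSpec ≅
      cohSections (hV.preimage f).fromSpec ⋙ ModuleCat.restrictScalars (f.app V).hom :=
  let e : tilde.functor Γ(Y, V) ⋙ specΓ Γ(Y, V) ≅ 𝟭 _ := tilde.toTildeΓNatIso.symm
  Functor.isoWhiskerRight (affinePushforwardRestrictIso f hV) (specΓ _) ≪≫
    Functor.isoWhiskerLeft (cohSections (hV.preimage f).fromSpec ⋙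
      ModuleCat.restrictScalars (f.app V).hom) e

instance : (cohPushforward f).Additive :=
  (cohPullbackPushforwardAdjunction f).right_adjoint_additive

instance : PreservesFiniteLimits (cohPushforward f) :=
  have := (cohPullbackPushforwardAdjunction f).rightAdjoint_preservesLimits
  PreservesLimits.preservesFiniteLimits _

instance : PreservesFiniteColimits (cohPushforward f) := by
  have : (cohPushforward f).PreservesEpimorphisms := ⟨fun φ _ ↦ by
    refine coh_epi_of_local fun y ↦ ?_
    obtain ⟨V, hV, hy⟩ := exists_affineOpen y
    refine ⟨_, hV.fromSpec, inferInstance, ?_, ?_⟩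
    · rwa [hV.range_fromSpec]
    · exact (NatIso.epi_map_iff (cohPushforwardSectionsIso f hV) φ).2 inferInstance⟩
  exact preservesFiniteColimits_of_epi _

/-- On affine charts pushforward is restriction of scalars, which is faithful, and the preimages of
these charts cover `X`. Faithfulness makes the counit epi. -/
instance : (cohPushforward f).Faithful where
  map_injective {M N φ ψ} h := by
    rw [← sub_eq_zero]
    refine coh_eq_zero_of_local fun x ↦ ?_
    obtain ⟨V, hV, hy⟩ := exists_affineOpen (f x)
    refine ⟨_, (hV.preimage f).fromSpec, inferInstance, ?_, ?_⟩
    · rwa [(hV.preimage f).range_fromSpec]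
    · have h₀ : (cohPushforward f ⋙ cohSections hV.fromSpec).map (φ - ψ) = 0 := by
        rw [Functor.comp_map, (cohPushforward f).map_sub, h, sub_self, Functor.map_zero]
      rw [NatIso.map_eq_zero_iff (cohPushforwardSectionsIso f hV)] at h₀
      exact (ModuleCat.restrictScalars (f.app V).hom).map_eq_zero_iff.1 h₀

end

end Scheme

end AlgebraicGeometry

/-! ### Flat pullback and existence of adapted sheaves. -/

lemma ModuleCat.preservesMonomorphisms_extendScalars {R S : CommRingCat.{u}} (φ : R ⟶ S)
    (hφ : φ.hom.Flat) : (ModuleCat.extendScalars.{u, u, u} φ.hom).PreservesMonomorphisms where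
  preserves {M N} g _ := by
    rw [ModuleCat.mono_iff_injective]
    algebraize [φ.hom]
    exact Module.Flat.lTensor_preserves_injective_linearMap (M := S) g.hom
      ((ModuleCat.mono_iff_injective g).1 inferInstance)

namespace AlgebraicGeometry

/-- The pullback of the sheaf associated with `N` along `Spec S ⟶ Spec R` is the sheaf associated
with `S ⊗[R] N`, naturally in `N`. -/
noncomputable def tildePullback {R S : CommRingCat.{u}} (φ : R ⟶ S) :
    tilde.functor R ⋙ Scheme.Modules.pullback (Spec.map φ) ≅
      ModuleCat.extendScalars φ.hom ⋙ tilde.functor S :=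
  (((Scheme.tildeSpecΓAdjunction R).comp
      (Scheme.Modules.pullbackPushforwardAdjunction (Spec.map φ))).ofNatIsoRight
        (pushforwardSpecΓ φ)).leftAdjointUniq
    ((ModuleCat.extendRestrictScalarsAdj φ.hom).comp (Scheme.tildeSpecΓAdjunction S))

namespace Scheme

variable {X Y : Scheme.{u}} [IsLocallyNoetherian X] [IsLocallyNoetherian Y] {f : X ⟶ Y}

section

variable {R S : CommRingCat.{u}} {j : Spec R ⟶ Y} {j' : Spec S ⟶ X} {φ : R ⟶ S}
  [IsOpenImmersion j] [IsOpenImmersion j']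

/-- The pullback of coherent sheaves is given by the extension of scalars on affine open
subschemes. -/
noncomputable def cohPullbackRestrictIso (w : j' ≫ f = Spec.map φ ≫ j) :
    cohPullback f ⋙ cohRestrict j' ≅
      (cohSections j ⋙ ModuleCat.extendScalars φ.hom) ⋙ tilde.functor S :=
  let e₁ : Modules.pullback f ⋙ Modules.restrictFunctor j' ≅
      Modules.restrictFunctor j ⋙ Modules.pullback (Spec.map φ) :=
    Functor.isoWhiskerLeft _ (Modules.restrictFunctorIsoPullback j') ≪≫
      Modules.pullbackComp j' f ≪≫ Modules.pullbackCongr w ≪≫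
      (Modules.pullbackComp (Spec.map φ) j).symm ≪≫
      Functor.isoWhiskerRight (Modules.restrictFunctorIsoPullback j).symm _
  Functor.isoWhiskerLeft (isCoherent Y).ι e₁ ≪≫
    Functor.isoWhiskerRight (cohSectionsTilde j).symm (Modules.pullback (Spec.map φ)) ≪≫
    Functor.isoWhiskerLeft (cohSections j) (tildePullback φ)

/-- The pullback of coherent sheaves is given by the extension of scalars on affine open
subschemes. -/
noncomputable def cohPullbackSectionsIso (w : j' ≫ f = Spec.map φ ≫ j) :
    cohPullback f ⋙ cohSections j' ≅ cohSections j ⋙ ModuleCat.extendScalars φ.hom :=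
  let e : tilde.functor S ⋙ specΓ S ≅ 𝟭 _ := tilde.toTildeΓNatIso.symm
  Functor.isoWhiskerRight (cohPullbackRestrictIso w) (specΓ S) ≪≫
    Functor.isoWhiskerLeft (cohSections j ⋙ ModuleCat.extendScalars φ.hom) e

end

variable (f)

omit [IsLocallyNoetherian X] [IsLocallyNoetherian Y] in
lemma exists_affineOpen_le (x : X) : ∃ (V : Y.Opens) (W : X.Opens) (_ : IsAffineOpen V)
    (_ : IsAffineOpen W), x ∈ W ∧ W ≤ f ⁻¹ᵁ V := by
  obtain ⟨V, hV, hx⟩ := exists_affineOpen (f x)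
  obtain ⟨_, ⟨W, hW, rfl⟩, hxW, hWV⟩ :=
    X.isBasis_affineOpens.exists_subset_of_mem_open (show x ∈ f ⁻¹ᵁ V from hx) (f ⁻¹ᵁ V).2
  exact ⟨V, W, hV, hW, hxW, hWV⟩

/-- The pullback of coherent sheaves along a flat morphism is exact. -/
lemma preservesMonomorphisms_cohPullback [Flat f] : (cohPullback f).PreservesMonomorphisms where
  preserves {M N} φ _ := by
    refine coh_mono_of_local fun x ↦ ?_
    obtain ⟨V, W, hV, hW, hx, h⟩ := exists_affineOpen_le f x
    refine ⟨_, hW.fromSpec, inferInstance, by rwa [hW.range_fromSpec], ?_⟩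
    have hφ : (f.appLE V W h).hom.Flat := Flat.flat_appLE f hV hW h
    have := ModuleCat.preservesMonomorphisms_extendScalars _ hφ
    have e := cohPullbackSectionsIso (IsAffineOpen.SpecMap_appLE_fromSpec f hV hW h).symm
    exact (NatIso.mono_map_iff e φ).2 inferInstance

variable {Z : Scheme.{u}} [IsLocallyNoetherian Z]

/-- Derived pullbacks exist along a finite morphism `f : X ⟶ Y` if there is a finite flat morphism
`p : Y ⟶ Z` such that `f ≫ p` is also flat. -/
lemma isPullbackDerivable [IsFinite f] (p : Y ⟶ Z) [IsFinite p] [Flat p] [Flat (f ≫ p)] :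
    IsPullbackDerivable f where
  exists_adjunction := ⟨_, ⟨cohPullbackPushforwardAdjunction f⟩, inferInstance⟩
  exists_isLeftAdapted := by
    have := preservesMonomorphisms_cohPullback p
    have : PreservesFiniteColimits (cohPullback p) :=
      have := (cohPullbackPushforwardAdjunction p).leftAdjoint_preservesColimits
      PreservesColimits.preservesFiniteColimits _
    have : PreservesFiniteColimits (cohPullback f) :=
      have := (cohPullbackPushforwardAdjunction f).leftAdjoint_preservesColimits
      PreservesColimits.preservesFiniteColimits _
    have := preservesFiniteLimits_of_mono (cohPullback p)
    -- The composite is the pullback along the flat morphism `f ≫ p`, so objects pulled back along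
    -- `p` are acyclic for `f^*`.
    have : (cohPullback p ⋙ cohPullback f).PreservesMonomorphisms := ⟨fun φ _ ↦ by
      have := preservesMonomorphisms_cohPullback (f ≫ p)
      exact (NatIso.mono_map_iff (cohPullbackComp f p) φ).2 inferInstance⟩
    exact ⟨_, (cohPullbackPushforwardAdjunction p).isLeftAdapted (cohPullback f)⟩

end Scheme

end AlgebraicGeometry

/-! ### Dimension of supports. -/

section

open Topology

lemma Topology.IsInducing.isPreirreducible_preimage {S T : Type*} [TopologicalSpace S]
    [TopologicalSpace T] {f : S → T} (hf : IsInducing f) {Z : Set T} (hZ : IsPreirreducible Z)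
    (h : Z ⊆ Set.range f) : IsPreirreducible (f ⁻¹' Z) := by
  rintro u v hu hv ⟨x, hx, hxu⟩ ⟨y, hy, hyv⟩
  obtain ⟨u', hu', rfl⟩ := hf.isOpen_iff.1 hu
  obtain ⟨v', hv', rfl⟩ := hf.isOpen_iff.1 hv
  obtain ⟨_, hz, hzu, hzv⟩ := hZ u' v' hu' hv' ⟨f x, hx, hxu⟩ ⟨f y, hy, hyv⟩
  obtain ⟨z, rfl⟩ := h hz
  exact ⟨z, hz, hzu, hzv⟩

/-- A chain of irreducible closed subsets contained in a subset `A` gives a lower bound for the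
dimension of `A`. -/
lemma LTSeries.length_le_topologicalKrullDim {S T : Type*} [TopologicalSpace S]
    [TopologicalSpace T] {f : S → T} (hf : IsInducing f) (p : LTSeries (IrreducibleCloseds T))
    (h : (p.last : Set T) ⊆ Set.range f) : p.length ≤ topologicalKrullDim S := by
  have hp (i) : (p i : Set T) ⊆ Set.range f :=
    (show (p i : Set T) ⊆ p.last from p.monotone (Fin.le_last i)).trans h
  let q : LTSeries (IrreducibleCloseds S) :=
    { length := p.length
      toFun i :=
        { carrier := f ⁻¹' p i
          isIrreducible' := by
            refine ⟨?_, hf.isPreirreducible_preimage (p i).isIrreducible.2 (hp i)⟩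
            obtain ⟨x, hx⟩ := (p i).isIrreducible.1
            obtain ⟨y, rfl⟩ := hp i hx
            exact ⟨y, hx⟩
          isClosed' := (p i).isClosed.preimage hf.continuous }
      step i := by
        obtain ⟨h₁, x, hx, hx'⟩ := Set.ssubset_iff_exists.1
          (show (p i.castSucc : Set T) ⊂ p i.succ from p.step i)
        obtain ⟨y, rfl⟩ := hp _ hx
        exact (Set.ssubset_iff_exists (s := f ⁻¹' p i.castSucc) (t := f ⁻¹' p i.succ)).2
          ⟨Set.preimage_mono h₁, y, hx, hx'⟩ }
  exact Order.LTSeries.length_le_krullDim q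

/-- The largest member of a chain of irreducible closed subsets of `C` is irreducible, so it, and
with it the chain, lies in `A` or in `B`. -/
lemma topologicalKrullDim_le_of_subset_union {T : Type*} [TopologicalSpace T] {A B C : Set T}
    (hA : IsClosed A) (hB : IsClosed B) (h : C ⊆ A ∪ B) {d : WithBot ℕ∞}
    (hdA : topologicalKrullDim A ≤ d) (hdB : topologicalKrullDim B ≤ d) :
    topologicalKrullDim C ≤ d := by
  refine iSup_le fun p ↦ ?_
  have key {D : Set T} (hD : topologicalKrullDim D ≤ d) (hp : (p.last : Set C) ⊆ (↑) ⁻¹' D) :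
      p.length ≤ d := by
    refine (p.length_le_topologicalKrullDim (f := Set.inclusion
      (Set.inter_subset_left : C ∩ D ⊆ C)) (IsEmbedding.inclusion _).isInducing ?_).trans
      (((IsEmbedding.inclusion Set.inter_subset_right).isInducing.topologicalKrullDim_le).trans hD)
    exact fun x hx ↦ ⟨⟨x, x.2, hp hx⟩, rfl⟩
  obtain h | h := isPreirreducible_iff_isClosed_union_isClosed.1 p.last.isIrreducible.2
    _ _ (hA.preimage continuous_subtype_val) (hB.preimage continuous_subtype_val)
    (fun x _ ↦ h x.2)
  · exact key hdA h
  · exact key hdB h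

end

namespace AlgebraicGeometry.Scheme

lemma isZero_stalk_tilde_iff {R : CommRingCat.{u}} (N : ModuleCat.{u} R) (x : PrimeSpectrum R) :
    IsZero ((tilde N).presheaf.stalk x) ↔ x ∉ Module.support R N := by
  refine Iff.trans ?_ (Module.notMem_support_iff (R := R) (M := N) (p := x)).symm
  rw [AddCommGrpCat.isZero_iff_subsingleton]
  let inst (y : PrimeSpectrum.Top R) : Module R ((tilde N).presheaf.stalk y) := inferInstance
  let := inst x
  let l : N →ₗ[R] (tilde N).presheaf.stalk x := (tilde.toStalk N x).hom
  have hl (y : PrimeSpectrum.Top R) : @IsLocalizedModule R _ N ((tilde N).presheaf.stalk y) _ _ _ _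
    (@Ideal.primeCompl R _ y.asIdeal y.isPrime) (tilde.toStalk N y).hom := inferInstance
  have : IsLocalizedModule x.asIdeal.primeCompl l := hl x
  exact (IsLocalizedModule.iso x.asIdeal.primeCompl l).toEquiv.subsingleton_congr.symm

section

variable {Y : Scheme.{u}} [IsLocallyNoetherian Y] {R : CommRingCat.{u}} (j : Spec R ⟶ Y)
  [IsOpenImmersion j]

/-- The support of a coherent sheaf is locally the support of its module of sections. -/
lemma mem_supp_iff (M : Coh Y) (x : Spec R) :
    j x ∈ supp M.obj ↔ x ∈ Module.support R ((cohSections j).obj M) := by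
  refine Iff.trans (Iff.not ?_) (not_iff_not.2 (isZero_stalk_tilde_iff _ x)|>.trans not_not)
  refine Iff.trans ((Modules.restrictStalkNatIso j x).app M.obj).symm.isZero_iff ?_
  exact ((Modules.toPresheaf _ ⋙ TopCat.Presheaf.stalkFunctor _ x).mapIso
    ((cohSectionsTilde j).app M)).symm.isZero_iff

end

variable {Y : Scheme.{u}} [IsLocallyNoetherian Y]

lemma exists_affineOpen_fromSpec (y : Y) : ∃ (R : CommRingCat.{u}) (j : Spec R ⟶ Y)
    (_ : IsOpenImmersion j) (x : Spec R), j x = y := by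
  obtain ⟨V, hV, hy⟩ := exists_affineOpen y
  exact ⟨_, hV.fromSpec, inferInstance, by
    have : y ∈ Set.range hV.fromSpec := by rwa [hV.range_fromSpec]
    exact this⟩

lemma supp_subset_of_epi {M N : Coh Y} (φ : M ⟶ N) [Epi φ] : supp N.obj ⊆ supp M.obj := by
  intro y
  obtain ⟨R, j, _, x, rfl⟩ := exists_affineOpen_fromSpec y
  rw [mem_supp_iff, mem_supp_iff]
  exact fun h ↦ Module.support_subset_of_surjective ((cohSections j).map φ).hom
    ((ModuleCat.epi_iff_surjective _).1 inferInstance) h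

lemma supp_of_shortExact {S : ShortComplex (Coh Y)} (hS : S.ShortExact) :
    supp S.X₂.obj ⊆ supp S.X₁.obj ∪ supp S.X₃.obj := by
  intro y
  obtain ⟨R, j, _, x, rfl⟩ := exists_affineOpen_fromSpec y
  have h := hS.map_of_exact (cohSections j)
  rw [Set.mem_union, mem_supp_iff, mem_supp_iff, mem_supp_iff]
  exact fun hx ↦ (Module.support_of_exact
    ((ShortComplex.ShortExact.moduleCat_exact_iff_function_exact _).1 h.exact)
    h.moduleCat_injective_f h.moduleCat_surjective_g).subset hx

lemma isClosed_supp (M : Coh Y) : IsClosed (supp M.obj) := by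
  rw [← isOpen_compl_iff, isOpen_iff_forall_mem_open]
  intro y hy
  obtain ⟨R, j, _, x, rfl⟩ := exists_affineOpen_fromSpec y
  refine ⟨j '' (Module.support R ((cohSections j).obj M))ᶜ, ?_,
    j.isOpenEmbedding.isOpenMap _ (Module.isClosed_support).isOpen_compl, x, ?_, rfl⟩
  · rintro _ ⟨z, hz, rfl⟩ h
    exact hz ((mem_supp_iff j M z).1 h)
  · exact fun h ↦ hy ((mem_supp_iff j M x).2 h)

/-- If every element of `N` is killed by a scalar outside the contracted prime, then so is every
tensor, taking products of scalars for sums. -/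
lemma ModuleCat.support_extendScalars_subset {R S : CommRingCat.{u}} (φ : R ⟶ S)
    (N : ModuleCat.{u} R) :
    Module.support S ((ModuleCat.extendScalars φ.hom).obj N) ⊆
      PrimeSpectrum.comap φ.hom ⁻¹' Module.support R N := by
  intro x hx
  by_contra h
  rw [Set.mem_preimage, Module.notMem_support_iff'] at h
  refine absurd hx (Module.notMem_support_iff'.2 ?_)
  algebraize [φ.hom]
  intro m
  change TensorProduct R S N at m
  change ∃ r ∉ x.asIdeal, r • m = 0
  induction m with
  | zero => exact ⟨1, x.2.one_notMem, smul_zero _⟩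
  | tmul s n =>
    obtain ⟨r, hr, h⟩ := h n
    refine ⟨φ.hom r, hr, ?_⟩
    change algebraMap R S r • _ = _
    rw [algebraMap_smul, ← TensorProduct.tmul_smul, h, TensorProduct.tmul_zero]
  | add a b ha hb =>
    obtain ⟨r, hr, ha⟩ := ha
    obtain ⟨t, ht, hb⟩ := hb
    refine ⟨r * t, x.2.mul_notMem hr ht, ?_⟩
    rw [smul_add, mul_smul, mul_smul, hb, smul_zero, smul_comm, ha, smul_zero, add_zero]

lemma supp_cohPullback_subset {X : Scheme.{u}} [IsLocallyNoetherian X] (f : X ⟶ Y) (M : Coh Y) :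
    supp ((cohPullback f).obj M).obj ⊆ f ⁻¹' supp M.obj := by
  intro x hx
  obtain ⟨V, W, hV, hW, hxW, h⟩ := exists_affineOpen_le f x
  obtain ⟨x, rfl⟩ : x ∈ Set.range hW.fromSpec := by rwa [hW.range_fromSpec]
  have w := IsAffineOpen.SpecMap_appLE_fromSpec f hV hW h
  rw [mem_supp_iff] at hx
  have hx' : x ∈ Module.support _ ((cohSections hV.fromSpec ⋙
      ModuleCat.extendScalars (f.appLE V W h).hom).obj M) := by
    rwa [← ((cohPullbackSectionsIso w.symm).app M).toLinearEquiv.support_eq]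
  rw [Set.mem_preimage, ← Scheme.Hom.comp_apply, ← w, Scheme.Hom.comp_apply, mem_supp_iff]
  exact ModuleCat.support_extendScalars_subset _ _ hx'

lemma cohLE.of_epi {M N : Coh Y} {d : ℕ} (h : cohLE Y d M) (φ : M ⟶ N) [Epi φ] : cohLE Y d N :=
  (Topology.IsEmbedding.inclusion (supp_subset_of_epi φ)).isInducing.topologicalKrullDim_le.trans h

lemma cohLE.of_shortExact {S : ShortComplex (Coh Y)} (hS : S.ShortExact) {d : ℕ}
    (h₁ : cohLE Y d S.X₁) (h₃ : cohLE Y d S.X₃) : cohLE Y d S.X₂ :=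
  topologicalKrullDim_le_of_subset_union (isClosed_supp _) (isClosed_supp _)
    (supp_of_shortExact hS) h₁ h₃

lemma cohLE_of_isZero {M : Coh Y} (h : IsZero M) (d : ℕ) : cohLE Y d M := by
  have : IsEmpty (supp M.obj) := ⟨fun ⟨y, hy⟩ ↦ hy
    (((isCoherent Y).ι ⋙ Modules.toPresheaf Y ⋙ TopCat.Presheaf.stalkFunctor _ y).map_isZero h)⟩
  have : IsEmpty (IrreducibleCloseds (supp M.obj)) :=
    ⟨fun Z ↦ this.elim Z.isIrreducible.1.some⟩
  exact (Order.krullDim_eq_bot (α := IrreducibleCloseds (supp M.obj))).trans_le bot_le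

instance (d : ℕ) : (cohLE Y d).IsClosedUnderIsomorphisms where
  of_iso e h := h.of_epi e.hom

instance (d : ℕ) : (cohGESucc Y d).IsClosedUnderIsomorphisms where
  of_iso e h := h.of_iso e

/-- The support of the pullback lies in the preimage of the support, and an inducing map does not
lower dimension from source to target. -/
lemma cohLE.cohPullback {X : Scheme.{u}} [IsLocallyNoetherian X] {f : X ⟶ Y}
    (hf : Topology.IsInducing f) {M : Coh Y} {d : ℕ} (h : cohLE Y d M) :
    cohLE X d ((cohPullback f).obj M) :=
  (Topology.IsInducing.topologicalKrullDim_le (f := fun x : supp ((Scheme.cohPullback f).obj M).obj ↦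
    (⟨f x, supp_cohPullback_subset f M x.2⟩ : supp M.obj))
    (.codRestrict (hf.comp .subtypeVal) _)).trans h

end AlgebraicGeometry.Scheme

/-! ### The torsion pair of sheaves with small support. -/

namespace CategoryTheory.ShortComplex

variable {C : Type*} [Category C] [Abelian C]

/-- The inverse image of a subobject of the quotient in a short exact sequence. -/
lemma ShortExact.pullback {S : ShortComplex C} (hS : S.ShortExact) {I : C} (i : I ⟶ S.X₃) :
    (ShortComplex.mk (pullback.lift (f := S.g) (g := i) S.f 0 (by rw [zero_comp, S.zero]))
      (pullback.snd S.g i) (pullback.lift_snd _ _ _)).ShortExact := by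
  have := hS.mono_f
  have := hS.epi_g
  have : Mono (pullback.lift (f := S.g) (g := i) S.f 0 (by rw [zero_comp, S.zero])) :=
    mono_of_mono_fac (pullback.lift_fst _ _ _)
  refine { exact := ShortComplex.exact_of_f_is_kernel _ ?_, mono_f := this, epi_g := ?_ }
  · refine KernelFork.IsLimit.ofι' _ _ fun {A} k hk ↦ ?_
    have h : (k ≫ pullback.fst S.g i) ≫ S.g = 0 := by
      rw [Category.assoc, pullback.condition, reassoc_of% hk, zero_comp]
    refine ⟨hS.fIsKernel.lift (KernelFork.ofι _ h), ?_⟩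
    have h' : hS.fIsKernel.lift (KernelFork.ofι _ h) ≫ S.f = k ≫ pullback.fst S.g i :=
      hS.fIsKernel.fac _ WalkingParallelPair.zero
    ext
    · exact (Category.assoc _ _ _).trans ((congr_arg _ (pullback.lift_fst _ _ _)).trans h')
    · exact (Category.assoc _ _ _).trans ((congr_arg _ (pullback.lift_snd _ _ _)).trans
        (comp_zero.trans hk.symm))
  · dsimp
    infer_instance

end CategoryTheory.ShortComplex

namespace AlgebraicGeometry.Scheme

variable {Y : Scheme.{u}} [IsLocallyNoetherian Y]

/-- A finite family of affine charts. -/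
lemma exists_finite_affineOpen_cover (Y : Scheme.{u}) [CompactSpace Y] :
    ∃ (t : Finset Y) (V : Y → Y.Opens), (∀ y, IsAffineOpen (V y)) ∧ ∀ y, ∃ i ∈ t, y ∈ V i := by
  choose V hV hy using fun y : Y ↦ exists_affineOpen y
  obtain ⟨t, -, ht⟩ := isCompact_univ.elim_nhds_subcover (fun y ↦ (V y : Set Y))
    fun y _ ↦ (V y).2.mem_nhds (hy y)
  refine ⟨t, V, hV, fun y ↦ ?_⟩
  simpa using ht (Set.mem_univ y)

/-- The family of modules of sections of a subobject over affine open subsets. -/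
noncomputable def sectionsRange {V : Y → Y.Opens} (hV : ∀ y, IsAffineOpen (V y)) (t : Finset Y)
    {P M : Coh Y} (f : P ⟶ M) (i : t) :
    Submodule Γ(Y, V i) ((cohSections (hV i).fromSpec).obj M) :=
  LinearMap.range ((cohSections (hV i).fromSpec).map f).hom

lemma sectionsRange_comp_le {V : Y → Y.Opens} (hV : ∀ y, IsAffineOpen (V y)) (t : Finset Y)
    {P Q M : Coh Y} (g : P ⟶ Q) (f : Q ⟶ M) :
    sectionsRange hV t (g ≫ f) ≤ sectionsRange hV t f := fun i ↦ by
  unfold sectionsRange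
  rw [Functor.map_comp, ModuleCat.hom_comp]
  exact LinearMap.range_comp_le_range _ _

/-- A subobject is determined by its sections on the charts, so strict inclusions of subsheaves give
strict inclusions of families of submodules. -/
lemma epi_of_sectionsRange_le {V : Y → Y.Opens} (hV : ∀ y, IsAffineOpen (V y)) (t : Finset Y)
    (ht : ∀ y, ∃ i ∈ t, y ∈ V i) {P Q M : Coh Y} (g : P ⟶ Q) (f : Q ⟶ M) [Mono f]
    (h : sectionsRange hV t f ≤ sectionsRange hV t (g ≫ f)) : Epi g := by
  refine coh_epi_of_local fun y ↦ ?_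
  obtain ⟨i, hi, hy⟩ := ht y
  refine ⟨_, (hV i).fromSpec, inferInstance, by rwa [(hV i).range_fromSpec], ?_⟩
  refine (ModuleCat.epi_iff_surjective _).2 fun x ↦ ?_
  have h' := h ⟨i, hi⟩
  unfold sectionsRange at h'
  obtain ⟨z, hz⟩ := h' ⟨x, rfl⟩
  rw [Functor.map_comp, ModuleCat.hom_comp] at hz
  exact ⟨z, (ModuleCat.mono_iff_injective ((cohSections (hV i).fromSpec).map f)).1
    inferInstance hz⟩

/-- The ascending chain condition uses finiteness of the cover: a finite product of the noetherian
submodule lattices. -/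
lemma wellFoundedGT_pi_submodule {V : Y → Y.Opens} (hV : ∀ y, IsAffineOpen (V y)) (t : Finset Y)
    (M : Coh Y) : WellFoundedGT
      (∀ i : t, Submodule Γ(Y, V i) ((cohSections (hV i).fromSpec).obj M)) := by
  have (i : t) : IsNoetherianRing Γ(Y, V i) :=
    IsLocallyNoetherian.component_noetherian ⟨V i, hV i⟩
  have (i : t) : WellFoundedGT (Submodule Γ(Y, V i) ((cohSections (hV i).fromSpec).obj M)) :=
    inferInstance
  have : WellFoundedLT
      (∀ i : t, (Submodule Γ(Y, V i) ((cohSections (hV i).fromSpec).obj M))ᵒᵈ) := inferInstance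
  exact ⟨this.wf⟩

open ZeroObject in
/-- On a noetherian scheme, every coherent sheaf has a largest subsheaf whose support has dimension
at most `d`. -/
lemma exists_shortExact_cohLE_cohGESucc [CompactSpace Y] (d : ℕ) (M : Coh Y) :
    ∃ S : ShortComplex (Coh Y), S.ShortExact ∧ S.X₂ = M ∧ cohLE Y d S.X₁ ∧
      cohGESucc Y d S.X₃ := by
  obtain ⟨t, V, hV, ht⟩ := exists_finite_affineOpen_cover Y
  have := wellFoundedGT_pi_submodule hV t M
  let A : Set (∀ i : t, Submodule Γ(Y, V i) ((cohSections (hV i).fromSpec).obj M)) :=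
    {a | ∃ (P : Coh Y) (f : P ⟶ M), Mono f ∧ cohLE Y d P ∧ sectionsRange hV t f = a}
  have hA : A.Nonempty := ⟨_, _, (0 : 0 ⟶ M), inferInstance, cohLE_of_isZero (isZero_zero _) d, rfl⟩
  obtain ⟨_, ⟨P, f, hf, hP, rfl⟩, hmax⟩ := wellFounded_gt.has_min A hA
  let S : ShortComplex (Coh Y) := ShortComplex.mk f (cokernel.π f) (cokernel.condition f)
  have hS : S.ShortExact :=
    { exact := ShortComplex.exact_cokernel f, mono_f := hf, epi_g := inferInstanceAs (Epi (cokernel.π f)) }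
  refine ⟨S, hS, rfl, hP, fun T hT φ ↦ ?_⟩
  have hI : cohLE Y d (image φ) := hT.of_epi (factorThruImage φ)
  have hS' := hS.pullback (image.ι φ)
  -- The preimage in `M` of the image of `φ` extends that image by `P`. By maximality it equals `P`,
  -- so the image is zero.
  have hP' : cohLE Y d (pullback S.g (image.ι φ)) := cohLE.of_shortExact hS' hP hI
  let g : P ⟶ pullback S.g (image.ι φ) := pullback.lift S.f 0 (by rw [zero_comp, S.zero])
  have hg : g ≫ pullback.fst S.g (image.ι φ) = f := pullback.lift_fst _ _ _
  have : Epi g := by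
    refine epi_of_sectionsRange_le hV t ht g (pullback.fst S.g (image.ι φ)) ?_
    rw [hg]
    have h₁ := sectionsRange_comp_le hV t g (pullback.fst S.g (image.ι φ))
    rw [hg] at h₁
    by_contra h₂
    exact hmax _ ⟨_, pullback.fst S.g (image.ι φ), inferInstance, hP', rfl⟩
      (lt_of_le_not_ge h₁ h₂)
  have h₀ : pullback.snd S.g (image.ι φ) = 0 := by
    rw [← cancel_epi g, comp_zero]
    exact pullback.lift_snd _ _ _
  have : Epi (pullback.snd S.g (image.ι φ)) := hS'.epi_g
  have h₁ : image.ι φ = 0 := by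
    rw [← cancel_epi (pullback.snd S.g (image.ι φ)), h₀, zero_comp, zero_comp]
  rw [← image.fac φ, h₁, comp_zero]

lemma isTorsionPair_cohLE_cohGESucc (Y : Scheme.{u}) [IsLocallyNoetherian Y] [CompactSpace Y]
    (d : ℕ) : DerivedCategory.IsTorsionPair (cohLE Y d) (cohGESucc Y d) where
  torsion_iso := inferInstance
  free_iso := inferInstance
  zero := fun _ _ φ hT hF ↦ hF _ hT φ
  exists_shortExact M := exists_shortExact_cohLE_cohGESucc d M

/-- The tilted t-structure exists on noetherian schemes. -/
lemma nonempty_perverseTStructure (Y : Scheme.{u}) [IsLocallyNoetherian Y] [CompactSpace Y] :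
    Nonempty (PerverseTStructure Y) :=
  ⟨{ t := (isTorsionPair_cohLE_cohGESucc Y 1).tilt
     le_zero := rfl
     ge_zero := rfl }⟩

end AlgebraicGeometry.Scheme

/-! ### Coefficient fields. -/

/-- Field extensions in characteristic zero are formally smooth. -/
lemma Algebra.FormallySmooth.of_charZero (k K : Type*) [Field k] [CharZero k] [Field K]
    [Algebra k K] : Algebra.FormallySmooth k K := by
  obtain ⟨s, hs⟩ := exists_isTranscendenceBasis k K
  have : Algebra.IsAlgebraic (IntermediateField.adjoin k (Set.range ((↑) : s → K))) K :=
    hs.isAlgebraic_field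
  exact .of_algebraicIndependent_of_isSeparable hs.1

section CoefficientField

variable (k : Type*) [Field k] [CharZero k] {R : Type*} [CommRing R] [Algebra k R] (π : R)
  [(Ideal.span {π}).IsMaximal] {m : ℕ}

lemma span_pow_le (hm : 1 ≤ m) : Ideal.span {π ^ m} ≤ Ideal.span {π} :=
  Ideal.span_singleton_le_span_singleton.2 (dvd_pow_self π (by lia))

/-- The ring `R / π ^ m` contains a copy of its residue field `R / π`, over which it is finite. -/
lemma exists_algHom_quotient_pow_finite (hm : 1 ≤ m) :
    ∃ c : R ⧸ Ideal.span {π} →ₐ[k] R ⧸ Ideal.span {π ^ m}, c.toRingHom.Finite := by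
  let := Ideal.Quotient.field (Ideal.span {π})
  have := Algebra.FormallySmooth.of_charZero k (R ⧸ Ideal.span {π})
  let q : R ⧸ Ideal.span {π ^ m} →ₐ[k] R ⧸ Ideal.span {π} :=
    Ideal.Quotient.factorₐ k (span_pow_le π hm)
  have hq : Function.Surjective q := Ideal.Quotient.factor_surjective (span_pow_le π hm)
  have hker : RingHom.ker q = Ideal.span {Ideal.Quotient.mk (Ideal.span {π ^ m}) π} := by
    refine (Ideal.Quotient.factor_ker (span_pow_le π hm)).trans ?_
    rw [Ideal.map_span, Set.image_singleton]
  have hnil : RingHom.ker q ^ m = ⊥ := by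
    rw [hker, Ideal.span_singleton_pow, ← map_pow, Ideal.span_singleton_eq_bot,
      Ideal.Quotient.eq_zero_iff_mem]
    exact Ideal.mem_span_singleton_self _
  -- The section lifts the identity of the residue field along a surjection with nilpotent kernel.
  let c := Algebra.FormallySmooth.liftOfSurjective (AlgHom.id k (R ⧸ Ideal.span {π})) q hq ⟨m, hnil⟩
  have hc (x) : q (c x) = x := Algebra.FormallySmooth.liftOfSurjective_apply _ q hq ⟨m, hnil⟩ x
  refine ⟨c, ?_⟩
  let := c.toRingHom.toAlgebra
  let q' : R ⧸ Ideal.span {π ^ m} →ₐ[R ⧸ Ideal.span {π}] R ⧸ Ideal.span {π} :=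
    { q with commutes' := hc }
  have hk : RingHom.ker q' = RingHom.ker q := rfl
  -- Finiteness over the residue field follows since the kernel of `q'` is nilpotent and generated
  -- by the class of `π`.
  refine Module.finite_of_surjective_of_ker_le_nilradical q' hq ?_ ?_
  · rw [hk]
    exact fun x hx ↦ ⟨m, (Ideal.mem_bot).1 (hnil ▸ Ideal.pow_mem_pow hx m)⟩
  · rw [hk, hker]
    exact ⟨{Ideal.Quotient.mk (Ideal.span {π ^ m}) π}, by simp⟩

end CoefficientField

/-! ### The thickenings and the final argument. -/

namespace AlgebraicGeometry

section

attribute [local instance] MvPolynomial.gradedAlgebra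

instance (σ : Type*) (k : Type*) [CommRing k] [Finite σ] :
    Algebra.FiniteType (MvPolynomial.homogeneousSubmodule σ k 0) (MvPolynomial σ k) :=
  have : IsScalarTower k (MvPolynomial.homogeneousSubmodule σ k 0) (MvPolynomial σ k) :=
    ⟨fun a b c ↦ smul_mul_assoc a (b : MvPolynomial σ k) c⟩
  .of_restrictScalars_finiteType k _ _

lemma IsSmoothProjectiveThreefold.quasiCompact {k : Type u} [Field k] {X : Scheme.{u}}
    (s : X ⟶ Spec (CommRingCat.of k)) [h : IsSmoothProjectiveThreefold s] : QuasiCompact s := by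
  obtain ⟨n, i, hi, rfl⟩ := h.projective
  infer_instance

end

section Thickening

variable {k : Type u} [Field k] {X : Scheme.{u}} (s : X ⟶ Spec (CommRingCat.of k))
  {A B C : Type u} [CommRing A] [CommRing B] [CommRing C] [Algebra k A] [Algebra k B] [Algebra k C]

/-- The base change of `X` along a `k`-algebra. -/
noncomputable abbrev algebraBaseChange (A : Type u) [CommRing A] [Algebra k A] : Scheme.{u} :=
  pullback s (Spec.map (CommRingCat.ofHom (algebraMap k A)))

/-- The morphism between base changes of `X` induced by a morphism of `k`-algebras. -/
noncomputable def algebraBaseChangeMap (f : A →ₐ[k] B) :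
    algebraBaseChange s B ⟶ algebraBaseChange s A :=
  pullback.map _ _ _ _ (𝟙 X) (Spec.map (CommRingCat.ofHom f.toRingHom)) (𝟙 _) (by simp) (by
    rw [Category.comp_id, ← Spec.map_comp, ← CommRingCat.ofHom_comp]
    congr 2
    exact f.comp_algebraMap.symm)

lemma algebraBaseChangeMap_comp (f : A →ₐ[k] B) (g : B →ₐ[k] C) :
    algebraBaseChangeMap s g ≫ algebraBaseChangeMap s f = algebraBaseChangeMap s (g.comp f) := by
  unfold algebraBaseChangeMap
  refine pullback.hom_ext ?_ ?_
  · simp only [pullback.map, Category.assoc, pullback.lift_fst, Category.comp_id]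
  · simp only [pullback.map, Category.assoc, pullback.lift_snd, pullback.lift_snd_assoc,
      ← Spec.map_comp]
    rfl

lemma algebraBaseChangeMap_of_specMap (P : MorphismProperty Scheme.{u}) [P.IsMultiplicative]
    [P.IsStableUnderBaseChange] (f : A →ₐ[k] B)
    (h : P (Spec.map (CommRingCat.ofHom f.toRingHom))) : P (algebraBaseChangeMap s f) :=
  P.pullbackMap (P.id_mem X) h (Category.id_comp _).symm (by
    rw [← Spec.map_comp, ← CommRingCat.ofHom_comp]
    congr 2
    exact f.comp_algebraMap.symm)

instance (K : Type u) [Field K] [Algebra k K] [LocallyOfFiniteType s] :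
    IsLocallyNoetherian (algebraBaseChange s K) :=
  LocallyOfFiniteType.isLocallyNoetherian (pullback.snd s _)

variable {R : Type u} [CommRing R] [Algebra k R] (π : R)

instance [IsSmoothProjectiveThreefold s] (m : ℕ) : CompactSpace (thickening s π m) := by
  have := IsSmoothProjectiveThreefold.quasiCompact s
  unfold thickening
  infer_instance

variable (k) in
/-- The projection `R / π ^ m → R / π ^ m'`. -/
def quotientPowFactor {m' m : ℕ} (h : m' ≤ m) :
    R ⧸ Ideal.span {π ^ m} →ₐ[k] R ⧸ Ideal.span {π ^ m'} :=
  Ideal.Quotient.factorₐ k (Ideal.span_singleton_le_span_singleton.2 (pow_dvd_pow π h))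

lemma thickeningMap_eq {m' m : ℕ} (h : m' ≤ m) :
    thickeningMap s π h = algebraBaseChangeMap s (quotientPowFactor k π h) := rfl

variable (k) in
lemma quotientPowFactor_surjective {m' m : ℕ} (h : m' ≤ m) :
    Function.Surjective (quotientPowFactor k π h) :=
  Ideal.Quotient.factor_surjective
    (Ideal.span_singleton_le_span_singleton.2 (pow_dvd_pow π h))

variable (k) in
lemma quotientPowFactor_comp {m'' m' m : ℕ} (h₁ : m'' ≤ m') (h₂ : m' ≤ m) :
    (quotientPowFactor k π h₁).comp (quotientPowFactor k π h₂) =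
      quotientPowFactor k π (h₁.trans h₂) := by
  ext x
  obtain ⟨x, rfl⟩ := Ideal.Quotient.mk_surjective x
  rfl

instance {m' m : ℕ} (h : m' ≤ m) : IsClosedImmersion (thickeningMap s π h) := by
  rw [thickeningMap_eq]
  exact algebraBaseChangeMap_of_specMap s @IsClosedImmersion _
    (IsClosedImmersion.spec_of_surjective _ (quotientPowFactor_surjective k π h))

lemma thickeningMap_comp {m'' m' m : ℕ} (h₁ : m'' ≤ m') (h₂ : m' ≤ m) :
    thickeningMap s π h₁ ≫ thickeningMap s π h₂ = thickeningMap s π (h₁.trans h₂) := by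
  have e : algebraBaseChangeMap s ((quotientPowFactor k π h₁).comp (quotientPowFactor k π h₂)) =
      algebraBaseChangeMap s (quotientPowFactor k π (h₁.trans h₂)) := by
    rw [quotientPowFactor_comp]
  exact (algebraBaseChangeMap_comp s (quotientPowFactor k π h₂) (quotientPowFactor k π h₁)).trans e

variable [IsSmoothProjectiveThreefold s] [CharZero k] [IsNoetherianRing R]
  [(Ideal.span {π}).IsMaximal]

/-- The coefficient field gives a finite morphism `p` to the base change of `X` to the residue
field. Both `p` and its composite with the closed immersion come from algebras over a field, so they
are flat. -/
lemma isPullbackDerivable_thickeningMap {m' m : ℕ} (hm : 1 ≤ m) (h : m' ≤ m) :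
    Scheme.IsPullbackDerivable (thickeningMap s π h) := by
  obtain ⟨c, hc⟩ := exists_algHom_quotient_pow_finite k π hm
  let := Ideal.Quotient.field (Ideal.span {π})
  have := IsSmoothProjectiveThreefold.smooth (s := s)
  have : Smooth s := SmoothOfRelativeDimension.smooth 3 s
  let p : thickening s π m ⟶ algebraBaseChange s (R ⧸ Ideal.span {π}) := algebraBaseChangeMap s c
  have hp : IsFinite p := algebraBaseChangeMap_of_specMap s @IsFinite c
    ((IsFinite.SpecMap_iff _).2 hc)
  have hK : IsField (R ⧸ Ideal.span {π}) := Field.toIsField _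
  have hp' : Flat p := algebraBaseChangeMap_of_specMap s @Flat c
    (Flat.SpecMap_iff.2 (RingHom.Flat.of_isField hK _))
  let q := quotientPowFactor k π h
  have hq : thickeningMap s π h ≫ p = algebraBaseChangeMap s (q.comp c) :=
    algebraBaseChangeMap_comp s c q
  have hq' : Flat (thickeningMap s π h ≫ p) := by
    rw [hq]
    exact algebraBaseChangeMap_of_specMap s @Flat (q.comp c)
      (Flat.SpecMap_iff.2 (RingHom.Flat.of_isField hK _))
  exact Scheme.isPullbackDerivable (thickeningMap s π h) p

end Thickening

end AlgebraicGeometry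

/-- Let `X` be a smooth projective three-fold over `k` and let `R` be a discrete valuation ring over
`k` with uniformiser `π`. The tilted t-structures on `D(X_m)` and the derived pullbacks `Lι_{m,m'}^*`
between bounded above derived categories exist, and there are isomorphisms of functors
`H^0 Lι_{m,m''}^* ≅ (H^0 Lι_{m',m''}^*) ∘ (H^0 Lι_{m,m'}^*)` on `D^{≤ 0}`. -/
theorem corollary5p3 {k : Type u} [Field k] [IsAlgClosed k] [CharZero k]
    {X : Scheme.{u}} (s : X ⟶ Spec (CommRingCat.of k)) [IsSmoothProjectiveThreefold s]
    {R : Type u} [CommRing R] [IsDomain R] [IsDiscreteValuationRing R] [Algebra k R]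
    (π : R) (hπ : Irreducible π) :
    (∀ m : ℕ, 1 ≤ m → Nonempty (Scheme.PerverseTStructure (thickening s π m))) ∧
    (∀ (m' m : ℕ) (_ : 1 ≤ m') (h : m' < m),
      Nonempty (Scheme.LeftDerivedPullback (thickeningMap s π h.le))) ∧
    ∀ (m'' m' m : ℕ) (_ : 1 ≤ m'') (h₁ : m'' < m') (h₂ : m' < m)
      (τ' : Scheme.PerverseTStructure (thickening s π m'))
      (τ'' : Scheme.PerverseTStructure (thickening s π m''))
      (L : Scheme.LeftDerivedPullback (thickeningMap s π (h₁.trans h₂).le))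
      (L₁ : Scheme.LeftDerivedPullback (thickeningMap s π h₁.le))
      (L₂ : Scheme.LeftDerivedPullback (thickeningMap s π h₂.le)),
      Nonempty (L.H0 τ'' ≅ L₂.H0 τ' ⋙ L₁.H0 τ'') := by
  have : (Ideal.span {π}).IsMaximal :=
    PrincipalIdealRing.isMaximal_of_irreducible hπ
  have hle {m' m : ℕ} (h : m' ≤ m) (M) (hM : Scheme.cohLE (thickening s π m) 1 M) :
      Scheme.cohLE (thickening s π m') 1 ((Scheme.cohPullback (thickeningMap s π h)).obj M) :=
    hM.cohPullback (thickeningMap s π h).isClosedEmbedding.isInducing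
  refine ⟨fun m _ ↦ Scheme.nonempty_perverseTStructure _, fun m' m hm' h ↦
    (isPullbackDerivable_thickeningMap s π (by lia) h.le).nonempty_leftDerivedPullback,
    fun m'' m' m hm'' h₁ h₂ τ' τ'' L L₁ L₂ ↦ ?_⟩
  -- A t-structure on `D(X_m)` is auxiliary here: the isomorphism involves only its `D^{≤ 0}`, but
  -- right t-exactness of `Lι_{m,m'}^*` is proved with it.
  obtain ⟨τ⟩ := Scheme.nonempty_perverseTStructure (thickening s π m)
  exact Scheme.nonempty_H0_iso (thickeningMap_comp s π h₁.le h₂.le)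
    (isPullbackDerivable_thickeningMap s π (by lia) h₁.le)
    (isPullbackDerivable_thickeningMap s π (by lia) h₂.le)
    (isPullbackDerivable_thickeningMap s π (by lia) (h₁.trans h₂).le)
    (hle h₁.le) (hle h₂.le) τ'' τ' τ L L₁ L₂
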